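/- Let $m,m'\ge 1$. Consider a discrete memoryless broadcast channel $p(y_1,\dots,y_m,y'_1,\dots,y'_{m'}\mid x)$ with finite alphabets, one sender $X$ and receivers $Y_1,\dots,Y_m,Y'_1,\dots,Y'_{m'}$, which is multilevel: for every input pmf $p(x)$, $$X\to Y_1\to Y_2\to\cdots\to Y_m\qquad\text{and}\qquad X\to Y'_1\to Y'_2\to\cdots\to Y'_{m'}$$ are Markov chains. A code of length $n$ and rates $R_0,R_1\ge 0$ for degraded message sets encodes independent, uniformly distributed messages $M_0\in[1:2^{nR_0}]$ and $M_1\in[1:2^{nR_1}]$ into $X^n$ (no feedback); $M_0$ has to be recovered by all the receivers from their output sequences, and $M_1$ by $Y_1$ as well. The probability of error is the probability that at least one receiver errs. A pair $(R_0,R_1)$ is achievable if there are codes with these rates whose probability of error tends to $0$ as $n\to\infty$, and the capacity region is the closure of the set of achievable pairs. Then the capacity region is the set of all pairs $(R_0,R_1)$ with $R_0,R_1\ge 0$ such that $$R_0\le\min\{I(U;Y_m),\,I(V;Y'_{m'})\},\qquad R_1\le I(X;Y_1\mid U),\qquad R_0+R_1\le I(V;Y'_{m'})+I(X;Y_1\mid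 V)$$ for some pmf $p(u,v)\,p(x\mid v)$ with finite-valued auxiliary variables $U,V$, where $(U,V,X,Y_1,\dots,Y_m,Y'_1,\dots,Y'_{m'})$ has the joint pmf $p(u,v)\,p(x\mid v)\,p(y_1,\dots,y_m,y'_1,\dots,y'_{m'}\mid x)$ and mutual informations are measured in bits. -/

import Mathlib

/-! Finite probability spaces are given by a real probability mass function `P : Ω → ℝ` on a finite
type (a point of `stdSimplex ℝ Ω`), and random variables are functions on `Ω`. -/

namespace MultilevelBC

open Classical in
/-- The pmf `p_A(a) = P{A = a}` of the random variable `A` under the pmf `P`. -/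
noncomputable def law {Ω α : Type*} [Fintype Ω] (P : Ω → ℝ) (A : Ω → α) (a : α) : ℝ :=
  ∑ ω, if A ω = a then P ω else 0

/-- The mutual information `I(A;B) = ∑ p(a,b) log₂ (p(a,b) / (p(a) p(b)))`, in bits. A term with
`p(a,b) = 0` is zero. -/
noncomputable def mutualInfo {Ω α β : Type*} [Fintype Ω] [Fintype α] [Fintype β]
    (P : Ω → ℝ) (A : Ω → α) (B : Ω → β) : ℝ :=
  ∑ a, ∑ b, law P (fun ω => (A ω, B ω)) (a, b) *
    Real.logb 2 (law P (fun ω => (A ω, B ω)) (a, b) / (law P A a * law P B b))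

/-- The conditional mutual information
`I(A;B|C) = ∑ p(a,b,c) log₂ (p(a,b,c) p(c) / (p(a,c) p(b,c)))`, in bits. A term with
`p(a,b,c) = 0` is zero. -/
noncomputable def condMutualInfo {Ω α β γ : Type*} [Fintype Ω] [Fintype α] [Fintype β] [Fintype γ]
    (P : Ω → ℝ) (A : Ω → α) (B : Ω → β) (C : Ω → γ) : ℝ :=
  ∑ a, ∑ b, ∑ c, law P (fun ω => (A ω, B ω, C ω)) (a, b, c) *
    Real.logb 2 (law P (fun ω => (A ω, B ω, C ω)) (a, b, c) * law P C c /
      (law P (fun ω => (A ω, C ω)) (a, c) * law P (fun ω => (B ω, C ω)) (b, c)))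

/-- `A → B → C`: conditionally on `B`, the variables `A` and `C` are independent, that is
`p(a,b,c) p(b) = p(a,b) p(b,c)`. -/
def IsMarkovTriple {Ω α β γ : Type*} [Fintype Ω]
    (P : Ω → ℝ) (A : Ω → α) (B : Ω → β) (C : Ω → γ) : Prop :=
  ∀ a b c, law P (fun ω => (A ω, B ω, C ω)) (a, b, c) * law P B b =
    law P (fun ω => (A ω, B ω)) (a, b) * law P (fun ω => (B ω, C ω)) (b, c)

/-- `X → Y 0 → Y 1 → ⋯ → Y m` is a Markov chain: given the present `Y i`, the next variable
`Y (i + 1)` is independent of the past `(X, Y 0, …, Y (i - 1))`. -/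
def IsMarkovChain {Ω α : Type*} [Fintype Ω] {m : ℕ} {β : Fin (m + 1) → Type*}
    (P : Ω → ℝ) (X : Ω → α) (Y : ∀ i, Ω → β i) : Prop :=
  ∀ i : Fin m, IsMarkovTriple P
    (fun ω => (X ω, fun k : {k : Fin (m + 1) // k < i.castSucc} => Y k.1 ω))
    (Y i.castSucc) (Y i.succ)

/-- A discrete memoryless broadcast channel with two groups of receivers, given by its one-letter
transition probabilities `p(y₀,…,y_m, y'₀,…,y'_{m'} | x) = W x (y, y')`. -/
structure Channel {m m' : ℕ} (𝒳 : Type*) (𝒴 : Fin (m + 1) → Type*) (𝒴' : Fin (m' + 1) → Type*)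
    [∀ i, Fintype (𝒴 i)] [∀ j, Fintype (𝒴' j)] where
  /-- the transition probabilities -/
  W : 𝒳 → (∀ i, 𝒴 i) × (∀ j, 𝒴' j) → ℝ
  isPmf : ∀ x, W x ∈ stdSimplex ℝ ((∀ i, 𝒴 i) × (∀ j, 𝒴' j))

section

variable {m m' : ℕ} {𝒳 : Type*} {𝒴 : Fin (m + 1) → Type*} {𝒴' : Fin (m' + 1) → Type*}
  [Fintype 𝒳] [∀ i, Fintype (𝒴 i)] [∀ j, Fintype (𝒴' j)]

/-- The channel is multilevel: for every input pmf, `X → Y 0 → ⋯ → Y m` and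
`X → Y' 0 → ⋯ → Y' m'` are Markov chains. -/
def Channel.IsMultilevel (ch : Channel 𝒳 𝒴 𝒴') : Prop :=
  ∀ p ∈ stdSimplex ℝ 𝒳,
    IsMarkovChain (fun ω : 𝒳 × (∀ i, 𝒴 i) × (∀ j, 𝒴' j) => p ω.1 * ch.W ω.1 ω.2)
      (fun ω => ω.1) (fun i ω => ω.2.1 i) ∧
    IsMarkovChain (fun ω : 𝒳 × (∀ i, 𝒴 i) × (∀ j, 𝒴' j) => p ω.1 * ch.W ω.1 ω.2)
      (fun ω => ω.1) (fun j ω => ω.2.2 j)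

/-- The message set `[1 : 2^{nR}]`, with `⌈2^{nR}⌉` elements. -/
abbrev Msg (n : ℕ) (R : ℝ) : Type := Fin ⌈(2 : ℝ) ^ ((n : ℝ) * R)⌉₊

/-- A block code of length `n` with degraded message sets: the common message, of rate `R₀`, is
decoded by every receiver; the private message, of rate `R₁`, is decoded by the receiver `Y 0`. -/
structure Code (𝒳 : Type*) (𝒴 : Fin (m + 1) → Type*) (𝒴' : Fin (m' + 1) → Type*)
    (n : ℕ) (R₀ R₁ : ℝ) where
  /-- the encoder -/
  enc : Msg n R₀ → Msg n R₁ → Fin n → 𝒳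
  /-- the estimate of the common message at the receiver `Y i` -/
  dec : ∀ i, (Fin n → 𝒴 i) → Msg n R₀
  /-- the estimate of the common message at the receiver `Y' j` -/
  dec' : ∀ j, (Fin n → 𝒴' j) → Msg n R₀
  /-- the estimate of the private message at the receiver `Y 0` -/
  decPriv : (Fin n → 𝒴 0) → Msg n R₁

/-- Some receiver makes an error: `m₀`, `m₁` were sent, and `z k` is the tuple of all the channel
outputs at time `k`. -/
def Code.IsError {n : ℕ} {R₀ R₁ : ℝ} (c : Code 𝒳 𝒴 𝒴' n R₀ R₁) (m₀ : Msg n R₀) (m₁ : Msg n R₁)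
    (z : Fin n → (∀ i, 𝒴 i) × (∀ j, 𝒴' j)) : Prop :=
  (∃ i, c.dec i (fun k => (z k).1 i) ≠ m₀) ∨ (∃ j, c.dec' j (fun k => (z k).2 j) ≠ m₀) ∨
    c.decPriv (fun k => (z k).1 0) ≠ m₁

open Classical in
/-- The average probability of error, for independent and uniformly distributed messages, over the
memoryless channel without feedback. -/
noncomputable def Code.errorProb {n : ℕ} {R₀ R₁ : ℝ} (c : Code 𝒳 𝒴 𝒴' n R₀ R₁)
    (ch : Channel 𝒳 𝒴 𝒴') : ℝ :=
  (∑ m₀ : Msg n R₀, ∑ m₁ : Msg n R₁, ∑ z : Fin n → (∀ i, 𝒴 i) × (∀ j, 𝒴' j),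
    if c.IsError m₀ m₁ z then ∏ k, ch.W (c.enc m₀ m₁ k) (z k) else 0) /
  ((Fintype.card (Msg n R₀) : ℝ) * (Fintype.card (Msg n R₁) : ℝ))

/-- The rate pair `(R₀, R₁)` is achievable: there is a sequence of codes with these rates whose
probability of error tends to zero as the block length grows. -/
def Channel.Achievable (ch : Channel 𝒳 𝒴 𝒴') (R₀ R₁ : ℝ) : Prop :=
  ∃ c : ∀ n : ℕ, Code 𝒳 𝒴 𝒴' n R₀ R₁,
    Filter.Tendsto (fun n => (c n).errorProb ch) Filter.atTop (nhds 0)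

/-- The capacity region with degraded message sets: the closure of the set of the achievable pairs
`(R₀, R₁)` of nonnegative rates. -/
def Channel.capacityRegion (ch : Channel 𝒳 𝒴 𝒴') : Set (ℝ × ℝ) :=
  closure {R | 0 ≤ R.1 ∧ 0 ≤ R.2 ∧ ch.Achievable R.1 R.2}

/-- The joint pmf `p(u,v) p(x|v) p(y,y'|x)` of `(U, V, X, (Y, Y'))`. -/
def Channel.joint {𝒰 𝒱 : Type*} (ch : Channel 𝒳 𝒴 𝒴') (p : 𝒰 × 𝒱 → ℝ) (q : 𝒱 → 𝒳 → ℝ)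
    (ω : 𝒰 × 𝒱 × 𝒳 × (∀ i, 𝒴 i) × (∀ j, 𝒴' j)) : ℝ :=
  p (ω.1, ω.2.1) * q ω.2.1 ω.2.2.1 * ch.W ω.2.2.1 ω.2.2.2

end

end MultilevelBC

/-! Converse. Write F for the pair (Y 0, Y m) and G for the output Y' m'. Up to o(n), Fano's
inequality bounds nR₀ by I(M₀;(Y m)^n) and by I(M₀;G^n), nR₁ by I(M₁;F^n|M₀), and n(R₀+R₁) by
I(M₀;G^n) + I(M₁;F^n|M₀). The auxiliary letters are U_i = (M₀, F_1…F_{i-1}) and V_i = (U_i,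
G_{i+1}…G_n). Chain rules give the first three single-letter bounds. The fourth needs H(F^n|M₀) -
H(G^n|M₀) = Σ (H(F_i|V_i) - H(G_i|V_i)), a form of Csiszár's sum identity obtained by telescoping
over hybrid sequences (`sum_ent_mixed`). With the pair F in place of Y 0, the past of Y m is a
function of U_i; degradedness gives I(X;F|U) = I(X;Y 0|U) at the end.

The alphabets of U_i and V_i grow with n, and the region must turn out to be closed. Both points are
settled by `entropyHull`: auxiliaries U → V → X enter the bounds only through the pmf of X and four
conditional entropies, and the possible values of these form a nested convex hull in a
finite-dimensional space, compact by Carathéodory's theorem. Convexity is time sharing, compactness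
removes the vanishing slack (`Channel.exists_hullBounds_zero`), and every point of the hull comes
from finite auxiliaries (`exists_of_mem_entropyHull`).

Direct part. Superposition coding: U carries M₀, V a part of M₁ of rate S₁, and X the rest, of rate
S₂. The codebook is a random tree, and receivers use likelihood ratio tests with threshold 2^{nγ}. A
test rejects the codeword sent with exponentially small probability if γ is below the relevant
mutual information (Chernoff), and accepts an independent codeword with probability at most 2^{-nγ}
(Markov). Each Y i finds M₀ from U; each Y' j finds M₀ from V, whichever V-codeword passes (indirect
decoding); then Y 0 finds M₁. This works if R₀ < I(U;Y i), R₀+S₁ < I(V;Y' j), S₁+S₂ < I(X;Y 0|U) and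
S₂ < I(X;Y 0|V). By data processing the last receiver of each group is the worst, the choice S₂ =
min(R₁, I(X;Y 0|V)) eliminates the split, and strictness is obtained by scaling the rates by t < 1
and passing to the closure. -/

namespace MultilevelBC

open Finset Real

/-! ### Pmfs of random variables on a finite probability space. -/

section Law

variable {Ω α β γ δ : Type*} [Fintype Ω] {P : Ω → ℝ}

theorem law_nonneg (hP : ∀ ω, 0 ≤ P ω) (A : Ω → α) (a : α) : 0 ≤ law P A a := by
  unfold law
  exact sum_nonneg fun ω _ => by split_ifs <;> simp [hP]

theorem sum_law_mul [Fintype α] (P : Ω → ℝ) (A : Ω → α) (g : α → ℝ) :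
    ∑ a, law P A a * g a = ∑ ω, P ω * g (A ω) := by
  classical
  unfold law
  simp only [sum_mul, ite_mul, zero_mul]
  rw [sum_comm]
  exact sum_congr rfl fun ω _ => by simp

theorem sum_law [Fintype α] (P : Ω → ℝ) (A : Ω → α) : ∑ a, law P A a = ∑ ω, P ω := by
  simpa using sum_law_mul P A fun _ => 1

theorem le_law_apply (hP : ∀ ω, 0 ≤ P ω) (A : Ω → α) (ω : Ω) : P ω ≤ law P A (A ω) := by
  classical
  unfold law
  refine le_trans ?_ (single_le_sum (f := fun ω' => if A ω' = A ω then P ω' else 0) ?_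
    (mem_univ ω))
  · simp
  · intro i _
    split_ifs <;> simp [hP]

theorem law_apply_pos (hP : ∀ ω, 0 ≤ P ω) (A : Ω → α) {ω : Ω} (h : P ω ≠ 0) :
    0 < law P A (A ω) :=
  lt_of_lt_of_le (lt_of_le_of_ne (hP ω) h.symm) (le_law_apply hP A ω)

theorem law_congr {A : Ω → α} {B : Ω → β} (h : ∀ ω ω', A ω = A ω' ↔ B ω = B ω') (ω : Ω) :
    law P A (A ω) = law P B (B ω) := by
  unfold law
  refine sum_congr rfl fun ω' _ => ?_
  by_cases h' : A ω' = A ω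
  · rw [if_pos h', if_pos ((h _ _).1 h')]
  · rw [if_neg h', if_neg fun h'' => h' ((h _ _).2 h'')]

theorem law_congr_apply {A : Ω → α} {B : Ω → β} {a : α} {b : β} (h : ∀ ω, A ω = a ↔ B ω = b) :
    law P A a = law P B b := by
  unfold law
  refine sum_congr rfl fun ω' _ => ?_
  by_cases h' : A ω' = a
  · rw [if_pos h', if_pos ((h _).1 h')]
  · rw [if_neg h', if_neg fun h'' => h' ((h _).2 h'')]

theorem sum_law_pair [Fintype β] (P : Ω → ℝ) (A : Ω → α) (B : Ω → β) (a : α) :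
    ∑ b, law P (fun ω => (A ω, B ω)) (a, b) = law P A a := by
  classical
  unfold law
  rw [sum_comm]
  refine sum_congr rfl fun ω _ => ?_
  by_cases h : A ω = a <;> simp [h]

theorem sum_law_pair_left [Fintype α] (P : Ω → ℝ) (A : Ω → α) (B : Ω → β) (b : β) :
    ∑ a, law P (fun ω => (A ω, B ω)) (a, b) = law P B b := by
  rw [← sum_law_pair P B A b]
  exact sum_congr rfl fun a _ => law_congr_apply (by simp [and_comm])

theorem law_pair_le [Fintype β] (hP : ∀ ω, 0 ≤ P ω) (A : Ω → α) (B : Ω → β) (a : α) (b : β) :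
    law P (fun ω => (A ω, B ω)) (a, b) ≤ law P A a := by
  rw [← sum_law_pair P A B a]
  exact single_le_sum (f := fun b => law P (fun ω => (A ω, B ω)) (a, b))
    (fun b _ => law_nonneg hP _ _) (mem_univ b)

theorem law_mem_stdSimplex [Fintype α] (hP : P ∈ stdSimplex ℝ Ω) (A : Ω → α) :
    law P A ∈ stdSimplex ℝ α :=
  ⟨law_nonneg hP.1 A, by rw [sum_law, hP.2]⟩

end Law

/-! ### Shannon entropy: Gibbs' inequality, conditioning, Fano's inequality. -/

section Entropy

variable {Ω α β γ δ : Type*} [Fintype Ω] {P : Ω → ℝ}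

/-- The entropy of the random variable `A`, in bits. -/
noncomputable def ent (P : Ω → ℝ) (A : Ω → α) : ℝ :=
  -∑ ω, P ω * logb 2 (law P A (A ω))

theorem ent_congr (P : Ω → ℝ) {A : Ω → α} {B : Ω → β} (h : ∀ ω ω', A ω = A ω' ↔ B ω = B ω') :
    ent P A = ent P B := by
  unfold ent
  simp only [law_congr h]

theorem ent_eq_sum [Fintype α] (P : Ω → ℝ) (A : Ω → α) :
    ent P A = ∑ a, negMulLog (law P A a) / log 2 := by
  unfold ent
  rw [← sum_law_mul P A fun a => logb 2 (law P A a), ← sum_neg_distrib]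
  exact sum_congr rfl fun a _ => by unfold negMulLog logb; ring

theorem mutualInfo_eq [Fintype α] [Fintype β] (hP : ∀ ω, 0 ≤ P ω) (A : Ω → α) (B : Ω → β) :
    mutualInfo P A B = ent P A + ent P B - ent P fun ω => (A ω, B ω) := by
  have h := sum_law_mul P (fun ω => (A ω, B ω)) fun x =>
    logb 2 (law P (fun ω => (A ω, B ω)) x / (law P A x.1 * law P B x.2))
  rw [Fintype.sum_prod_type] at h
  unfold mutualInfo ent
  rw [h, ← neg_add, ← sum_add_distrib, sub_neg_eq_add, ← sum_neg_distrib, ← sum_add_distrib]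
  refine sum_congr rfl fun ω _ => ?_
  by_cases h0 : P ω = 0
  · simp [h0]
  have h1 := (law_apply_pos hP A h0).ne'
  have h2 := (law_apply_pos hP B h0).ne'
  have h3 := (law_apply_pos hP (fun ω => (A ω, B ω)) h0).ne'
  rw [logb_div h3 (mul_ne_zero h1 h2), logb_mul h1 h2]
  ring

theorem condMutualInfo_eq [Fintype α] [Fintype β] [Fintype γ] (hP : ∀ ω, 0 ≤ P ω)
    (A : Ω → α) (B : Ω → β) (C : Ω → γ) :
    condMutualInfo P A B C = ent P (fun ω => (A ω, C ω)) + ent P (fun ω => (B ω, C ω))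
      - ent P (fun ω => (A ω, B ω, C ω)) - ent P C := by
  have h := sum_law_mul P (fun ω => (A ω, B ω, C ω)) fun x =>
    logb 2 (law P (fun ω => (A ω, B ω, C ω)) x * law P C x.2.2 /
      (law P (fun ω => (A ω, C ω)) (x.1, x.2.2) * law P (fun ω => (B ω, C ω)) x.2))
  simp only [Fintype.sum_prod_type] at h
  unfold condMutualInfo ent
  rw [h]
  simp only [← sum_neg_distrib, ← sum_add_distrib, ← sum_sub_distrib]
  refine sum_congr rfl fun ω _ => ?_
  by_cases h0 : P ω = 0
  · simp [h0]
  have h1 := (law_apply_pos hP (fun ω => (A ω, C ω)) h0).ne'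
  have h2 := (law_apply_pos hP (fun ω => (B ω, C ω)) h0).ne'
  have h3 := (law_apply_pos hP (fun ω => (A ω, B ω, C ω)) h0).ne'
  have h4 := (law_apply_pos hP C h0).ne'
  rw [logb_div (mul_ne_zero h3 h4) (mul_ne_zero h1 h2), logb_mul h1 h2, logb_mul h3 h4]
  ring

/-- Conditional entropies are evaluated through a kernel `D`; the factorisation is needed on the
support only, since the other points have weight zero. -/
theorem ent_pair_sub (hP : ∀ ω, 0 ≤ P ω) (A : Ω → α) (B : Ω → β) (D : α → β → ℝ)
    (h : ∀ ω, P ω ≠ 0 → law P (fun ω => (A ω, B ω)) (A ω, B ω) = law P A (A ω) * D (A ω) (B ω)) :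
    ent P (fun ω => (A ω, B ω)) - ent P A = -∑ ω, P ω * logb 2 (D (A ω) (B ω)) := by
  unfold ent
  rw [sub_neg_eq_add, ← sum_neg_distrib, ← sum_neg_distrib, ← sum_add_distrib]
  refine sum_congr rfl fun ω _ => ?_
  by_cases h0 : P ω = 0
  · simp [h0]
  have h1 := (law_apply_pos hP A h0).ne'
  have h3 := (law_apply_pos hP (fun ω => (A ω, B ω)) h0).ne'
  rw [h ω h0] at h3 ⊢
  rw [logb_mul h1 (right_ne_zero_of_mul h3)]
  ring

/-- Gibbs' inequality for conditional entropy. -/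
theorem ent_pair_sub_le [Fintype α] [Fintype β] (hP : P ∈ stdSimplex ℝ Ω) (A : Ω → α) (B : Ω → β)
    (r : α → β → ℝ) (hr : ∀ a b, 0 ≤ r a b) (hr1 : ∀ a, ∑ b, r a b ≤ 1)
    (hpos : ∀ ω, P ω ≠ 0 → 0 < r (A ω) (B ω)) :
    ent P (fun ω => (A ω, B ω)) - ent P A ≤ -∑ ω, P ω * logb 2 (r (A ω) (B ω)) := by
  have hP0 := hP.1
  set J := law P fun ω => (A ω, B ω) with hJ
  have key : ∑ ω, P ω * (law P A (A ω) * r (A ω) (B ω) / J (A ω, B ω) - 1) ≤ 0 := by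
    rw [← sum_law_mul P (fun ω => (A ω, B ω))
      fun x => law P A x.1 * r x.1 x.2 / J x - 1, ← hJ]
    -- Where `J x = 0` the left side vanishes, so equality weakens to an inequality there.
    have h1 : ∀ x, J x * (law P A x.1 * r x.1 x.2 / J x - 1) ≤
        law P A x.1 * r x.1 x.2 - J x := by
      intro x
      by_cases h0 : J x = 0
      · rw [h0]
        simpa using mul_nonneg (law_nonneg hP0 _ _) (hr _ _)
      · apply le_of_eq
        field_simp
    refine (sum_le_sum fun x _ => h1 x).trans ?_
    rw [sum_sub_distrib, hJ, sum_law, hP.2, Fintype.sum_prod_type]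
    simp only [← mul_sum]
    have : ∑ a, law P A a * ∑ b, r a b ≤ ∑ a, law P A a * 1 :=
      sum_le_sum fun a _ => mul_le_mul_of_nonneg_left (hr1 a) (law_nonneg hP0 _ _)
    simp only [mul_one, sum_law, hP.2] at this
    linarith
  have h2 : ∀ ω, P ω * (logb 2 (r (A ω) (B ω)) + logb 2 (law P A (A ω)) - logb 2 (J (A ω, B ω))) ≤
      P ω * (law P A (A ω) * r (A ω) (B ω) / J (A ω, B ω) - 1) / log 2 := by
    intro ω
    by_cases h0 : P ω = 0
    · simp [h0]
    have h1 := (law_apply_pos hP0 A h0)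
    have h3 : 0 < J (A ω, B ω) := (law_apply_pos hP0 (fun ω => (A ω, B ω)) h0)
    have h4 := hpos ω h0
    have : logb 2 (r (A ω) (B ω)) + logb 2 (law P A (A ω)) - logb 2 (J (A ω, B ω)) =
        log (law P A (A ω) * r (A ω) (B ω) / J (A ω, B ω)) / log 2 := by
      rw [log_div (by positivity) (by positivity), log_mul (by positivity) (by positivity)]
      unfold logb
      ring
    rw [this, mul_div_assoc (P ω)]
    refine mul_le_mul_of_nonneg_left ?_ (hP0 ω)
    exact div_le_div_of_nonneg_right (log_le_sub_one_of_pos (by positivity))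
      (log_nonneg (by norm_num))
  have h3 := sum_le_sum fun ω (_ : ω ∈ univ) => h2 ω
  rw [← sum_div] at h3
  have h4 := h3.trans (div_nonpos_of_nonpos_of_nonneg key (log_nonneg (by norm_num)))
  unfold ent
  simp only [mul_sub, mul_add, sum_sub_distrib, sum_add_distrib] at h4
  linarith

/-- Conditioning reduces entropy. -/
theorem ent_triple_sub_le [Fintype α] [Fintype β] [Fintype γ] (hP : P ∈ stdSimplex ℝ Ω)
    (A : Ω → α) (B : Ω → β) (C : Ω → γ) :
    ent P (fun ω => ((A ω, B ω), C ω)) - ent P (fun ω => (A ω, B ω)) ≤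
      ent P (fun ω => (A ω, C ω)) - ent P A := by
  have hP0 := hP.1
  refine (ent_pair_sub_le hP (fun ω => (A ω, B ω)) C
    (fun x c => law P (fun ω => (A ω, C ω)) (x.1, c) / law P A x.1) ?_ ?_ ?_).trans ?_
  · exact fun a b => div_nonneg (law_nonneg hP0 _ _) (law_nonneg hP0 _ _)
  · intro a
    rw [← sum_div, sum_law_pair]
    exact div_self_le_one _
  · exact fun ω h => div_pos (law_apply_pos hP0 (fun ω => (A ω, C ω)) h) (law_apply_pos hP0 A h)
  · rw [ent_pair_sub hP0 A C fun a c => law P (fun ω => (A ω, C ω)) (a, c) / law P A a]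
    intro ω h
    field_simp [(law_apply_pos hP0 A h).ne']

theorem ent_unique [Subsingleton α] (hP : P ∈ stdSimplex ℝ Ω) (A : Ω → α) : ent P A = 0 := by
  have : ∀ ω, law P A (A ω) = 1 := fun ω => by
    unfold law
    rw [← hP.2]
    exact sum_congr rfl fun ω' _ => if_pos (Subsingleton.elim _ _)
  simp [ent, this]

theorem ent_pair_le [Fintype α] [Fintype β] (hP : P ∈ stdSimplex ℝ Ω) (A : Ω → α) (B : Ω → β) :
    ent P (fun ω => (A ω, B ω)) ≤ ent P A + ent P B := by
  have h := ent_triple_sub_le hP (fun _ => ()) A B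
  rw [ent_unique hP (fun _ : Ω => ()),
    ent_congr P (A := fun ω => (((), A ω), B ω)) (B := fun ω => (A ω, B ω)) (by simp),
    ent_congr P (A := fun ω => ((), A ω)) (B := A) (by simp),
    ent_congr P (A := fun ω => ((), B ω)) (B := B) (by simp)] at h
  linarith

/-- As `B` is a function of `A`, the pair `(B, A)` is as informative as `A`, and conditioning
reduces entropy. The converse uses this to discard letters or messages from a conditioning. -/
theorem ent_pair_cond_le [Fintype α] [Fintype β] [Fintype γ] (hP : P ∈ stdSimplex ℝ Ω)
    (A : Ω → α) (B : Ω → β) (C : Ω → γ) (h : ∀ ω ω', A ω = A ω' → B ω = B ω') :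
    ent P (fun ω => (A ω, C ω)) - ent P A ≤ ent P (fun ω => (B ω, C ω)) - ent P B := by
  have := ent_triple_sub_le hP B A C
  rw [ent_congr P (A := fun ω => ((B ω, A ω), C ω)) (B := fun ω => (A ω, C ω)),
    ent_congr P (A := fun ω => (B ω, A ω)) (B := A)] at this
  · exact this
  · intro ω ω'
    simp only [Prod.mk.injEq, and_iff_right_iff_imp]
    exact h ω ω'
  · intro ω ω'
    simp only [Prod.mk.injEq]
    exact ⟨fun hh => ⟨hh.1.2, hh.2⟩, fun hh => ⟨⟨h _ _ hh.1, hh.1⟩, hh.2⟩⟩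

/-- Fano's inequality. -/
theorem ent_fano [Fintype α] [Fintype β] (hP : P ∈ stdSimplex ℝ Ω) (Y : Ω → β)
    (M : Ω → α) (g : β → α) (E : Ω → Prop) [DecidablePred E]
    (hE : ∀ ω, g (Y ω) ≠ M ω → E ω) :
    ent P (fun ω => (Y ω, M ω)) - ent P Y ≤
      1 + (∑ ω, if E ω then P ω else 0) * logb 2 (Fintype.card α) := by
  classical
  rcases isEmpty_or_nonempty Ω with hΩ | ⟨⟨ω₀⟩⟩
  · have := hP.2
    simp at this
  have hN : (1 : ℝ) ≤ Fintype.card α := by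
    exact_mod_cast Fintype.card_pos_iff.2 ⟨M ω₀⟩
  have hN0 : (0 : ℝ) < Fintype.card α := by linarith
  -- Gibbs' inequality against the kernel with weight 1/2 at the guess `g y` and 1/(2N) at every
  -- other value, N being the number of values. Every outcome then costs one bit, and an error `logb
  -- 2 N` more; no binary entropy is needed.
  refine (ent_pair_sub_le hP Y M
    (fun y m => if g y = m then 1 / 2 else 1 / (2 * Fintype.card α)) ?_ ?_ ?_).trans ?_
  · intro a b
    split_ifs <;> positivity
  · intro y
    have : ∀ m, (if g y = m then (1 : ℝ) / 2 else 1 / (2 * Fintype.card α)) ≤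
        (if g y = m then 1 / 2 else 0) + 1 / (2 * Fintype.card α) := by
      intro m
      split_ifs
      · simp
      · simp
    refine (sum_le_sum fun m _ => this m).trans ?_
    rw [sum_add_distrib]
    simp only [sum_ite_eq, mem_univ, if_true, sum_const, card_univ, nsmul_eq_mul]
    apply le_of_eq
    field_simp
    norm_num
  · intro ω _
    split_ifs <;> positivity
  · rw [← sum_neg_distrib, sum_mul]
    rw [show (1 : ℝ) + ∑ ω, (if E ω then P ω else 0) * logb 2 (Fintype.card α : ℝ) =
      ∑ ω, (P ω + (if E ω then P ω else 0) * logb 2 (Fintype.card α : ℝ)) by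
        rw [sum_add_distrib, hP.2]]
    refine sum_le_sum fun ω _ => ?_
    have hl : 0 ≤ logb 2 (Fintype.card α : ℝ) := logb_nonneg (by norm_num) hN
    have h2 : logb 2 (1 / 2 : ℝ) = -1 := by
      rw [one_div, logb_inv, logb_self_eq_one (by norm_num)]
    have h3 : logb 2 (1 / (2 * Fintype.card α) : ℝ) = -1 - logb 2 (Fintype.card α) := by
      rw [one_div, logb_inv, logb_mul (by norm_num) hN0.ne', logb_self_eq_one (by norm_num)]
      ring
    by_cases h : g (Y ω) = M ω
    · rw [if_pos h, h2]
      have := hP.1 ω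
      split_ifs
      · nlinarith
      · simp
    · rw [if_neg h, if_pos (hE ω h), h3]
      apply le_of_eq
      ring

end Entropy

end MultilevelBC

namespace MultilevelBC

open Finset Real

theorem law_comp_pair {Ω α β γ : Type*} [Fintype Ω] [Fintype α] [DecidableEq γ] (P : Ω → ℝ)
    (A : Ω → α) (B : Ω → β) (f : α → γ) (c : γ) (b : β) :
    law P (fun ω => (f (A ω), B ω)) (c, b) =
      ∑ a, if f a = c then law P (fun ω => (A ω, B ω)) (a, b) else 0 := by
  rw [← sum_law_pair P (fun ω => (f (A ω), B ω)) A (c, b)]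
  refine sum_congr rfl fun a _ => ?_
  split_ifs with h
  · refine law_congr_apply fun ω => ?_
    simp only [Prod.mk.injEq]
    constructor
    · tauto
    · rintro ⟨rfl, rfl⟩
      exact ⟨⟨h, rfl⟩, rfl⟩
  · unfold law
    refine sum_eq_zero fun ω _ => if_neg ?_
    simp only [Prod.mk.injEq, not_and]
    rintro h' rfl
    exact h h'.1

/-! ### Disintegration of finite pmfs. -/

section Kernel

/-- A nonnegative function on a product disintegrates along its first marginal. -/
theorem exists_kernel {α β : Type*} [Fintype β] [Nonempty β] (J : α × β → ℝ) (hJ : ∀ x, 0 ≤ J x) :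
    ∃ k : α → β → ℝ, (∀ a, k a ∈ stdSimplex ℝ β) ∧ ∀ a b, J (a, b) = (∑ b', J (a, b')) * k a b := by
  classical
  obtain ⟨b₀⟩ := ‹Nonempty β›
  -- The point mass at `b₀` is a default, so that `k a` is a pmf even where the marginal vanishes.
  refine ⟨fun a b => if ∑ b', J (a, b') = 0 then (Pi.single b₀ 1 : β → ℝ) b else
    J (a, b) / ∑ b', J (a, b'),
    fun a => ?_, fun a b => ?_⟩
  · by_cases h : ∑ b', J (a, b') = 0
    · simp only [h, if_true]
      exact single_mem_stdSimplex ℝ b₀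
    · simp only [h, if_false]
      refine ⟨fun b => div_nonneg (hJ _) (sum_nonneg fun _ _ => hJ _), ?_⟩
      rw [← sum_div, div_self h]
  · by_cases h : ∑ b', J (a, b') = 0
    · have h' := (sum_eq_zero_iff_of_nonneg fun b' _ => hJ (a, b')).1 h b (mem_univ b)
      simp only [h, zero_mul, h']
    · simp only [h, if_false]
      field_simp

/-- The conditional pmf of `X` given `A`, defined also where `A` has probability zero. -/
theorem exists_condLaw {Ω α 𝒳 : Type*} [Fintype Ω] [Fintype 𝒳] {P : Ω → ℝ}
    (hP : P ∈ stdSimplex ℝ Ω) (A : Ω → α) (X : Ω → 𝒳) :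
    ∃ q : α → 𝒳 → ℝ, (∀ a, q a ∈ stdSimplex ℝ 𝒳) ∧
      ∀ a x, law P (fun ω => (A ω, X ω)) (a, x) = law P A a * q a x := by
  have : Nonempty Ω := by
    by_contra h
    rw [not_nonempty_iff] at h
    simpa using hP.2
  have : Nonempty 𝒳 := this.map X
  obtain ⟨k, hk, h⟩ := exists_kernel (law P fun ω => (A ω, X ω)) (law_nonneg hP.1 _)
  exact ⟨k, hk, fun a x => by rw [h, sum_law_pair]⟩

end Kernel

/-! ### Output entropies of a channel as functions of the input pmf. -/

section OutputEntropy

variable {Ω α γ 𝒳 β : Type*} [Fintype Ω] [Fintype 𝒳] [Fintype β]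

/-- The entropy of the output of the channel `w` with input pmf `q`. -/
noncomputable def outEnt (w : 𝒳 → β → ℝ) (q : 𝒳 → ℝ) : ℝ :=
  ∑ b, negMulLog (∑ x, q x * w x b) / log 2

/-- The conditional entropy of the output given the input of the channel `w` with input pmf `q`. -/
noncomputable def rowEnt (w : 𝒳 → β → ℝ) (q : 𝒳 → ℝ) : ℝ :=
  ∑ x, q x * ∑ b, negMulLog (w x b) / log 2

theorem continuous_outEnt (w : 𝒳 → β → ℝ) : Continuous (outEnt w) := by
  unfold outEnt
  exact continuous_finsetSum _ fun b _ => (continuous_negMulLog.comp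
    (continuous_finsetSum _ fun x _ => (continuous_apply x).mul continuous_const)).div_const _

theorem continuous_rowEnt (w : 𝒳 → β → ℝ) : Continuous (rowEnt w) := by
  unfold rowEnt
  exact continuous_finsetSum _ fun x _ => (continuous_apply x).mul continuous_const

theorem rowEnt_sum {ι : Type*} (s : Finset ι) (w : 𝒳 → β → ℝ) (c : ι → ℝ) (q : ι → 𝒳 → ℝ) :
    rowEnt w (∑ i ∈ s, c i • q i) = ∑ i ∈ s, c i * rowEnt w (q i) := by
  unfold rowEnt
  simp only [Finset.sum_apply, Pi.smul_apply, smul_eq_mul, sum_mul]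
  rw [sum_comm]
  refine sum_congr rfl fun i _ => ?_
  rw [mul_sum]
  refine sum_congr rfl fun x _ => ?_
  ring

/-- The output pmf is linear in the input pmf, and `negMulLog` is concave. Time sharing relies on
this. -/
theorem concaveOn_outEnt {w : 𝒳 → β → ℝ} (hw : ∀ x b, 0 ≤ w x b) :
    ConcaveOn ℝ (stdSimplex ℝ 𝒳) (outEnt w) := by
  refine ⟨convex_stdSimplex ℝ 𝒳, fun q hq q' hq' s t hs ht hst => ?_⟩
  unfold outEnt
  rw [smul_eq_mul, smul_eq_mul, mul_sum, mul_sum, ← sum_add_distrib]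
  refine sum_le_sum fun b _ => ?_
  have h := concaveOn_negMulLog.2 (x := ∑ x, q x * w x b) (y := ∑ x, q' x * w x b)
    (sum_nonneg fun x _ => mul_nonneg (hq.1 x) (hw x b))
    (sum_nonneg fun x _ => mul_nonneg (hq'.1 x) (hw x b)) hs ht hst
  have h2 : s • (∑ x, q x * w x b) + t • (∑ x, q' x * w x b) =
      ∑ x, (s • q + t • q') x * w x b := by
    simp only [smul_eq_mul, mul_sum, ← sum_add_distrib, Pi.add_apply, Pi.smul_apply]
    exact sum_congr rfl fun x _ => by ring
  rw [h2, smul_eq_mul, smul_eq_mul] at h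
  calc s * (negMulLog (∑ x, q x * w x b) / log 2) + t * (negMulLog (∑ x, q' x * w x b) / log 2)
      = (s * negMulLog (∑ x, q x * w x b) + t * negMulLog (∑ x, q' x * w x b)) / log 2 := by ring
    _ ≤ _ := div_le_div_of_nonneg_right h (log_nonneg (by norm_num))

/-- Given `A` and the input `X = x`, the output `B` has the pmf `w x`. -/
def IsOutput (P : Ω → ℝ) (A : Ω → α) (X : Ω → 𝒳) (B : Ω → β) (w : 𝒳 → β → ℝ) : Prop :=
  ∀ a x b, law P (fun ω => ((A ω, X ω), B ω)) ((a, x), b) =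
    law P (fun ω => (A ω, X ω)) (a, x) * w x b

variable {P : Ω → ℝ} {A : Ω → α} {X : Ω → 𝒳} {B : Ω → β} {w : 𝒳 → β → ℝ}

/-- The output law given `A` and `X` depends on the input alone, so it survives summation over the
fibres of `f`. This passes from conditioning on V to conditioning on U. -/
theorem IsOutput.comp [Fintype α] (h : IsOutput P A X B w) (f : α → γ) :
    IsOutput P (fun ω => f (A ω)) X B w := by
  classical
  intro c x b
  rw [law_congr_apply (B := fun ω => (f (A ω), X ω, B ω)) (b := (c, x, b))
    (by simp [and_assoc]), law_comp_pair P A _ f, law_comp_pair P A X f, sum_mul]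
  refine sum_congr rfl fun a _ => ?_
  split_ifs
  · rw [← h a x b]
    exact law_congr_apply (by simp [and_assoc])
  · simp

theorem IsOutput.law_pair (h : IsOutput P A X B w) (a : α) (b : β) :
    law P (fun ω => (A ω, B ω)) (a, b) = ∑ x, law P (fun ω => (A ω, X ω)) (a, x) * w x b := by
  rw [← sum_law_pair P (fun ω => (A ω, B ω)) X (a, b)]
  refine sum_congr rfl fun x _ => ?_
  rw [← h a x b]
  exact law_congr_apply fun ω => by
    simp only [Prod.mk.injEq]
    tauto

/-- Given `A = a` the input has pmf `q a`, so the conditional output entropy is a mixture of values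
of `outEnt w`. This is what places conditional entropies in a convex hull. -/
theorem IsOutput.ent_sub [Fintype α] (hP : ∀ ω, 0 ≤ P ω) (h : IsOutput P A X B w)
    {q : α → 𝒳 → ℝ} (hq : ∀ a x, law P (fun ω => (A ω, X ω)) (a, x) = law P A a * q a x) :
    ent P (fun ω => (A ω, B ω)) - ent P A = ∑ a, law P A a * outEnt w (q a) := by
  have h1 : ∀ a b, law P (fun ω => (A ω, B ω)) (a, b) = law P A a * ∑ x, q a x * w x b := by
    intro a b
    rw [h.law_pair, mul_sum]
    exact sum_congr rfl fun x _ => by rw [hq]; ring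
  rw [ent_pair_sub hP A B (fun a b => ∑ x, q a x * w x b) fun ω _ => h1 _ _,
    ← sum_law_mul P (fun ω => (A ω, B ω)) fun y => logb 2 (∑ x, q y.1 x * w x y.2),
    Fintype.sum_prod_type, ← sum_neg_distrib]
  refine sum_congr rfl fun a _ => ?_
  unfold outEnt
  rw [mul_sum, ← sum_neg_distrib]
  refine sum_congr rfl fun b _ => ?_
  rw [h1]
  unfold negMulLog logb
  ring

theorem IsOutput.ent_sub_input [Fintype α] (hP : ∀ ω, 0 ≤ P ω) (h : IsOutput P A X B w) :
    ent P (fun ω => ((A ω, X ω), B ω)) - ent P (fun ω => (A ω, X ω)) = rowEnt w (law P X) := by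
  rw [ent_pair_sub hP (fun ω => (A ω, X ω)) B (fun a b => w a.2 b) fun ω _ => h _ _ _,
    ← sum_law_mul P (fun ω => ((A ω, X ω), B ω)) fun y => logb 2 (w y.1.2 y.2)]
  simp only [Fintype.sum_prod_type]
  rw [sum_comm, ← sum_neg_distrib]
  refine sum_congr rfl fun x _ => ?_
  rw [sum_comm, mul_sum, ← sum_neg_distrib]
  refine sum_congr rfl fun b _ => ?_
  simp only [h _ _ _, mul_assoc]
  rw [← sum_mul, sum_law_pair_left P A X x]
  unfold negMulLog logb
  ring

/-- When `A` determines `X`, adjoining `X` to `A` changes no entropy. In the converse `A` contains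
both messages. -/
theorem IsOutput.ent_sub_of_det [Fintype α] (hP : ∀ ω, 0 ≤ P ω) (h : IsOutput P A X B w)
    (hX : ∀ ω ω', A ω = A ω' → X ω = X ω') :
    ent P (fun ω => (A ω, B ω)) - ent P A = rowEnt w (law P X) := by
  rw [← h.ent_sub_input hP]
  congr 1
  · refine ent_congr P fun ω ω' => ?_
    have := hX ω ω'
    simp only [Prod.mk.injEq]
    tauto
  · refine ent_congr P fun ω ω' => ?_
    have := hX ω ω'
    simp only [Prod.mk.injEq]
    tauto

theorem IsOutput.ent_eq [Fintype α] (h : IsOutput P A X B w) :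
    ent P B = outEnt w (law P X) := by
  rw [ent_eq_sum]
  unfold outEnt
  refine sum_congr rfl fun b _ => ?_
  have := (h.comp fun _ => ()).law_pair () b
  rw [law_congr_apply (b := b) (B := B) (by simp)] at this
  rw [this]
  congr 3
  ext x
  rw [law_congr_apply (b := x) (B := X) (by simp)]

end OutputEntropy

/-! ### The compact convex set of entropy values of auxiliary variables. -/

section Hull

theorem sum_eq_sum_of_embedding {ι κ F : Type*} [Fintype ι] [Fintype κ] [AddCommMonoid F]
    (e : ι ↪ κ) (g : ι → F) (G : κ → F) (h1 : ∀ i, G (e i) = g i)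
    (h2 : ∀ j, (¬∃ i, e i = j) → G j = 0) : ∑ j, G j = ∑ i, g i := by
  rw [← sum_congr rfl fun i _ => h1 i, ← sum_map univ e G]
  refine (sum_subset (subset_univ _) fun j _ hj => h2 j ?_).symm
  rintro ⟨i, hi⟩
  exact hj (by simp [← hi])

/-- By Carathéodory's theorem `finrank + 1` points suffice, so the hull is a continuous image of a
simplex of weights times a power of `s`. Shorter combinations are padded with the point `x₀` at
weight zero. -/
theorem isCompact_convexHull_of_isCompact {E : Type*} [AddCommGroup E] [Module ℝ E]
    [TopologicalSpace E] [IsTopologicalAddGroup E] [ContinuousSMul ℝ E] [FiniteDimensional ℝ E]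
    {s : Set E} (hs : IsCompact s) : IsCompact (convexHull ℝ s) := by
  classical
  rcases s.eq_empty_or_nonempty with rfl | ⟨x₀, hx₀⟩
  · simp
  set N := Module.finrank ℝ E + 1
  have hc : IsCompact ((fun y : (Fin N → ℝ) × (Fin N → E) => ∑ i, y.1 i • y.2 i) ''
      (stdSimplex ℝ (Fin N) ×ˢ Set.univ.pi fun _ => s)) := by
    refine ((isCompact_stdSimplex ℝ (Fin N)).prod (isCompact_univ_pi fun _ => hs)).image ?_
    fun_prop
  convert hc using 1
  apply Set.Subset.antisymm
  · intro x hx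
    obtain ⟨ι, hι, z, w, hz, haff, hw, hw1, hx⟩ := eq_pos_convex_span_of_mem_convexHull hx
    have hcard : Fintype.card ι ≤ Fintype.card (Fin N) := by
      rw [Fintype.card_fin]
      refine haff.card_le_finrank_succ.trans ?_
      exact Nat.add_le_add_right (Submodule.finrank_le _) 1
    obtain ⟨e⟩ := Function.Embedding.nonempty_of_card_le hcard
    have hch : ∀ i (h : ∃ i', e i' = e i), h.choose = i := fun i h => e.injective h.choose_spec
    refine ⟨(fun j => if h : ∃ i, e i = j then w h.choose else 0,
      fun j => if h : ∃ i, e i = j then z h.choose else x₀), ⟨⟨fun j => ?_, ?_⟩, fun j _ => ?_⟩, ?_⟩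
    · dsimp only
      split_ifs with h
      · exact (hw _).le
      · exact le_rfl
    · refine (sum_eq_sum_of_embedding e w _ (fun i => ?_) fun j h => dif_neg h).trans hw1
      rw [dif_pos ⟨i, rfl⟩, hch]
    · dsimp only
      split_ifs with h
      · exact hz (Set.mem_range_self _)
      · exact hx₀
    · rw [← hx]
      refine sum_eq_sum_of_embedding e _ _ (fun i => ?_) fun j h => ?_
      · dsimp only
        rw [dif_pos ⟨i, rfl⟩, dif_pos ⟨i, rfl⟩, hch]
      · dsimp only
        rw [dif_neg h, zero_smul]
  · rintro _ ⟨y, ⟨hy, hy'⟩, rfl⟩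
    exact (convex_convexHull ℝ s).sum_mem (fun i _ => hy.1 i) hy.2
      fun i _ => subset_convexHull ℝ s (hy' i trivial)

variable {𝒳 β₁ β₂ β₃ : Type*} [Fintype 𝒳] [Fintype β₁] [Fintype β₂] [Fintype β₃]

/-- The possible values of the pmf of `X` and the conditional entropies, given an auxiliary
variable, of the outputs of `w₃` and `w₁`. -/
noncomputable def innerHull (w₁ : 𝒳 → β₁ → ℝ) (w₃ : 𝒳 → β₃ → ℝ) : Set ((𝒳 → ℝ) × ℝ × ℝ) :=
  convexHull ℝ ((fun q => (q, outEnt w₃ q, outEnt w₁ q)) '' stdSimplex ℝ 𝒳)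

/-- The possible values of the pmf of `X`, of `H(Y₃|V)`, `H(Y₁|V)` and of `H(Y₂|U)`, `H(Y₁|U)`,
for auxiliary variables with `U → V → X`. -/
noncomputable def entropyHull (w₁ : 𝒳 → β₁ → ℝ) (w₂ : 𝒳 → β₂ → ℝ) (w₃ : 𝒳 → β₃ → ℝ) :
    Set (((𝒳 → ℝ) × ℝ × ℝ) × ℝ × ℝ) :=
  convexHull ℝ ((fun k => (k, outEnt w₂ k.1, outEnt w₁ k.1)) '' innerHull w₁ w₃)

variable (w₁ : 𝒳 → β₁ → ℝ) (w₂ : 𝒳 → β₂ → ℝ) (w₃ : 𝒳 → β₃ → ℝ)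

theorem isCompact_innerHull : IsCompact (innerHull w₁ w₃) := by
  refine isCompact_convexHull_of_isCompact ((isCompact_stdSimplex ℝ 𝒳).image ?_)
  exact continuous_id.prodMk ((continuous_outEnt _).prodMk (continuous_outEnt _))

theorem isCompact_entropyHull : IsCompact (entropyHull w₁ w₂ w₃) := by
  refine isCompact_convexHull_of_isCompact ((isCompact_innerHull w₁ w₃).image ?_)
  exact continuous_id.prodMk (((continuous_outEnt _).comp continuous_fst).prodMk
    ((continuous_outEnt _).comp continuous_fst))

theorem innerHull_fst {k : (𝒳 → ℝ) × ℝ × ℝ} (hk : k ∈ innerHull w₁ w₃) :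
    k.1 ∈ stdSimplex ℝ 𝒳 := by
  have : innerHull w₁ w₃ ⊆ LinearMap.fst ℝ (𝒳 → ℝ) (ℝ × ℝ) ⁻¹' stdSimplex ℝ 𝒳 := by
    refine convexHull_min ?_ ((convex_stdSimplex ℝ 𝒳).linear_preimage _)
    rintro _ ⟨q, hq, rfl⟩
    exact hq
  exact this hk

theorem entropyHull_fst {k : ((𝒳 → ℝ) × ℝ × ℝ) × ℝ × ℝ} (hk : k ∈ entropyHull w₁ w₂ w₃) :
    k.1.1 ∈ stdSimplex ℝ 𝒳 := by
  have : entropyHull w₁ w₂ w₃ ⊆ LinearMap.fst ℝ ((𝒳 → ℝ) × ℝ × ℝ) (ℝ × ℝ) ⁻¹' innerHull w₁ w₃ := by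
    refine convexHull_min ?_ ((convex_convexHull ℝ _).linear_preimage _)
    rintro _ ⟨q, hq, rfl⟩
    exact hq
  exact innerHull_fst w₁ w₃ (this hk)

variable {w₁ w₂ w₃}

/-- Mixing over V given `U = u` yields a point `k u` of the inner hull whose first component is the
pmf of X given `U = u`; averaging over `u` yields a point of the outer hull. Having `U = f(V)`
suffices for the converse, where V_i contains U_i. -/
theorem mem_entropyHull {Ω 𝒰 𝒱 : Type*} [Fintype Ω] [Fintype 𝒰] [Fintype 𝒱] {P : Ω → ℝ}
    (hP : P ∈ stdSimplex ℝ Ω) (V : Ω → 𝒱) (f : 𝒱 → 𝒰) (X : Ω → 𝒳)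
    {B₁ : Ω → β₁} {B₂ : Ω → β₂} {B₃ : Ω → β₃}
    (h₁ : IsOutput P V X B₁ w₁) (h₂ : IsOutput P V X B₂ w₂) (h₃ : IsOutput P V X B₃ w₃) :
    ((law P X, ent P (fun ω => (V ω, B₃ ω)) - ent P V, ent P (fun ω => (V ω, B₁ ω)) - ent P V),
      ent P (fun ω => (f (V ω), B₂ ω)) - ent P (fun ω => f (V ω)),
      ent P (fun ω => (f (V ω), B₁ ω)) - ent P (fun ω => f (V ω))) ∈ entropyHull w₁ w₂ w₃ := by
  classical
  have hP0 := hP.1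
  obtain ⟨q, hq, hqX⟩ := exists_condLaw hP V X
  obtain ⟨r, hr, hrV⟩ := exists_condLaw hP (fun ω => f (V ω)) V
  set k : 𝒰 → (𝒳 → ℝ) × ℝ × ℝ := fun u => ∑ v, r u v • (q v, outEnt w₃ (q v), outEnt w₁ (q v))
    with hk
  have hkmem : ∀ u, k u ∈ innerHull w₁ w₃ := fun u =>
    (convex_convexHull ℝ _).sum_mem (fun v _ => (hr u).1 v) (hr u).2
      fun v _ => subset_convexHull ℝ _ ⟨q v, hq v, rfl⟩
  have hk1 : ∀ u, (k u).1 = fun x => ∑ v, r u v * q v x := by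
    intro u
    ext x
    simp [hk, Prod.fst_sum]
  have hUX : ∀ u x, law P (fun ω => (f (V ω), X ω)) (u, x) =
      law P (fun ω => f (V ω)) u * (k u).1 x := by
    intro u x
    rw [hk1, mul_sum]
    simp only [← mul_assoc, ← hrV]
    rw [law_comp_pair P V X f]
    refine sum_congr rfl fun v _ => ?_
    have : law P (fun ω => (f (V ω), V ω)) (u, v) = if f v = u then law P V v else 0 := by
      rw [law_comp_pair P V V f, sum_eq_single v]
      · split_ifs
        · exact law_congr_apply (by simp)
        · rfl
      · intro v' _ hv'
        split_ifs
        · unfold law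
          refine sum_eq_zero fun ω _ => if_neg ?_
          simp only [Prod.mk.injEq, not_and]
          rintro rfl h
          exact hv' h
        · rfl
      · simp
    rw [this, hqX]
    split_ifs <;> simp
  have hmix : ∀ g : 𝒱 → ℝ, ∑ u, law P (fun ω => f (V ω)) u * ∑ v, r u v * g v =
      ∑ v, law P V v * g v := by
    intro g
    simp only [mul_sum, ← mul_assoc, ← hrV]
    rw [sum_comm]
    simp only [← sum_mul, sum_law_pair_left P (fun ω => f (V ω)) V]
  have hmem : ∑ u, law P (fun ω => f (V ω)) u • (k u, outEnt w₂ (k u).1, outEnt w₁ (k u).1) ∈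
      entropyHull w₁ w₂ w₃ :=
    (convex_convexHull ℝ _).sum_mem (fun u _ => law_nonneg hP0 _ _)
      (by rw [sum_law, hP.2]) fun u _ => subset_convexHull ℝ _ ⟨k u, hkmem u, rfl⟩
  convert hmem using 1
  simp only [h₃.ent_sub hP0 hqX, h₁.ent_sub hP0 hqX, (h₂.comp f).ent_sub hP0 hUX,
    (h₁.comp f).ent_sub hP0 hUX]
  have hX : ∀ x, law P X x = ∑ v, law P V v * q v x := by
    intro x
    simp only [← hqX, sum_law_pair_left P V X]
  ext x
  · simp only [Prod.fst_sum, Prod.smul_fst, Finset.sum_apply, Pi.smul_apply, smul_eq_mul, hk1]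
    rw [hmix fun v => q v x, hX]
  · simp only [hk, Prod.fst_sum, Prod.smul_fst, Prod.snd_sum, Prod.smul_snd, smul_eq_mul]
    rw [hmix fun v => outEnt w₃ (q v)]
  · simp only [hk, Prod.fst_sum, Prod.smul_fst, Prod.snd_sum, Prod.smul_snd, smul_eq_mul]
    rw [hmix fun v => outEnt w₁ (q v)]
  · simp only [Prod.fst_sum, Prod.smul_fst, Prod.snd_sum, Prod.smul_snd, smul_eq_mul]
  · simp only [Prod.snd_sum, Prod.smul_snd, smul_eq_mul]

end Hull

end MultilevelBC

namespace MultilevelBC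

open Finset Real

/-! ### Product laws with a fresh channel output, and degraded outputs. -/

section Output

variable {Ω Ω' α 𝒳 𝒵 β γ : Type*} [Fintype Ω] [Fintype Ω'] [Fintype 𝒵]

/-- The transition probabilities from the input to the function `φ` of the output. -/
noncomputable def outLaw (W : 𝒳 → 𝒵 → ℝ) (φ : 𝒵 → β) (x : 𝒳) (b : β) : ℝ := law (W x) φ b

theorem law_id (q : 𝒵 → ℝ) : (law q fun z => z) = q := by
  classical
  ext z
  unfold law
  rw [sum_eq_single z]
  · simp
  · intro b _ hb
    simp [hb]
  · simp

theorem outLaw_id (W : 𝒳 → 𝒵 → ℝ) : (outLaw W fun z => z) = W := by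
  ext x z
  unfold outLaw
  rw [law_id]

theorem outLaw_nonneg {W : 𝒳 → 𝒵 → ℝ} (hW : ∀ x, W x ∈ stdSimplex ℝ 𝒵) (φ : 𝒵 → β) (x : 𝒳)
    (b : β) : 0 ≤ outLaw W φ x b :=
  law_nonneg (hW x).1 _ _

theorem sum_outLaw [Fintype β] {W : 𝒳 → 𝒵 → ℝ} (hW : ∀ x, W x ∈ stdSimplex ℝ 𝒵) (φ : 𝒵 → β)
    (x : 𝒳) : ∑ b, outLaw W φ x b = 1 :=
  (law_mem_stdSimplex (hW x) φ).2

theorem law_prod (P' : Ω' → ℝ) (W : 𝒳 → 𝒵 → ℝ) (X : Ω' → 𝒳) (C : Ω' → α) (φ : 𝒵 → β)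
    {c : α} {x : 𝒳} (hX : ∀ ω, C ω = c → X ω = x) (b : β) :
    law (fun ω : Ω' × 𝒵 => P' ω.1 * W (X ω.1) ω.2) (fun ω => (C ω.1, φ ω.2)) (c, b) =
      law P' C c * outLaw W φ x b := by
  unfold outLaw law
  rw [sum_mul_sum, Fintype.sum_prod_type]
  refine sum_congr rfl fun ω _ => sum_congr rfl fun z _ => ?_
  by_cases h : C ω = c
  · by_cases h' : φ z = b
    · simp [h, h', hX ω h]
    · simp [h']
  · simp [h]

open Classical in
theorem law_equiv (e : Ω ≃ Ω') (P : Ω → ℝ) (A : Ω → α) (a : α) :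
    law P A a = law (fun ω => P (e.symm ω)) (fun ω => A (e.symm ω)) a := by
  unfold law
  exact (e.symm.sum_comp fun ω => if A ω = a then P ω else 0).symm

/-- The sample space splits into a part that carries `A` and `X` and an output drawn afresh from `W
(X)`. Both the single-letter joint pmf and one letter of the block pmf have this shape. -/
theorem isOutput_of_equiv (e : Ω ≃ Ω' × 𝒵) {P : Ω → ℝ} (P' : Ω' → ℝ) {W : 𝒳 → 𝒵 → ℝ}
    (hW : ∀ x, W x ∈ stdSimplex ℝ 𝒵) (A : Ω' → α) (X : Ω' → 𝒳) (φ : 𝒵 → β)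
    (hP : ∀ ω, P (e.symm ω) = P' ω.1 * W (X ω.1) ω.2) :
    IsOutput P (fun ω => A (e ω).1) (fun ω => X (e ω).1) (fun ω => φ (e ω).2) (outLaw W φ) := by
  intro a x b
  rw [law_equiv e, law_equiv e P]
  simp only [hP, Equiv.apply_symm_apply]
  have hX : ∀ ω, (A ω, X ω) = (a, x) → X ω = x := fun ω h => (Prod.mk.inj h).2
  rw [law_prod P' W X (fun ω => (A ω, X ω)) φ hX]
  have h1 := law_prod P' W X (fun ω => (A ω, X ω)) (fun _ => ()) hX ()
  have h2 : outLaw W (fun _ => ()) x () = 1 := by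
    have := sum_outLaw hW (fun _ => ()) x
    simpa using this
  rw [h2, mul_one] at h1
  rw [← h1]
  congr 1
  exact law_congr_apply (by simp)

/-- The output functions `f` and `g` satisfy `X → f → g` with a transition kernel that does not
depend on the input pmf. -/
def IsDegraded [Fintype γ] (W : 𝒳 → 𝒵 → ℝ) (f : 𝒵 → β) (g : 𝒵 → γ) : Prop :=
  ∃ D : β → γ → ℝ, (∀ b, D b ∈ stdSimplex ℝ γ) ∧
    ∀ x b c, outLaw W (fun z => (f z, g z)) x (b, c) = outLaw W f x b * D b c

theorem isDegraded_refl [Fintype β] (W : 𝒳 → 𝒵 → ℝ) (f : 𝒵 → β) : IsDegraded W f f := by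
  classical
  refine ⟨fun b => Pi.single b 1, fun b => single_mem_stdSimplex ℝ b, fun x b c => ?_⟩
  unfold outLaw
  by_cases h : c = b
  · subst h
    simp only [Pi.single_eq_same, mul_one]
    exact law_congr_apply (by simp)
  · beta_reduce
    rw [Pi.single_eq_of_ne h, mul_zero]
    unfold law
    refine sum_eq_zero fun ω _ => if_neg ?_
    simp only [Prod.mk.injEq, not_and]
    rintro rfl h'
    exact h h'.symm

variable [Fintype 𝒳]

/-- Kernels between consecutive outputs are composed by induction on `j`: since the past in the
Markov property includes X and `Y i`, the next kernel ignores them. The input pmf has full support,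
so it can be divided out and the identity becomes one about `W` alone. -/
theorem isDegraded_of_isMarkovChain [Nonempty 𝒳] {m : ℕ} {β : Fin (m + 1) → Type*}
    [∀ i, Fintype (β i)] {W : 𝒳 → 𝒵 → ℝ} (hW : ∀ x, W x ∈ stdSimplex ℝ 𝒵) {p : 𝒳 → ℝ}
    (hp : p ∈ stdSimplex ℝ 𝒳) (hpos : ∀ x, 0 < p x) (Y : ∀ i, 𝒵 → β i)
    (h : IsMarkovChain (fun ω : 𝒳 × 𝒵 => p ω.1 * W ω.1 ω.2) (fun ω => ω.1)
      (fun i ω => Y i ω.2)) {i j : Fin (m + 1)} (hij : i ≤ j) : IsDegraded W (Y i) (Y j) := by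
  classical
  induction j using Fin.induction with
  | zero =>
    obtain rfl : i = 0 := le_antisymm hij (Fin.zero_le _)
    exact isDegraded_refl W _
  | succ j ih =>
    rcases eq_or_lt_of_le hij with rfl | hlt
    · exact isDegraded_refl W _
    have hle : i ≤ j.castSucc := Fin.le_castSucc_iff.2 hlt
    obtain ⟨D, hD, hDW⟩ := ih hle
    set P : 𝒳 × 𝒵 → ℝ := fun ω => p ω.1 * W ω.1 ω.2 with hPdef
    have hP : P ∈ stdSimplex ℝ (𝒳 × 𝒵) := by
      refine ⟨fun ω => mul_nonneg (hp.1 _) ((hW _).1 _), ?_⟩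
      rw [Fintype.sum_prod_type]
      simp only [hPdef, ← mul_sum, (hW _).2, mul_one, hp.2]
    have hprod : ∀ {δ : Type _} (φ : 𝒵 → δ) x b,
        law P (fun ω => (ω.1, φ ω.2)) (x, b) = p x * outLaw W φ x b := by
      intro δ φ x b
      rw [law_prod p W (fun x => x) (fun x => x) φ (x := x) (fun _ h => h)]
      congr 1
      simp [law]
    obtain ⟨E, hE, hEP⟩ := exists_condLaw hP (fun ω => Y j.castSucc ω.2) (fun ω => Y j.succ ω.2)
    set past := fun ω : 𝒳 × 𝒵 =>
      (ω.1, fun k : {k : Fin (m + 1) // k < j.castSucc} => Y k.1 ω.2) with hpast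
    have hA : ∀ a b c, law P (fun ω => ((past ω, Y j.castSucc ω.2), Y j.succ ω.2)) ((a, b), c) =
        law P (fun ω => (past ω, Y j.castSucc ω.2)) (a, b) * E b c := by
      intro a b c
      have h1 := h j a b c
      rw [hEP] at h1
      rw [law_congr_apply (B := fun ω => (past ω, Y j.castSucc ω.2, Y j.succ ω.2))
        (b := (a, b, c)) (by simp [and_assoc])]
      by_cases h0 : law P (fun ω => Y j.castSucc ω.2) b = 0
      · have h2 : law P (fun ω => (past ω, Y j.castSucc ω.2)) (a, b) = 0 := by
          refine le_antisymm ?_ (law_nonneg hP.1 _ _)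
          rw [← h0, ← sum_law_pair_left P past fun ω => Y j.castSucc ω.2]
          exact single_le_sum
            (f := fun a => law P (fun ω => (past ω, Y j.castSucc ω.2)) (a, b))
            (fun a _ => law_nonneg hP.1 _ _) (mem_univ a)
        rw [h2, zero_mul]
        refine le_antisymm ?_ (law_nonneg hP.1 _ _)
        rw [← h2, law_congr_apply
          (B := fun ω => ((past ω, Y j.castSucc ω.2), Y j.succ ω.2)) (b := ((a, b), c))
          (by simp [and_assoc])]
        exact law_pair_le hP.1 _ _ _ _
      · refine mul_right_cancel₀ h0 (h1.trans ?_)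
        ring
    -- `Y i` is either the present output or one of the past ones, so `(X, Y i)` is a function of
    -- past and present.
    obtain ⟨f, hf⟩ : ∃ f : (𝒳 × (∀ k : {k : Fin (m + 1) // k < j.castSucc}, β k.1)) ×
        β j.castSucc → 𝒳 × β i, ∀ ω, f (past ω, Y j.castSucc ω.2) = (ω.1, Y i ω.2) := by
      rcases eq_or_lt_of_le hle with rfl | hlt'
      · exact ⟨fun a => (a.1.1, a.2), fun ω => rfl⟩
      · exact ⟨fun a => (a.1.1, a.1.2 ⟨i, hlt'⟩), fun ω => rfl⟩
    have hB : ∀ x a b c,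
        law P (fun ω => (((ω.1, Y i ω.2), Y j.castSucc ω.2), Y j.succ ω.2)) (((x, a), b), c) =
        law P (fun ω => ((ω.1, Y i ω.2), Y j.castSucc ω.2)) ((x, a), b) * E b c := by
      intro x a b c
      have h1 := law_comp_pair P (fun ω => (past ω, Y j.castSucc ω.2)) (fun ω => Y j.succ ω.2)
        (fun y => (f y, y.2)) ((x, a), b) c
      have h2 := law_comp_pair P (fun ω => (past ω, Y j.castSucc ω.2)) (fun _ => ())
        (fun y => (f y, y.2)) ((x, a), b) ()
      simp only [hf] at h1 h2
      rw [h1, law_congr_apply (A := fun ω : 𝒳 × 𝒵 => ((ω.1, Y i ω.2), Y j.castSucc ω.2))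
        (a := ((x, a), b))
        (B := fun ω : 𝒳 × 𝒵 => (((ω.1, Y i ω.2), Y j.castSucc ω.2), ())) (b := (((x, a), b), ()))
        (by simp), h2, sum_mul]
      refine sum_congr rfl fun y _ => ?_
      split_ifs with hy
      · obtain ⟨y1, y2⟩ := y
        obtain rfl : y2 = b := (Prod.mk.inj hy).2
        rw [hA]
        congr 1
        exact law_congr_apply (by simp)
      · simp
    refine ⟨fun a c => ∑ b, D a b * E b c, fun a => ⟨fun c => sum_nonneg fun b _ =>
      mul_nonneg ((hD a).1 b) ((hE b).1 c), ?_⟩, fun x a c => ?_⟩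
    · rw [sum_comm]
      simp only [← mul_sum, (hE _).2, mul_one, (hD a).2]
    · refine mul_left_cancel₀ (hpos x).ne' ?_
      rw [← hprod fun z => (Y i z, Y j.succ z), ← mul_assoc, ← hprod]
      have h3 : ∀ b, law P (fun ω => ((ω.1, Y i ω.2), Y j.castSucc ω.2)) ((x, a), b) =
          law P (fun ω => (ω.1, Y i ω.2)) (x, a) * D a b := by
        intro b
        rw [law_congr_apply (B := fun ω => (ω.1, Y i ω.2, Y j.castSucc ω.2)) (b := (x, a, b))
          (by simp [and_assoc]), hprod fun z => (Y i z, Y j.castSucc z), hDW, hprod]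
        ring
      rw [mul_sum, ← sum_law_pair P _ (fun ω => Y j.castSucc ω.2)]
      refine sum_congr rfl fun b _ => ?_
      rw [← mul_assoc, ← h3, ← hB]
      refine law_congr_apply fun ω => ?_
      simp only [Prod.mk.injEq]
      tauto

end Output

/-! ### Information inequalities for degraded outputs. -/

section Degraded

variable {Ω α 𝒳 𝒵 β γ : Type*} [Fintype Ω] [Fintype α] [Fintype 𝒳] [Fintype 𝒵] [Fintype β]
  [Fintype γ] {W : 𝒳 → 𝒵 → ℝ} {f : 𝒵 → β} {g : 𝒵 → γ} {P : Ω → ℝ} {A : Ω → α} {X : Ω → 𝒳}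
  {Z : Ω → 𝒵}

theorem IsOutput.map (h : IsOutput P A X Z W) (φ : 𝒵 → β) :
    IsOutput P A X (fun ω => φ (Z ω)) (outLaw W φ) := by
  classical
  intro a x b
  have h1 := law_comp_pair P Z (fun ω => (A ω, X ω)) φ b (a, x)
  rw [law_congr_apply (B := fun ω => (φ (Z ω), A ω, X ω)) (b := (b, a, x))
    (by simp [and_comm]), h1]
  have h2 : outLaw W φ x b = ∑ z, if φ z = b then W x z else 0 := by
    unfold outLaw law
    exact sum_congr rfl fun z _ => by split_ifs <;> rfl
  rw [h2, mul_sum]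
  refine sum_congr rfl fun z _ => ?_
  split_ifs
  · rw [← h a x z]
    exact law_congr_apply (by simp [and_comm])
  · simp

theorem IsOutput.law_degraded {D : β → γ → ℝ} (h : IsOutput P A X Z W)
    (hD : ∀ x b c, outLaw W (fun z => (f z, g z)) x (b, c) = outLaw W f x b * D b c)
    (a : α) (b : β) (c : γ) :
    law P (fun ω => ((A ω, f (Z ω)), g (Z ω))) ((a, b), c) =
      law P (fun ω => (A ω, f (Z ω))) (a, b) * D b c := by
  rw [(h.map f).law_pair, sum_mul, law_congr_apply (B := fun ω => (A ω, (f (Z ω), g (Z ω))))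
    (b := (a, b, c)) (by simp [and_assoc]), (h.map fun z => (f z, g z)).law_pair]
  exact sum_congr rfl fun x _ => by rw [hD]; ring

/-- Given `f`, the kernel `D` produces `g` without regard to `A`; both sides are the mean of `-logb
2 (D (f Z) (g Z))`. -/
theorem IsOutput.ent_degraded (hP : ∀ ω, 0 ≤ P ω) (h : IsOutput P A X Z W)
    (hfg : IsDegraded W f g) :
    ent P (fun ω => (A ω, (f (Z ω), g (Z ω)))) - ent P (fun ω => (A ω, f (Z ω))) =
      ent P (fun ω => (f (Z ω), g (Z ω))) - ent P (fun ω => f (Z ω)) := by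
  obtain ⟨D, -, hD⟩ := hfg
  have h1 := ent_pair_sub hP (fun ω => (A ω, f (Z ω))) (fun ω => g (Z ω)) (fun a b => D a.2 b)
    fun ω _ => h.law_degraded hD _ _ _
  have h2 := ent_pair_sub hP (fun ω => ((), f (Z ω))) (fun ω => g (Z ω)) (fun a b => D a.2 b)
    fun ω _ => (h.comp fun _ => ()).law_degraded hD _ _ _
  rw [ent_congr P (B := fun ω => (A ω, (f (Z ω), g (Z ω)))) (by simp [and_assoc])] at h1
  rw [ent_congr P (A := fun ω => (((), f (Z ω)), g (Z ω))) (B := fun ω => (f (Z ω), g (Z ω)))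
    (by simp), ent_congr P (A := fun ω => ((), f (Z ω))) (B := fun ω => f (Z ω)) (by simp)] at h2
  rw [h1, h2]

/-- The data processing inequality. -/
theorem IsOutput.mutualInfo_degraded_le (hP : P ∈ stdSimplex ℝ Ω) (h : IsOutput P A X Z W)
    (hfg : IsDegraded W f g) :
    mutualInfo P A (fun ω => g (Z ω)) ≤ mutualInfo P A fun ω => f (Z ω) := by
  rw [mutualInfo_eq hP.1, mutualInfo_eq hP.1]
  have h1 := h.ent_degraded hP.1 hfg
  have h2 := ent_triple_sub_le hP (fun ω => g (Z ω)) (fun ω => f (Z ω)) A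
  rw [ent_congr P (A := fun ω => ((g (Z ω), f (Z ω)), A ω))
    (B := fun ω => (A ω, (f (Z ω), g (Z ω)))) (by simp; tauto),
    ent_congr P (A := fun ω => (g (Z ω), f (Z ω))) (B := fun ω => (f (Z ω), g (Z ω)))
      (by simp; tauto),
    ent_congr P (A := fun ω => (g (Z ω), A ω)) (B := fun ω => (A ω, g (Z ω)))
      (by simp; tauto)] at h2
  linarith

theorem condMutualInfo_nonneg (hP : P ∈ stdSimplex ℝ Ω) (A : Ω → α) (B : Ω → β) (C : Ω → γ) :
    0 ≤ condMutualInfo P A B C := by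
  rw [condMutualInfo_eq hP.1]
  have h := ent_triple_sub_le hP C A B
  rw [ent_congr P (A := fun ω => ((C ω, A ω), B ω)) (B := fun ω => (A ω, B ω, C ω))
    (by simp; tauto), ent_congr P (A := fun ω => (C ω, A ω)) (B := fun ω => (A ω, C ω))
    (by simp; tauto), ent_congr P (A := fun ω => (C ω, B ω)) (B := fun ω => (B ω, C ω))
    (by simp; tauto)] at h
  linarith

/-- This is I(X;f,g) = I(X;f) for the input pmf `q`: the case `A = X` of `IsOutput.ent_degraded`. -/
theorem outEnt_sub_rowEnt_degraded (hW : ∀ x, W x ∈ stdSimplex ℝ 𝒵) (hfg : IsDegraded W f g)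
    {q : 𝒳 → ℝ} (hq : q ∈ stdSimplex ℝ 𝒳) :
    outEnt (outLaw W fun z => (f z, g z)) q - rowEnt (outLaw W fun z => (f z, g z)) q =
      outEnt (outLaw W f) q - rowEnt (outLaw W f) q := by
  set P : 𝒳 × 𝒵 → ℝ := fun ω => q ω.1 * W ω.1 ω.2 with hP
  have hP0 : ∀ ω, 0 ≤ P ω := fun ω => mul_nonneg (hq.1 _) ((hW _).1 _)
  have hO : IsOutput P (fun ω => ω.1) (fun ω => ω.1) (fun ω => ω.2) W := by
    have h := isOutput_of_equiv (Equiv.refl (𝒳 × 𝒵)) (P := P) q hW (fun x => x) (fun x => x)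
      (fun z => z) (fun ω => rfl)
    rwa [outLaw_id] at h
  have hX : law P (fun ω => ω.1) = q := by
    ext x
    rw [law_congr_apply (B := fun ω : 𝒳 × 𝒵 => (ω.1, ())) (b := (x, ())) (by simp),
      law_prod q W (fun x => x) (fun x => x) (fun _ => ()) (x := x) fun _ h => h]
    have : outLaw W (fun _ => ()) x () = 1 := by
      simpa using sum_outLaw hW (fun _ => ()) x
    rw [this, mul_one, law_id]
  have h0 := hO.ent_degraded hP0 hfg
  have h1 := (hO.map f).ent_sub_of_det hP0 fun _ _ h => h
  have h2 := (hO.map fun z => (f z, g z)).ent_sub_of_det hP0 fun _ _ h => h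
  have h3 := (hO.map f).ent_eq
  have h4 := (hO.map fun z => (f z, g z)).ent_eq
  rw [hX] at h1 h2 h3 h4
  linarith

/-- `I(X;B|A) = H(B|A) - H(B|X)`. -/
theorem IsOutput.condMutualInfo_eq (hP : ∀ ω, 0 ≤ P ω) {B : Ω → β} {w : 𝒳 → β → ℝ}
    (h : IsOutput P A X B w) :
    condMutualInfo P X B A = ent P (fun ω => (A ω, B ω)) - ent P A - rowEnt w (law P X) := by
  rw [MultilevelBC.condMutualInfo_eq hP, ← h.ent_sub_input hP,
    ent_congr P (A := fun ω => ((A ω, X ω), B ω)) (B := fun ω => (X ω, B ω, A ω))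
    (by simp; tauto), ent_congr P (A := fun ω => (A ω, X ω)) (B := fun ω => (X ω, A ω))
    (by simp; tauto), ent_congr P (A := fun ω => (A ω, B ω)) (B := fun ω => (B ω, A ω))
    (by simp; tauto)]
  ring

end Degraded

end MultilevelBC

namespace MultilevelBC

open Finset Real

/-! ### From points of the hull back to auxiliary variables. -/

section Auxiliary

variable {𝒳 β₁ β₂ β₃ : Type*} [Fintype 𝒳] [Fintype β₁] [Fintype β₂] [Fintype β₃]
  {w₁ : 𝒳 → β₁ → ℝ} {w₂ : 𝒳 → β₂ → ℝ} {w₃ : 𝒳 → β₃ → ℝ}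

theorem exists_of_mem_innerHull {k : (𝒳 → ℝ) × ℝ × ℝ} (hk : k ∈ innerHull w₁ w₃) :
    ∃ (n : ℕ) (d : Fin n → ℝ) (q : Fin n → 𝒳 → ℝ), d ∈ stdSimplex ℝ (Fin n) ∧
      (∀ v, q v ∈ stdSimplex ℝ 𝒳) ∧
      k = ∑ v, d v • (q v, outEnt w₃ (q v), outEnt w₁ (q v)) := by
  obtain ⟨ι, _, d, z, hd, hd1, hz, rfl⟩ := mem_convexHull_iff_exists_fintype.1 hk
  choose q hq hqz using hz
  refine ⟨Fintype.card ι, d ∘ (Fintype.equivFin ι).symm, q ∘ (Fintype.equivFin ι).symm,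
    ⟨fun v => hd _, ?_⟩, fun v => hq _, ?_⟩
  · rw [← hd1]
    exact (Fintype.equivFin ι).symm.sum_comp d
  · rw [← (Fintype.equivFin ι).symm.sum_comp]
    exact sum_congr rfl fun v _ => by simp [← hqz]

/-- A point of the entropy hull comes from auxiliary variables `U = f(V)` and `V`. -/
theorem exists_of_mem_entropyHull {k : ((𝒳 → ℝ) × ℝ × ℝ) × ℝ × ℝ}
    (hk : k ∈ entropyHull w₁ w₂ w₃) :
    ∃ (a b : ℕ) (f : Fin b → Fin a) (p : Fin b → ℝ) (q : Fin b → 𝒳 → ℝ) (r : Fin a → 𝒳 → ℝ),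
      p ∈ stdSimplex ℝ (Fin b) ∧ (∀ v, q v ∈ stdSimplex ℝ 𝒳) ∧
      (∀ u x, ∑ v, (if f v = u then p v * q v x else 0) = law p f u * r u x) ∧
      k.1.1 = (fun x => ∑ v, p v * q v x) ∧
      k.1.2.1 = ∑ v, p v * outEnt w₃ (q v) ∧ k.1.2.2 = ∑ v, p v * outEnt w₁ (q v) ∧
      k.2.1 = ∑ u, law p f u * outEnt w₂ (r u) ∧ k.2.2 = ∑ u, law p f u * outEnt w₁ (r u) := by
  classical
  obtain ⟨ι, _, c, z, hc, hc1, hz, rfl⟩ := mem_convexHull_iff_exists_fintype.1 hk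
  choose l hl hlz using hz
  choose n d q hd hq hl' using fun i => exists_of_mem_innerHull (hl i)
  set eU := Fintype.equivFin ι
  set eV := Fintype.equivFin (Σ i, Fin (n i))
  have hsum : ∀ {F : Type _} [AddCommMonoid F] (g : (Σ i, Fin (n i)) → F),
      ∑ v, g (eV.symm v) = ∑ i, ∑ j, g ⟨i, j⟩ := by
    intro F _ g
    rw [eV.symm.sum_comp g, ← univ_sigma_univ, sum_sigma]
  set p : Fin (Fintype.card (Σ i, Fin (n i))) → ℝ := fun v => c (eV.symm v).1 * d _ (eV.symm v).2
    with hp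
  -- A value of V is a pair (outer index, inner index) of the two nested convex combinations, and U
  -- is its outer index.
  set f := fun v => eU (eV.symm v).1 with hf
  have hflt : ∀ (g : (Σ i, Fin (n i)) → ℝ) i,
      ∑ v, (if f v = eU i then p v * g (eV.symm v) else 0) = c i * ∑ j, d i j * g ⟨i, j⟩ := by
    intro g i
    have := hsum fun s => if eU s.1 = eU i then c s.1 * d _ s.2 * g s else 0
    simp only [hf, hp, this]
    rw [sum_eq_single i]
    · simp [mul_sum, mul_assoc]
    · intro i' _ hi'
      simp [hi']
    · simp
  have hU : ∀ i, law p f (eU i) = c i := by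
    intro i
    have := hflt (fun _ => 1) i
    simp only [mul_one, (hd i).2] at this
    rw [← this]
    unfold law
    exact sum_congr rfl fun v _ => by split_ifs <;> rfl
  have hall : ∀ g : (Σ i, Fin (n i)) → ℝ, ∑ v, p v * g (eV.symm v) =
      ∑ i, c i * ∑ j, d i j * g ⟨i, j⟩ := by
    intro g
    have := hsum fun s => c s.1 * d _ s.2 * g s
    simp only [mul_assoc, ← mul_sum] at this
    simp only [hp, mul_assoc, this]
  have hl1 : ∀ i x, (l i).1 x = ∑ j, d i j * q i j x := by
    intro i x
    rw [hl' i]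
    simp [Prod.fst_sum]
  refine ⟨_, _, f, p, fun v => q _ (eV.symm v).2, fun u => (l (eU.symm u)).1,
    ⟨fun v => mul_nonneg (hc _) ((hd _).1 _), ?_⟩, fun v => hq _ _, fun u x => ?_, ?_, ?_, ?_,
    ?_, ?_⟩
  · have := hall fun _ => 1
    simpa [(hd _).2, hc1] using this
  · obtain ⟨i, rfl⟩ := eU.surjective u
    rw [hflt fun s => q _ s.2 x, hU]
    beta_reduce
    rw [Equiv.symm_apply_apply, hl1]
  · ext x
    rw [hall fun s => q _ s.2 x]
    simp [← hlz, Prod.fst_sum, hl1]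
  · rw [hall fun s => outEnt w₃ (q _ s.2)]
    simp only [← hlz, Prod.fst_sum, Prod.snd_sum, Prod.smul_fst, Prod.smul_snd, smul_eq_mul]
    refine sum_congr rfl fun i _ => ?_
    rw [hl' i]
    simp [Prod.fst_sum, Prod.snd_sum]
  · rw [hall fun s => outEnt w₁ (q _ s.2)]
    simp only [← hlz, Prod.fst_sum, Prod.snd_sum, Prod.smul_fst, Prod.smul_snd, smul_eq_mul]
    refine sum_congr rfl fun i _ => ?_
    rw [hl' i]
    simp [Prod.snd_sum]
  · rw [← eU.sum_comp]
    simp [← hlz, Prod.fst_sum, Prod.snd_sum, hU]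
  · rw [← eU.sum_comp]
    simp [← hlz, Prod.snd_sum, hU]

end Auxiliary

/-! ### Marginals of the joint pmf of (U, V, X, outputs). -/

section Joint

variable {m m' : ℕ} {𝒰 𝒱 𝒳 : Type*} {𝒴 : Fin (m + 1) → Type*} {𝒴' : Fin (m' + 1) → Type*}
  [Fintype 𝒰] [Fintype 𝒱] [Fintype 𝒳] [∀ i, Fintype (𝒴 i)] [∀ j, Fintype (𝒴' j)]
  (ch : Channel 𝒳 𝒴 𝒴') {p : 𝒰 × 𝒱 → ℝ} {q : 𝒱 → 𝒳 → ℝ}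

/-- Reassociation of the sample space of `Channel.joint`. -/
def jointEquiv (𝒰 𝒱 𝒳 𝒵 : Type*) : 𝒰 × 𝒱 × 𝒳 × 𝒵 ≃ (𝒰 × 𝒱 × 𝒳) × 𝒵 where
  toFun ω := ((ω.1, ω.2.1, ω.2.2.1), ω.2.2.2)
  invFun ω := (ω.1.1, ω.1.2.1, ω.1.2.2, ω.2)
  left_inv _ := rfl
  right_inv _ := rfl

theorem isOutput_joint (p : 𝒰 × 𝒱 → ℝ) (q : 𝒱 → 𝒳 → ℝ) :
    IsOutput (ch.joint p q) (fun ω => (ω.1, ω.2.1)) (fun ω => ω.2.2.1) (fun ω => ω.2.2.2) ch.W := by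
  have h := isOutput_of_equiv (jointEquiv 𝒰 𝒱 𝒳 ((∀ i, 𝒴 i) × (∀ j, 𝒴' j))) (P := ch.joint p q)
    (fun ω => p (ω.1, ω.2.1) * q ω.2.1 ω.2.2) ch.isPmf (fun ω => (ω.1, ω.2.1))
    (fun ω => ω.2.2) (fun z => z) (fun ω => rfl)
  rwa [outLaw_id] at h

theorem law_joint (p : 𝒰 × 𝒱 → ℝ) (q : 𝒱 → 𝒳 → ℝ) (u : 𝒰) (v : 𝒱) (x : 𝒳) :
    law (ch.joint p q) (fun ω => (ω.1, ω.2.1, ω.2.2.1)) (u, v, x) = p (u, v) * q v x := by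
  rw [law_equiv (jointEquiv _ _ _ _), law_congr_apply (B := fun ω => (ω.1, ()))
    (b := ((u, v, x), ())) (by simp [jointEquiv])]
  have h2 : outLaw ch.W (fun _ => ()) x () = 1 := by
    simpa using sum_outLaw ch.isPmf (fun _ => ()) x
  have := law_prod (𝒵 := (∀ i, 𝒴 i) × (∀ j, 𝒴' j)) (fun ω : 𝒰 × 𝒱 × 𝒳 => p (ω.1, ω.2.1) *
    q ω.2.1 ω.2.2) ch.W (fun ω => ω.2.2)
    (fun ω => ω) (fun _ => ()) (c := (u, v, x)) (x := x) (by rintro _ rfl; rfl) ()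
  rw [h2, mul_one, law_id] at this
  exact this

variable {ch}

theorem law_joint_VX (v : 𝒱) (x : 𝒳) :
    law (ch.joint p q) (fun ω => (ω.2.1, ω.2.2.1)) (v, x) = (∑ u, p (u, v)) * q v x := by
  rw [← sum_law_pair_left _ (fun ω => ω.1), sum_mul]
  exact sum_congr rfl fun u _ => law_joint ch p q u v x

theorem law_joint_UX (u : 𝒰) (x : 𝒳) :
    law (ch.joint p q) (fun ω => (ω.1, ω.2.2.1)) (u, x) = ∑ v, p (u, v) * q v x := by
  rw [← sum_law_pair_left _ (fun ω => ω.2.1)]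
  refine sum_congr rfl fun v _ => ?_
  rw [← law_joint ch p q u v x]
  refine law_congr_apply fun ω => ?_
  simp only [Prod.mk.injEq]
  tauto

theorem law_joint_UV (hq : ∀ v, q v ∈ stdSimplex ℝ 𝒳) (u : 𝒰) (v : 𝒱) :
    law (ch.joint p q) (fun ω => (ω.1, ω.2.1)) (u, v) = p (u, v) := by
  rw [← sum_law_pair _ _ (fun ω => ω.2.2.1)]
  rw [← mul_one (p (u, v)), ← (hq v).2, mul_sum]
  refine sum_congr rfl fun x _ => ?_
  rw [← law_joint ch p q u v x]
  exact law_congr_apply (by simp [and_assoc])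

theorem law_joint_U (hq : ∀ v, q v ∈ stdSimplex ℝ 𝒳) (u : 𝒰) :
    law (ch.joint p q) (fun ω => ω.1) u = ∑ v, p (u, v) := by
  rw [← sum_law_pair _ _ (fun ω => ω.2.1)]
  exact sum_congr rfl fun v _ => law_joint_UV hq u v

theorem law_joint_V (hq : ∀ v, q v ∈ stdSimplex ℝ 𝒳) (v : 𝒱) :
    law (ch.joint p q) (fun ω => ω.2.1) v = ∑ u, p (u, v) := by
  rw [← sum_law_pair_left _ (fun ω => ω.1)]
  exact sum_congr rfl fun u _ => law_joint_UV hq u v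

theorem law_joint_X (x : 𝒳) :
    law (ch.joint p q) (fun ω => ω.2.2.1) x = ∑ v, (∑ u, p (u, v)) * q v x := by
  rw [← sum_law_pair_left _ (fun ω => ω.2.1)]
  exact sum_congr rfl fun v _ => law_joint_VX v x

theorem joint_mem_stdSimplex (hp : p ∈ stdSimplex ℝ (𝒰 × 𝒱)) (hq : ∀ v, q v ∈ stdSimplex ℝ 𝒳) :
    ch.joint p q ∈ stdSimplex ℝ (𝒰 × 𝒱 × 𝒳 × (∀ i, 𝒴 i) × (∀ j, 𝒴' j)) := by
  refine ⟨fun ω => mul_nonneg (mul_nonneg (hp.1 _) ((hq _).1 _)) ((ch.isPmf _).1 _), ?_⟩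
  rw [← sum_law _ fun ω : 𝒰 × 𝒱 × 𝒳 × (∀ i, 𝒴 i) × (∀ j, 𝒴' j) => (ω.1, ω.2.1), ← hp.2]
  exact sum_congr rfl fun x _ => law_joint_UV hq x.1 x.2

/-- `I(X;f,g|A) = I(X;f|A)` when `g` is a degraded version of `f`. -/
theorem IsOutput.condMutualInfo_degraded {Ω α 𝒵 β γ : Type*} [Fintype Ω] [Fintype α] [Fintype 𝒵]
    [Fintype β] [Fintype γ] {W : 𝒳 → 𝒵 → ℝ} {f : 𝒵 → β} {g : 𝒵 → γ} {P : Ω → ℝ} {A : Ω → α}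
    {X : Ω → 𝒳} {Z : Ω → 𝒵} (hP : P ∈ stdSimplex ℝ Ω) (hW : ∀ x, W x ∈ stdSimplex ℝ 𝒵)
    (h : IsOutput P A X Z W) (hfg : IsDegraded W f g) :
    condMutualInfo P X (fun ω => (f (Z ω), g (Z ω))) A =
      condMutualInfo P X (fun ω => f (Z ω)) A := by
  rw [(h.map fun z => (f z, g z)).condMutualInfo_eq hP.1, (h.map f).condMutualInfo_eq hP.1]
  have h1 := h.ent_degraded hP.1 hfg
  have h2 := outEnt_sub_rowEnt_degraded hW hfg (law_mem_stdSimplex hP X)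
  have h3 := (h.map f).ent_eq
  have h4 := (h.map fun z => (f z, g z)).ent_eq
  linarith

end Joint

/-! ### Rate bounds in terms of the entropy hull. -/

section Region

variable {m m' : ℕ} {𝒳 : Type*} {𝒴 : Fin (m + 1) → Type*} {𝒴' : Fin (m' + 1) → Type*}
  [Fintype 𝒳] [∀ i, Fintype (𝒴 i)] [∀ j, Fintype (𝒴' j)] (ch : Channel 𝒳 𝒴 𝒴')

/-- The rate bounds of the capacity region, for auxiliary variables with pmfs `p(u,v)`, `q(x|v)`. -/
def Channel.RateBounds {𝒰 𝒱 : Type*} [Fintype 𝒰] [Fintype 𝒱] (R₀ R₁ : ℝ) (p : 𝒰 × 𝒱 → ℝ)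
    (q : 𝒱 → 𝒳 → ℝ) : Prop :=
  R₀ ≤ mutualInfo (ch.joint p q) (fun ω => ω.1) (fun ω => ω.2.2.2.1 (Fin.last m)) ∧
  R₀ ≤ mutualInfo (ch.joint p q) (fun ω => ω.2.1) (fun ω => ω.2.2.2.2 (Fin.last m')) ∧
  R₁ ≤ condMutualInfo (ch.joint p q) (fun ω => ω.2.2.1) (fun ω => ω.2.2.2.1 0) (fun ω => ω.1) ∧
  R₀ + R₁ ≤ mutualInfo (ch.joint p q) (fun ω => ω.2.1) (fun ω => ω.2.2.2.2 (Fin.last m')) +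
    condMutualInfo (ch.joint p q) (fun ω => ω.2.2.1) (fun ω => ω.2.2.2.1 0) (fun ω => ω.2.1)

/-- The transition probabilities to the pair of outputs `Y 0`, `Y m`. -/
noncomputable abbrev Channel.w₁ : 𝒳 → 𝒴 0 × 𝒴 (Fin.last m) → ℝ :=
  outLaw ch.W fun z => (z.1 0, z.1 (Fin.last m))

/-- The transition probabilities to the output `Y m`. -/
noncomputable abbrev Channel.w₂ : 𝒳 → 𝒴 (Fin.last m) → ℝ := outLaw ch.W fun z => z.1 (Fin.last m)

/-- The transition probabilities to the output `Y' m'`. -/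
noncomputable abbrev Channel.w₃ : 𝒳 → 𝒴' (Fin.last m') → ℝ :=
  outLaw ch.W fun z => z.2 (Fin.last m')

/-- The rate bounds at a point of the entropy hull, with slack `δ`. -/
def Channel.HullBounds (R₀ R₁ δ : ℝ) (k : ((𝒳 → ℝ) × ℝ × ℝ) × ℝ × ℝ) : Prop :=
  R₀ ≤ outEnt ch.w₂ k.1.1 - k.2.1 + δ ∧ R₀ ≤ outEnt ch.w₃ k.1.1 - k.1.2.1 + δ ∧
  R₁ ≤ k.2.2 - rowEnt ch.w₁ k.1.1 + δ ∧
  R₀ + R₁ ≤ outEnt ch.w₃ k.1.1 - k.1.2.1 + (k.1.2.2 - rowEnt ch.w₁ k.1.1) + δ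

variable {ch}

/-- The pmf of (U, V) is carried by the graph `u = f v`. The hull speaks of the pair (Y 0, Y m), and
degradedness reduces its conditional informations to those of Y 0. -/
theorem Channel.HullBounds.exists_rateBounds (hdeg : IsDegraded ch.W (fun z => z.1 0)
    (fun z => z.1 (Fin.last m))) {R₀ R₁ : ℝ} {k : ((𝒳 → ℝ) × ℝ × ℝ) × ℝ × ℝ}
    (hk : k ∈ entropyHull ch.w₁ ch.w₂ ch.w₃) (h : ch.HullBounds R₀ R₁ 0 k) :
    ∃ (a b : ℕ) (p : Fin a × Fin b → ℝ) (q : Fin b → 𝒳 → ℝ),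
      p ∈ stdSimplex ℝ (Fin a × Fin b) ∧ (∀ v, q v ∈ stdSimplex ℝ 𝒳) ∧
      ch.RateBounds R₀ R₁ p q := by
  obtain ⟨a, b, f, pV, q, r, hpV, hq, hr, h1, h2, h3, h4, h5⟩ := exists_of_mem_entropyHull hk
  set p : Fin a × Fin b → ℝ := fun x => if f x.2 = x.1 then pV x.2 else 0 with hp
  have hpmem : p ∈ stdSimplex ℝ (Fin a × Fin b) := by
    refine ⟨fun x => ?_, ?_⟩
    · simp only [hp]
      split_ifs
      · exact hpV.1 _
      · exact le_rfl
    · rw [Fintype.sum_prod_type_right]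
      simpa [hp] using hpV.2
  refine ⟨a, b, p, q, hpmem, hq, ?_⟩
  have hP := joint_mem_stdSimplex (ch := ch) hpmem hq
  have hP0 := hP.1
  have hO := isOutput_joint ch p q
  have hOU := hO.comp fun x => x.1
  have hOV := hO.comp fun x => x.2
  have hpV' : ∀ v, ∑ u, p (u, v) = pV v := fun v => by simp [hp]
  have hX : law (ch.joint p q) (fun ω => ω.2.2.1) = k.1.1 := by
    rw [h1]
    ext x
    rw [law_joint_X]
    simp only [hpV']
  have hlawV : ∀ v, law (ch.joint p q) (fun ω => ω.2.1) v = pV v := by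
    intro v
    rw [law_joint_V hq, hpV']
  have hlawU : ∀ u, law (ch.joint p q) (fun ω => ω.1) u = law pV f u := by
    intro u
    rw [law_joint_U hq]
    unfold law
    exact sum_congr rfl fun v _ => by simp only [hp]; split_ifs <;> rfl
  have hVX : ∀ v x, law (ch.joint p q) (fun ω => (ω.2.1, ω.2.2.1)) (v, x) =
      law (ch.joint p q) (fun ω => ω.2.1) v * q v x := by
    intro v x
    rw [law_joint_VX, hlawV, hpV']
  have hUX : ∀ u x, law (ch.joint p q) (fun ω => (ω.1, ω.2.2.1)) (u, x) =
      law (ch.joint p q) (fun ω => ω.1) u * r u x := by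
    intro u x
    rw [law_joint_UX, hlawU, ← hr]
    exact sum_congr rfl fun v _ => by simp only [hp]; split_ifs <;> simp
  obtain ⟨b1, b2, b3, b4⟩ := h
  unfold Channel.RateBounds
  have c1 : condMutualInfo (ch.joint p q) (fun ω => ω.2.2.1) (fun ω => ω.2.2.2.1 0) (fun ω => ω.1)
      = k.2.2 - rowEnt ch.w₁ k.1.1 := by
    have e := (hOU.map fun z => (z.1 0, z.1 (Fin.last m))).ent_sub hP0 hUX
    rw [← hOU.condMutualInfo_degraded hP ch.isPmf hdeg,
      (hOU.map fun z => (z.1 0, z.1 (Fin.last m))).condMutualInfo_eq hP0, e, hX, h5]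
    simp only [hlawU]
  have c2 : condMutualInfo (ch.joint p q) (fun ω => ω.2.2.1) (fun ω => ω.2.2.2.1 0)
      (fun ω => ω.2.1) = k.1.2.2 - rowEnt ch.w₁ k.1.1 := by
    have e := (hOV.map fun z => (z.1 0, z.1 (Fin.last m))).ent_sub hP0 hVX
    rw [← hOV.condMutualInfo_degraded hP ch.isPmf hdeg,
      (hOV.map fun z => (z.1 0, z.1 (Fin.last m))).condMutualInfo_eq hP0, e, hX, h3]
    simp only [hlawV]
  have c3 : mutualInfo (ch.joint p q) (fun ω => ω.1) (fun ω => ω.2.2.2.1 (Fin.last m)) =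
      outEnt ch.w₂ k.1.1 - k.2.1 := by
    have e := (hOU.map fun z => z.1 (Fin.last m)).ent_sub hP0 hUX
    have e' := (hOU.map fun z => z.1 (Fin.last m)).ent_eq
    simp only [hlawU, ← h4] at e
    rw [hX] at e'
    rw [mutualInfo_eq hP0]
    linarith
  have c4 : mutualInfo (ch.joint p q) (fun ω => ω.2.1) (fun ω => ω.2.2.2.2 (Fin.last m')) =
      outEnt ch.w₃ k.1.1 - k.1.2.1 := by
    have e := (hOV.map fun z => z.2 (Fin.last m')).ent_sub hP0 hVX
    have e' := (hOV.map fun z => z.2 (Fin.last m')).ent_eq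
    simp only [hlawV, ← h2] at e
    rw [hX] at e'
    rw [mutualInfo_eq hP0]
    linarith
  rw [c1, c2, c3, c4]
  refine ⟨?_, ?_, ?_, ?_⟩ <;> linarith

/-- By compactness of the entropy hull, the slack may be taken to be zero. -/
theorem Channel.exists_hullBounds_zero {R₀ R₁ : ℝ}
    (h : ∀ δ > 0, ∃ k ∈ entropyHull ch.w₁ ch.w₂ ch.w₃, ch.HullBounds R₀ R₁ δ k) :
    ∃ k ∈ entropyHull ch.w₁ ch.w₂ ch.w₃, ch.HullBounds R₀ R₁ 0 k := by
  -- The largest violation of the four bounds. It is continuous, hence attains its minimum on the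
  -- compact hull, and this minimum is below every positive `δ`.
  set g : ((𝒳 → ℝ) × ℝ × ℝ) × ℝ × ℝ → ℝ := fun k =>
    max (max (R₀ - (outEnt ch.w₂ k.1.1 - k.2.1)) (R₀ - (outEnt ch.w₃ k.1.1 - k.1.2.1)))
      (max (R₁ - (k.2.2 - rowEnt ch.w₁ k.1.1)) (R₀ + R₁ - (outEnt ch.w₃ k.1.1 - k.1.2.1 +
        (k.1.2.2 - rowEnt ch.w₁ k.1.1)))) with hg
  have hgδ : ∀ δ k, ch.HullBounds R₀ R₁ δ k ↔ g k ≤ δ := by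
    intro δ k
    unfold Channel.HullBounds
    simp only [hg, max_le_iff, sub_le_iff_le_add', and_assoc, add_comm]
  have hcont : Continuous g := by
    have c2 := continuous_outEnt ch.w₂
    have c3 := continuous_outEnt ch.w₃
    have c1 := continuous_rowEnt ch.w₁
    fun_prop
  have hne : (entropyHull ch.w₁ ch.w₂ ch.w₃).Nonempty := by
    obtain ⟨k, hk, -⟩ := h 1 one_pos
    exact ⟨k, hk⟩
  obtain ⟨k, hk, hmin⟩ := (isCompact_entropyHull ch.w₁ ch.w₂ ch.w₃).exists_isMinOn hne
    hcont.continuousOn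
  refine ⟨k, hk, (hgδ 0 k).2 (le_of_forall_pos_le_add fun δ hδ => ?_)⟩
  obtain ⟨k', hk', hb⟩ := h δ hδ
  rw [zero_add]
  exact (hmin hk').trans ((hgδ δ k').1 hb)

end Region

end MultilevelBC

namespace MultilevelBC

open Finset Real

/-! ### Chain rules for output sequences; `none` marks the positions left out. -/

section Sequences

variable {n : ℕ} {𝒵 β γ : Type*}

/-- The first `i` letters of the sequence `f (z k)`. -/
def seqLT (f : 𝒵 → β) (i : ℕ) (z : Fin n → 𝒵) (k : Fin n) : Option β :=
  if k.val < i then some (f (z k)) else none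

/-- The letters of the sequence `f (z k)` from the position `i` on. -/
def seqGE (f : 𝒵 → β) (i : ℕ) (z : Fin n → 𝒵) (k : Fin n) : Option β :=
  if i ≤ k.val then some (f (z k)) else none

theorem seqLT_eq_iff {f : 𝒵 → β} {i : ℕ} {z z' : Fin n → 𝒵} :
    seqLT f i z = seqLT f i z' ↔ ∀ k : Fin n, k.val < i → f (z k) = f (z' k) := by
  refine ⟨fun h k hk => ?_, fun h => ?_⟩
  · simpa [seqLT, hk] using congrFun h k
  · ext1 k
    unfold seqLT
    split_ifs with hk
    · rw [h k hk]
    · rfl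

theorem seqGE_eq_iff {f : 𝒵 → β} {i : ℕ} {z z' : Fin n → 𝒵} :
    seqGE f i z = seqGE f i z' ↔ ∀ k : Fin n, i ≤ k.val → f (z k) = f (z' k) := by
  refine ⟨fun h k hk => ?_, fun h => ?_⟩
  · simpa [seqGE, hk] using congrFun h k
  · ext1 k
    unfold seqGE
    split_ifs with hk
    · rw [h k hk]
    · rfl

theorem seqLT_succ_eq_iff {f : 𝒵 → β} {i : Fin n} {z z' : Fin n → 𝒵} :
    seqLT f (i + 1) z = seqLT f (i + 1) z' ↔
      seqLT f i z = seqLT f i z' ∧ f (z i) = f (z' i) := by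
  simp only [seqLT_eq_iff]
  refine ⟨fun h => ⟨fun k hk => h k (by omega), h i (by omega)⟩, fun h k hk => ?_⟩
  rcases Nat.lt_succ_iff_lt_or_eq.1 hk with hk | hk
  · exact h.1 k hk
  · rw [Fin.ext hk]
    exact h.2

theorem seqGE_eq_iff_succ {f : 𝒵 → β} {i : Fin n} {z z' : Fin n → 𝒵} :
    seqGE f i z = seqGE f i z' ↔
      seqGE f (i + 1) z = seqGE f (i + 1) z' ∧ f (z i) = f (z' i) := by
  simp only [seqGE_eq_iff]
  refine ⟨fun h => ⟨fun k hk => h k (by omega), h i le_rfl⟩, fun h k hk => ?_⟩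
  rcases Nat.lt_or_eq_of_le hk with hk | hk
  · exact h.1 k hk
  · rw [← Fin.ext hk]
    exact h.2

theorem seqLT_zero_eq {f : 𝒵 → β} {z z' : Fin n → 𝒵} : seqLT f 0 z = seqLT f 0 z' := by
  simp [seqLT_eq_iff]

theorem seqGE_last_eq {f : 𝒵 → β} {z z' : Fin n → 𝒵} : seqGE f n z = seqGE f n z' := by
  simp only [seqGE_eq_iff]
  intro k hk
  omega

theorem seqLT_last_eq_iff {f : 𝒵 → β} {z z' : Fin n → 𝒵} :
    seqLT f n z = seqLT f n z' ↔ (fun k => f (z k)) = fun k => f (z' k) := by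
  rw [seqLT_eq_iff]
  simp [funext_iff]

theorem seqGE_zero_eq_iff {f : 𝒵 → β} {z z' : Fin n → 𝒵} :
    seqGE f 0 z = seqGE f 0 z' ↔ (fun k => f (z k)) = fun k => f (z' k) := by
  rw [seqGE_eq_iff]
  simp [funext_iff]

theorem seqLT_update (f : 𝒵 → β) (i : Fin n) (z : Fin n → 𝒵) (a : 𝒵) :
    seqLT f i (Function.update z i a) = seqLT f i z := by
  simp only [seqLT_eq_iff]
  intro k hk
  rw [Function.update_of_ne (by rintro rfl; omega)]

theorem seqGE_update (f : 𝒵 → β) (i : Fin n) (z : Fin n → 𝒵) (a : 𝒵) :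
    seqGE f (i + 1) (Function.update z i a) = seqGE f (i + 1) z := by
  simp only [seqGE_eq_iff]
  intro k hk
  rw [Function.update_of_ne (by rintro rfl; omega)]

theorem sum_telescope (b : ℕ → ℝ) : ∑ i : Fin n, (b (i + 1) - b i) = b n - b 0 := by
  rw [Fin.sum_univ_eq_sum_range (fun i => b (i + 1) - b i) n, sum_range_sub]

variable {Ω α : Type*} [Fintype Ω] (P : Ω → ℝ)

/-- The chain rule for entropy. -/
theorem sum_ent_seqLT (A : Ω → α) (Z : Ω → Fin n → 𝒵) (f : 𝒵 → β) :
    ∑ i : Fin n, (ent P (fun ω => ((A ω, seqLT f i (Z ω)), f (Z ω i))) -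
      ent P (fun ω => (A ω, seqLT f i (Z ω)))) =
      ent P (fun ω => (A ω, fun k => f (Z ω k))) - ent P A := by
  have h := sum_telescope (n := n) fun i => ent P fun ω => (A ω, seqLT f i (Z ω))
  rw [ent_congr P (A := fun ω => (A ω, seqLT f n (Z ω)))
    (B := fun ω => (A ω, fun k => f (Z ω k))) (by simp [seqLT_last_eq_iff]),
    ent_congr P (A := fun ω => (A ω, seqLT f 0 (Z ω))) (B := A)
      (fun ω ω' => by simp [seqLT_zero_eq (z := Z ω) (z' := Z ω')])] at h
  rw [← h]
  refine sum_congr rfl fun i _ => ?_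
  congr 1
  exact ent_congr P (by simp [seqLT_succ_eq_iff, and_assoc])

/-- The chain rule for entropy, backwards. -/
theorem sum_ent_seqGE (A : Ω → α) (Z : Ω → Fin n → 𝒵) (f : 𝒵 → β) :
    ∑ i : Fin n, (ent P (fun ω => ((A ω, seqGE f (i + 1) (Z ω)), f (Z ω i))) -
      ent P (fun ω => (A ω, seqGE f (i + 1) (Z ω)))) =
      ent P (fun ω => (A ω, fun k => f (Z ω k))) - ent P A := by
  have h := sum_telescope (n := n) fun i => -ent P fun ω => (A ω, seqGE f i (Z ω))
  rw [ent_congr P (A := fun ω => (A ω, seqGE f 0 (Z ω)))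
    (B := fun ω => (A ω, fun k => f (Z ω k))) (by simp [seqGE_zero_eq_iff]),
    ent_congr P (A := fun ω => (A ω, seqGE f n (Z ω))) (B := A)
      (fun ω ω' => by simp [seqGE_last_eq (z := Z ω) (z' := Z ω')])] at h
  rw [← neg_add_eq_sub, add_comm, ← sub_eq_add_neg, ← neg_sub_neg, neg_sub_neg, ← neg_sub_neg, ← h]
  refine sum_congr rfl fun i _ => ?_
  rw [neg_sub_neg]
  congr 1
  exact ent_congr P (by simp [seqGE_eq_iff_succ, and_assoc])

/-- The entropies of the hybrids that follow `f` before position `i` and `g` from `i` on telescope: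
consecutive hybrids share everything but the letter `i`. This plays the role of Csiszár's sum
identity. -/
theorem sum_ent_mixed (A : Ω → α) (Z : Ω → Fin n → 𝒵) (f : 𝒵 → β) (g : 𝒵 → γ) :
    ∑ i : Fin n, (ent P (fun ω => ((A ω, seqLT f i (Z ω), seqGE g (i + 1) (Z ω)), f (Z ω i))) -
      ent P (fun ω => ((A ω, seqLT f i (Z ω), seqGE g (i + 1) (Z ω)), g (Z ω i)))) =
      ent P (fun ω => (A ω, fun k => f (Z ω k))) - ent P (fun ω => (A ω, fun k => g (Z ω k))) := by
  have h := sum_telescope (n := n) fun i => ent P fun ω => (A ω, seqLT f i (Z ω), seqGE g i (Z ω))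
  rw [ent_congr P (A := fun ω => (A ω, seqLT f n (Z ω), seqGE g n (Z ω)))
    (B := fun ω => (A ω, fun k => f (Z ω k)))
      (fun ω ω' => by simp [seqLT_last_eq_iff, seqGE_last_eq (z := Z ω) (z' := Z ω')]),
    ent_congr P (A := fun ω => (A ω, seqLT f 0 (Z ω), seqGE g 0 (Z ω)))
    (B := fun ω => (A ω, fun k => g (Z ω k)))
      (fun ω ω' => by simp [seqGE_zero_eq_iff, seqLT_zero_eq (z := Z ω) (z' := Z ω')])] at h
  rw [← h]
  refine sum_congr rfl fun i _ => ?_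
  congr 1
  · refine ent_congr P fun ω ω' => ?_
    simp only [Prod.mk.injEq, seqLT_succ_eq_iff]
    tauto
  · refine ent_congr P fun ω ω' => ?_
    simp only [Prod.mk.injEq, seqGE_eq_iff_succ]
    tauto

variable {P}

theorem ent_seq_le [Fintype β] (hP : P ∈ stdSimplex ℝ Ω) (Z : Ω → Fin n → 𝒵) (f : 𝒵 → β) :
    ent P (fun ω => fun k => f (Z ω k)) ≤ ∑ i, ent P fun ω => f (Z ω i) := by
  have h := sum_ent_seqLT P (fun _ => ()) Z f
  rw [ent_unique hP (fun _ : Ω => ()), sub_zero,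
    ent_congr P (A := fun ω => ((), fun k => f (Z ω k))) (B := fun ω => fun k => f (Z ω k))
      (by simp)] at h
  rw [← h]
  refine sum_le_sum fun i _ => ?_
  linarith [ent_pair_le hP (fun ω => ((), seqLT f i (Z ω))) fun ω => f (Z ω i)]

end Sequences

/-! ### Messages and outputs of a block code. -/

section Block

variable {n : ℕ} {ℳ₀ ℳ₁ 𝒳 𝒵 α : Type*} [Fintype ℳ₀] [Fintype ℳ₁] [Fintype 𝒵]

/-- The joint pmf of the uniformly distributed messages and of the outputs of the memoryless
channel `W` with the encoder `enc`. -/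
noncomputable def blockPmf (W : 𝒳 → 𝒵 → ℝ) (enc : ℳ₀ → ℳ₁ → Fin n → 𝒳)
    (ω : ℳ₀ × ℳ₁ × (Fin n → 𝒵)) : ℝ :=
  ((Fintype.card ℳ₀ : ℝ) * Fintype.card ℳ₁)⁻¹ * ∏ k, W (enc ω.1 ω.2.1 k) (ω.2.2 k)

variable {W : 𝒳 → 𝒵 → ℝ} {enc : ℳ₀ → ℳ₁ → Fin n → 𝒳}

theorem sum_prod_eq_one {ι A : Type*} [Fintype ι] [DecidableEq ι] [Fintype A] {w : ι → A → ℝ}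
    (hw : ∀ i, ∑ a, w i a = 1) : ∑ f : ι → A, ∏ i, w i (f i) = 1 := by
  have := prod_univ_sum (fun _ : ι => (univ : Finset A)) w
  simp only [hw, prod_const_one, Fintype.piFinset_univ] at this
  exact this.symm

theorem law_blockPmf_messages (hW : ∀ x, W x ∈ stdSimplex ℝ 𝒵) (a : ℳ₀) (b : ℳ₁) :
    law (blockPmf W enc) (fun ω => (ω.1, ω.2.1)) (a, b) =
      ((Fintype.card ℳ₀ : ℝ) * Fintype.card ℳ₁)⁻¹ := by
  classical
  unfold law blockPmf
  simp only [Fintype.sum_prod_type, Prod.mk.injEq]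
  rw [sum_eq_single a, sum_eq_single b]
  · simp only [and_self, if_true, ← mul_sum]
    rw [sum_prod_eq_one fun k => (hW (enc a b k)).2, mul_one]
  · intro b' _ hb'
    simp [hb']
  · simp
  · intro a' _ ha'
    simp [ha']
  · simp

variable [Nonempty ℳ₀] [Nonempty ℳ₁]

theorem law_blockPmf_fst (hW : ∀ x, W x ∈ stdSimplex ℝ 𝒵) (a : ℳ₀) :
    law (blockPmf W enc) (fun ω => ω.1) a = (Fintype.card ℳ₀ : ℝ)⁻¹ := by
  rw [← sum_law_pair _ _ fun ω => ω.2.1]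
  simp only [law_blockPmf_messages hW, sum_const, card_univ, nsmul_eq_mul]
  have : (Fintype.card ℳ₁ : ℝ) ≠ 0 := by simp
  field_simp

theorem blockPmf_mem_stdSimplex (hW : ∀ x, W x ∈ stdSimplex ℝ 𝒵) :
    blockPmf W enc ∈ stdSimplex ℝ (ℳ₀ × ℳ₁ × (Fin n → 𝒵)) := by
  refine ⟨fun ω => mul_nonneg (by positivity) (prod_nonneg fun k _ => (hW _).1 _), ?_⟩
  rw [← sum_law _ fun ω : ℳ₀ × ℳ₁ × (Fin n → 𝒵) => ω.1]
  simp only [law_blockPmf_fst hW, sum_const, card_univ, nsmul_eq_mul]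
  exact mul_inv_cancel₀ (by simp)

theorem ent_blockPmf_fst (hW : ∀ x, W x ∈ stdSimplex ℝ 𝒵) :
    ent (blockPmf W enc) (fun ω => ω.1) = logb 2 (Fintype.card ℳ₀) := by
  unfold ent
  simp only [law_blockPmf_fst hW, ← sum_mul, (blockPmf_mem_stdSimplex hW).2, logb_inv]
  ring

theorem ent_blockPmf_messages (hW : ∀ x, W x ∈ stdSimplex ℝ 𝒵) :
    ent (blockPmf W enc) (fun ω => (ω.1, ω.2.1)) =
      logb 2 (Fintype.card ℳ₀) + logb 2 (Fintype.card ℳ₁) := by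
  unfold ent
  simp only [law_blockPmf_messages hW, ← sum_mul, (blockPmf_mem_stdSimplex hW).2, logb_inv]
  rw [logb_mul (by simp) (by simp)]
  ring

/-- Without feedback the inputs depend on the messages only, so given the messages and all the other
letters, past or future, the letter `i` is a fresh output. Future letters must be allowed because
V_i contains them. -/
theorem isOutput_blockPmf (hW : ∀ x, W x ∈ stdSimplex ℝ 𝒵) (i : Fin n)
    (A : ℳ₀ → ℳ₁ → (Fin n → 𝒵) → α)
    (hA : ∀ m₀ m₁ z a, A m₀ m₁ (Function.update z i a) = A m₀ m₁ z) :
    IsOutput (blockPmf W enc) (fun ω => A ω.1 ω.2.1 ω.2.2) (fun ω => enc ω.1 ω.2.1 i)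
      (fun ω => ω.2.2 i) W := by
  classical
  rcases isEmpty_or_nonempty 𝒵 with h𝒵 | ⟨⟨z₀⟩⟩
  · exact fun a x b => isEmptyElim b
  set e : ℳ₀ × ℳ₁ × (Fin n → 𝒵) ≃ (ℳ₀ × ℳ₁ × ({k // k ≠ i} → 𝒵)) × 𝒵 :=
    { toFun := fun ω => ((ω.1, ω.2.1, fun k => ω.2.2 k), ω.2.2 i)
      invFun := fun ω => (ω.1.1, ω.1.2.1, (Equiv.funSplitAt i 𝒵).symm (ω.2, ω.1.2.2))
      left_inv := fun ω => by
        obtain ⟨a, b, z⟩ := ω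
        exact congrArg (fun z => (a, b, z)) ((Equiv.funSplitAt i 𝒵).symm_apply_apply z)
      right_inv := fun ω => by
        have := (Equiv.funSplitAt i 𝒵).apply_symm_apply (ω.2, ω.1.2.2)
        simp only [Equiv.funSplitAt_apply, Prod.mk.injEq] at this
        ext1
        · ext1
          · rfl
          · ext1
            · rfl
            · exact this.2
        · exact this.1 } with he
  -- `z₀` fills the position `i`, to which `A` is insensitive by `hA`.
  have h := isOutput_of_equiv e (P := blockPmf W enc)
    (fun r => ((Fintype.card ℳ₀ : ℝ) * Fintype.card ℳ₁)⁻¹ *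
      ∏ k : {k // k ≠ i}, W (enc r.1 r.2.1 k) (r.2.2 k)) hW
    (fun r => A r.1 r.2.1 ((Equiv.funSplitAt i 𝒵).symm (z₀, r.2.2)))
    (fun r => enc r.1 r.2.1 i) (fun z => z) ?_
  · rw [outLaw_id] at h
    have hAe : (fun ω : ℳ₀ × ℳ₁ × (Fin n → 𝒵) => A ω.1 ω.2.1 ω.2.2) = fun ω =>
        A (e ω).1.1 (e ω).1.2.1 ((Equiv.funSplitAt i 𝒵).symm (z₀, (e ω).1.2.2)) := by
      ext1 ω
      rw [← hA _ _ _ z₀]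
      change A ω.1 ω.2.1 _ = A ω.1 ω.2.1 _
      congr 1
    rw [hAe]
    exact h
  · intro ω
    unfold blockPmf
    rw [Fintype.prod_eq_mul_prod_subtype_ne _ i]
    have h1 : ∀ k : {k // k ≠ i}, (Equiv.funSplitAt i 𝒵).symm (ω.2, ω.1.2.2) k = ω.1.2.2 k := by
      rintro ⟨k, hk⟩
      simp [hk]
    have h2 : (Equiv.funSplitAt i 𝒵).symm (ω.2, ω.1.2.2) i = ω.2 := by simp
    simp only [he, Equiv.coe_fn_symm_mk, h1, h2]
    ring

end Block

end MultilevelBC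

namespace MultilevelBC

open Finset Real

/-! ### The converse: Fano's inequality and single-letterization. -/

section Converse

variable {m m' : ℕ} {𝒳 : Type*} {𝒴 : Fin (m + 1) → Type*} {𝒴' : Fin (m' + 1) → Type*}
  [Fintype 𝒳] [∀ i, Fintype (𝒴 i)] [∀ j, Fintype (𝒴' j)] {ch : Channel 𝒳 𝒴 𝒴'}

/-- Time sharing: the average of points of the entropy hull. -/
theorem exists_hullBounds_of_sum {n : ℕ} (hn : 0 < n) {R₀ R₁ δ : ℝ}
    (k : Fin n → ((𝒳 → ℝ) × ℝ × ℝ) × ℝ × ℝ) (hk : ∀ i, k i ∈ entropyHull ch.w₁ ch.w₂ ch.w₃)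
    (h₂ : n * R₀ ≤ ∑ i, (outEnt ch.w₂ (k i).1.1 - (k i).2.1) + n * δ)
    (h₃ : n * R₀ ≤ ∑ i, (outEnt ch.w₃ (k i).1.1 - (k i).1.2.1) + n * δ)
    (h₁ : n * R₁ ≤ ∑ i, ((k i).2.2 - rowEnt ch.w₁ (k i).1.1) + n * δ)
    (h₄ : n * (R₀ + R₁) ≤ ∑ i, (outEnt ch.w₃ (k i).1.1 - (k i).1.2.1 +
      ((k i).1.2.2 - rowEnt ch.w₁ (k i).1.1)) + n * δ) :
    ∃ k ∈ entropyHull ch.w₁ ch.w₂ ch.w₃, ch.HullBounds R₀ R₁ δ k := by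
  have hn' : (0 : ℝ) < n := by exact_mod_cast hn
  have hw : ∑ _i : Fin n, (n : ℝ)⁻¹ = 1 := by
    simp [hn'.ne']
  have hw0 : ∀ i ∈ (univ : Finset (Fin n)), 0 ≤ (n : ℝ)⁻¹ := fun i _ => by positivity
  refine ⟨∑ i, (n : ℝ)⁻¹ • k i, (convex_convexHull ℝ _).sum_mem hw0 hw fun i _ => hk i, ?_⟩
  have hfst : ∀ i ∈ (univ : Finset (Fin n)), (k i).1.1 ∈ stdSimplex ℝ 𝒳 := fun i _ =>
    entropyHull_fst _ _ _ (hk i)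
  have e1 : (∑ i, (n : ℝ)⁻¹ • k i).1.1 = ∑ i, (n : ℝ)⁻¹ • (k i).1.1 := by
    simp only [Prod.fst_sum, Prod.smul_fst]
  have e2 : (∑ i, (n : ℝ)⁻¹ • k i).1.2.1 = (n : ℝ)⁻¹ * ∑ i, (k i).1.2.1 := by
    simp only [Prod.fst_sum, Prod.smul_fst, Prod.snd_sum, Prod.smul_snd, smul_eq_mul, mul_sum]
  have e3 : (∑ i, (n : ℝ)⁻¹ • k i).1.2.2 = (n : ℝ)⁻¹ * ∑ i, (k i).1.2.2 := by
    simp only [Prod.fst_sum, Prod.smul_fst, Prod.snd_sum, Prod.smul_snd, smul_eq_mul, mul_sum]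
  have e4 : (∑ i, (n : ℝ)⁻¹ • k i).2.1 = (n : ℝ)⁻¹ * ∑ i, (k i).2.1 := by
    simp only [Prod.fst_sum, Prod.smul_fst, Prod.snd_sum, Prod.smul_snd, smul_eq_mul, mul_sum]
  have e5 : (∑ i, (n : ℝ)⁻¹ • k i).2.2 = (n : ℝ)⁻¹ * ∑ i, (k i).2.2 := by
    simp only [Prod.snd_sum, Prod.smul_snd, smul_eq_mul, mul_sum]
  -- Only the `outEnt` terms are nonlinear in the point of the hull; by concavity averaging
  -- increases them, which favours the bounds.
  have c2 := (concaveOn_outEnt (outLaw_nonneg ch.isPmf fun z => z.1 (Fin.last m))).le_map_sum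
    hw0 hw hfst
  have c3 := (concaveOn_outEnt (outLaw_nonneg ch.isPmf fun z => z.2 (Fin.last m'))).le_map_sum
    hw0 hw hfst
  have c1 := rowEnt_sum univ ch.w₁ (fun _ => (n : ℝ)⁻¹) fun i => (k i).1.1
  simp only [smul_eq_mul, ← mul_sum] at c1 c2 c3
  have hdiv : ∀ {a b : ℝ}, n * a ≤ b + n * δ → a ≤ (n : ℝ)⁻¹ * b + δ := by
    intro a b h
    have : a = (n : ℝ)⁻¹ * (n * a) := by field_simp
    rw [this]
    calc (n : ℝ)⁻¹ * (n * a) ≤ (n : ℝ)⁻¹ * (b + n * δ) :=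
          mul_le_mul_of_nonneg_left h (by positivity)
      _ = _ := by field_simp
  have h₁' := hdiv h₁
  have h₂' := hdiv h₂
  have h₃' := hdiv h₃
  have h₄' := hdiv h₄
  simp only [sum_add_distrib, sum_sub_distrib, mul_add, mul_sub] at h₁' h₂' h₃' h₄'
  unfold Channel.HullBounds
  rw [e1, e2, e3, e4, e5, c1]
  refine ⟨?_, ?_, ?_, ?_⟩ <;> linarith

theorem le_logb_card_msg (n : ℕ) (R : ℝ) : n * R ≤ logb 2 (Fintype.card (Msg n R)) := by
  rw [Fintype.card_fin]
  calc (n : ℝ) * R = logb 2 (2 ^ ((n : ℝ) * R)) := by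
        rw [logb_rpow (by norm_num) (by norm_num)]
    _ ≤ _ := logb_le_logb_of_le (by norm_num) (by positivity) (Nat.le_ceil _)

theorem logb_card_msg_le (n : ℕ) {R : ℝ} (hR : 0 ≤ R) :
    logb 2 (Fintype.card (Msg n R)) ≤ n * R + 1 := by
  rw [Fintype.card_fin]
  have h1 : (1 : ℝ) ≤ 2 ^ ((n : ℝ) * R) := one_le_rpow (by norm_num) (by positivity)
  have h2 : (⌈(2 : ℝ) ^ ((n : ℝ) * R)⌉₊ : ℝ) ≤ 2 ^ ((n : ℝ) * R + 1) := by
    rw [rpow_add (by norm_num), rpow_one]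
    have := Nat.ceil_lt_add_one (a := (2 : ℝ) ^ ((n : ℝ) * R)) (by positivity)
    linarith
  have h3 : (0 : ℝ) < ⌈(2 : ℝ) ^ ((n : ℝ) * R)⌉₊ := by
    exact_mod_cast Nat.ceil_pos.2 (by positivity)
  calc _ ≤ logb 2 (2 ^ ((n : ℝ) * R + 1)) := logb_le_logb_of_le (by norm_num) h3 h2
    _ = _ := by rw [logb_rpow (by norm_num) (by norm_num)]

instance (n : ℕ) (R : ℝ) : Nonempty (Msg n R) :=
  ⟨⟨0, Nat.ceil_pos.2 (by positivity)⟩⟩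

open Classical in
theorem errorProb_eq {n : ℕ} {R₀ R₁ : ℝ} (c : Code 𝒳 𝒴 𝒴' n R₀ R₁) :
    c.errorProb ch = ∑ ω, if c.IsError ω.1 ω.2.1 ω.2.2 then blockPmf ch.W c.enc ω else 0 := by
  unfold Code.errorProb blockPmf
  simp only [Fintype.sum_prod_type]
  rw [div_eq_inv_mul, mul_sum]
  refine sum_congr rfl fun _ _ => ?_
  rw [mul_sum]
  refine sum_congr rfl fun _ _ => ?_
  rw [mul_sum]
  refine sum_congr rfl fun _ _ => ?_
  split_ifs <;> simp

/-- The rates of a code satisfy the bounds of the capacity region up to a slack that vanishes with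
the probability of error. -/
theorem Code.exists_hullBounds {n : ℕ} (hn : 0 < n) {R₀ R₁ : ℝ} (hR₀ : 0 ≤ R₀) (hR₁ : 0 ≤ R₁)
    (c : Code 𝒳 𝒴 𝒴' n R₀ R₁) :
    ∃ k ∈ entropyHull ch.w₁ ch.w₂ ch.w₃,
      ch.HullBounds R₀ R₁ (2 / n + c.errorProb ch * (R₀ + R₁ + 2)) k := by
  classical
  have hn' : (0 : ℝ) < n := by exact_mod_cast hn
  have hn1 : (1 : ℝ) ≤ n := by exact_mod_cast hn
  set P := blockPmf ch.W c.enc with hPdef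
  have hP : P ∈ stdSimplex ℝ _ := blockPmf_mem_stdSimplex ch.isPmf
  have hP0 := hP.1
  -- With the pair of outputs, the past of Y m is contained in the past of `f`, as the bound `T₂`
  -- requires.
  set f : (∀ i, 𝒴 i) × (∀ j, 𝒴' j) → 𝒴 0 × 𝒴 (Fin.last m) := fun z => (z.1 0, z.1 (Fin.last m))
    with hf
  set h : (∀ i, 𝒴 i) × (∀ j, 𝒴' j) → 𝒴 (Fin.last m) := fun z => z.1 (Fin.last m) with hh
  set g : (∀ i, 𝒴 i) × (∀ j, 𝒴' j) → 𝒴' (Fin.last m') := fun z => z.2 (Fin.last m') with hg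
  -- the two messages, the outputs and the inputs
  set M : Msg n R₀ × Msg n R₁ × (Fin n → (∀ i, 𝒴 i) × (∀ j, 𝒴' j)) → Msg n R₀ :=
    fun ω => ω.1 with hM
  set N : Msg n R₀ × Msg n R₁ × (Fin n → (∀ i, 𝒴 i) × (∀ j, 𝒴' j)) → Msg n R₁ :=
    fun ω => ω.2.1 with hN
  set Z : Msg n R₀ × Msg n R₁ × (Fin n → (∀ i, 𝒴 i) × (∀ j, 𝒴' j)) →
    Fin n → (∀ i, 𝒴 i) × (∀ j, 𝒴' j) := fun ω => ω.2.2 with hZ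
  set X : Fin n → Msg n R₀ × Msg n R₁ × (Fin n → (∀ i, 𝒴 i) × (∀ j, 𝒴' j)) → 𝒳 :=
    fun i ω => c.enc ω.1 ω.2.1 i with hX
  -- The common part of two consecutive hybrids of `sum_ent_mixed`, together with the common
  -- message.
  set V := fun (i : Fin n) (ω : Msg n R₀ × Msg n R₁ × (Fin n → (∀ i, 𝒴 i) × (∀ j, 𝒴' j))) =>
    (M ω, seqLT f i (Z ω), seqGE g (i + 1) (Z ω)) with hV
  set U := fun (i : Fin n) (ω : Msg n R₀ × Msg n R₁ × (Fin n → (∀ i, 𝒴 i) × (∀ j, 𝒴' j))) =>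
    (M ω, seqLT f i (Z ω)) with hU
  have hO : ∀ i, IsOutput P (V i) (X i) (fun ω => Z ω i) ch.W := fun i =>
    isOutput_blockPmf ch.isPmf i (fun m₀ _ z => (m₀, seqLT f i z, seqGE g (i + 1) z))
      fun m₀ m₁ z a => by rw [seqLT_update, seqGE_update]
  have hOM : ∀ i : Fin n, IsOutput P (fun ω => ((M ω, N ω), seqLT f i (Z ω))) (X i)
      (fun ω => Z ω i) ch.W := fun i =>
    isOutput_blockPmf ch.isPmf i (fun m₀ m₁ z => ((m₀, m₁), seqLT f i z))
      fun m₀ m₁ z a => by rw [seqLT_update]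
  set k : Fin n → ((𝒳 → ℝ) × ℝ × ℝ) × ℝ × ℝ := fun i =>
    ((law P (X i), ent P (fun ω => (V i ω, g (Z ω i))) - ent P (V i),
      ent P (fun ω => (V i ω, f (Z ω i))) - ent P (V i)),
      ent P (fun ω => (U i ω, h (Z ω i))) - ent P (U i),
      ent P (fun ω => (U i ω, f (Z ω i))) - ent P (U i)) with hk
  have hkmem : ∀ i, k i ∈ entropyHull ch.w₁ ch.w₂ ch.w₃ := fun i =>
    mem_entropyHull hP (V i) (fun v => (v.1, v.2.1)) (X i) ((hO i).map f) ((hO i).map h)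
      ((hO i).map g)
  -- Fano's inequality
  have hE := errorProb_eq (ch := ch) c
  have hE0 : 0 ≤ c.errorProb ch := by
    rw [hE]
    exact sum_nonneg fun ω _ => by split_ifs <;> [exact hP0 ω; exact le_rfl]
  have lM := le_logb_card_msg n R₀
  have lN := le_logb_card_msg n R₁
  have uM := logb_card_msg_le n hR₀
  have uN := logb_card_msg_le n hR₁
  have F₂ := ent_fano hP (fun ω k => h (Z ω k)) M (c.dec (Fin.last m))
    (fun ω => c.IsError ω.1 ω.2.1 ω.2.2) fun ω hω => Or.inl ⟨_, hω⟩
  have F₃ := ent_fano hP (fun ω k => g (Z ω k)) M (c.dec' (Fin.last m'))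
    (fun ω => c.IsError ω.1 ω.2.1 ω.2.2) fun ω hω => Or.inr (Or.inl ⟨_, hω⟩)
  have F₁ := ent_fano hP (fun ω k => f (Z ω k)) N (fun y => c.decPriv fun k => (y k).1)
    (fun ω => c.IsError ω.1 ω.2.1 ω.2.2) fun ω hω => Or.inr (Or.inr hω)
  rw [← hE] at F₁ F₂ F₃
  have F₁' : ent P (fun ω => ((M ω, N ω), fun k => f (Z ω k))) -
      ent P (fun ω => (M ω, fun k => f (Z ω k))) ≤
      1 + c.errorProb ch * logb 2 (Fintype.card (Msg n R₁)) := by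
    refine le_trans ?_ F₁
    have := ent_pair_cond_le hP (fun ω => (M ω, fun k => f (Z ω k))) (fun ω k => f (Z ω k)) N
      fun ω ω' h => (Prod.mk.inj h).2
    rw [ent_congr P (A := fun ω => ((M ω, fun k => f (Z ω k)), N ω))
      (B := fun ω => ((M ω, N ω), fun k => f (Z ω k))) (by simp only [Prod.mk.injEq]; tauto)]
      at this
    exact this
  have hEM : c.errorProb ch * logb 2 (Fintype.card (Msg n R₀)) ≤ c.errorProb ch * (n * R₀ + 1) :=
    mul_le_mul_of_nonneg_left uM hE0
  have hEN : c.errorProb ch * logb 2 (Fintype.card (Msg n R₁)) ≤ c.errorProb ch * (n * R₁ + 1) :=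
    mul_le_mul_of_nonneg_left uN hE0
  have entM : ent P M = logb 2 (Fintype.card (Msg n R₀)) := ent_blockPmf_fst ch.isPmf
  have entMN : ent P (fun ω => (M ω, N ω)) = logb 2 (Fintype.card (Msg n R₀)) +
    logb 2 (Fintype.card (Msg n R₁)) := ent_blockPmf_messages ch.isPmf
  have swap : ∀ {β : Type _} (φ : (∀ i, 𝒴 i) × (∀ j, 𝒴' j) → β),
      ent P (fun ω => (fun k => φ (Z ω k), M ω)) = ent P (fun ω => (M ω, fun k => φ (Z ω k))) :=
    fun φ => ent_congr P (by simp only [Prod.mk.injEq]; tauto)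
  have swap₂ := swap h
  have swap₃ : ent P (fun ω => (fun k => g (Z ω k), M ω)) =
      ent P (fun ω => (M ω, fun k => g (Z ω k))) :=
    ent_congr P (by simp only [Prod.mk.injEq]; tauto)
  -- entropies of the output sequences
  have S₂ := ent_seq_le hP Z h
  have S₃ := ent_seq_le hP Z g
  have O₂ : ∀ i, ent P (fun ω => h (Z ω i)) = outEnt ch.w₂ (k i).1.1 := fun i =>
    ((hO i).map h).ent_eq
  have O₃ : ∀ i, ent P (fun ω => g (Z ω i)) = outEnt ch.w₃ (k i).1.1 := fun i =>
    ((hO i).map g).ent_eq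
  simp only [O₂] at S₂
  simp only [O₃] at S₃
  have T₂ : ∑ i, (k i).2.1 ≤ ent P (fun ω => (M ω, fun k => h (Z ω k))) - ent P M := by
    rw [← sum_ent_seqLT]
    refine sum_le_sum fun i _ => ent_pair_cond_le hP _ _ _ fun ω ω' hω => ?_
    simp only [hU, Prod.mk.injEq, seqLT_eq_iff] at hω ⊢
    exact ⟨hω.1, fun k hk => congrArg Prod.snd (hω.2 k hk)⟩
  have T₃ : ∑ i, (k i).1.2.1 ≤ ent P (fun ω => (M ω, fun k => g (Z ω k))) - ent P M := by
    rw [← sum_ent_seqGE]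
    refine sum_le_sum fun i _ => ent_pair_cond_le hP _ _ _ fun ω ω' hω => ?_
    simp only [hV, Prod.mk.injEq] at hω ⊢
    exact ⟨hω.1, hω.2.2⟩
  have T₁ : ∑ i, (k i).2.2 = ent P (fun ω => (M ω, fun k => f (Z ω k))) - ent P M :=
    sum_ent_seqLT P M Z f
  have T₀ : ∑ i, rowEnt ch.w₁ (k i).1.1 = ent P (fun ω => ((M ω, N ω), fun k => f (Z ω k))) -
      ent P (fun ω => (M ω, N ω)) := by
    rw [← sum_ent_seqLT]
    refine sum_congr rfl fun i _ => ?_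
    refine (((hOM i).map f).ent_sub_of_det hP0 fun ω ω' hω => ?_).symm
    simp only [Prod.mk.injEq] at hω
    obtain ⟨⟨h1, h2⟩, -⟩ := hω
    simp only [hM, hN] at h1 h2
    simp only [hX, h1, h2]
  have T₄ : ∑ i, (k i).1.2.2 - ∑ i, (k i).1.2.1 = ent P (fun ω => (M ω, fun k => f (Z ω k))) -
      ent P (fun ω => (M ω, fun k => g (Z ω k))) := by
    rw [← sum_ent_mixed, ← sum_sub_distrib]
    refine sum_congr rfl fun i _ => ?_
    simp only [hk, hV]
    ring
  -- Two applications of Fano's inequality cost two bits; each message has at most `2 ^ (n * R + 1)`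
  -- values because of the ceiling, and `n ≥ 1` absorbs these two extra bits into `2 * n`.
  have hδ : n * (2 / n + c.errorProb ch * (R₀ + R₁ + 2)) =
      2 + c.errorProb ch * (n * R₀ + n * R₁ + 2 * n) := by
    field_simp
  have q0 : 0 ≤ c.errorProb ch * (n * R₀) := by positivity
  have q1 : 0 ≤ c.errorProb ch * (n * R₁) := by positivity
  have q2 : c.errorProb ch ≤ c.errorProb ch * n := le_mul_of_one_le_right hE0 hn1
  refine exists_hullBounds_of_sum hn k hkmem ?_ ?_ ?_ ?_
  all_goals
    rw [hδ]
    simp only [sum_add_distrib, sum_sub_distrib]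
    linarith

/-- The converse part of the coding theorem. -/
theorem Channel.exists_rateBounds_of_mem_capacityRegion
    (hdeg : IsDegraded ch.W (fun z => z.1 0) (fun z => z.1 (Fin.last m))) {R : ℝ × ℝ}
    (hR : R ∈ ch.capacityRegion) :
    0 ≤ R.1 ∧ 0 ≤ R.2 ∧ ∃ (a b : ℕ) (p : Fin a × Fin b → ℝ) (q : Fin b → 𝒳 → ℝ),
      p ∈ stdSimplex ℝ (Fin a × Fin b) ∧ (∀ v, q v ∈ stdSimplex ℝ 𝒳) ∧
      ch.RateBounds R.1 R.2 p q := by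
  have h0 : R ∈ {R : ℝ × ℝ | 0 ≤ R.1 ∧ 0 ≤ R.2} := by
    have hcl : closure {R : ℝ × ℝ | 0 ≤ R.1 ∧ 0 ≤ R.2 ∧ ch.Achievable R.1 R.2} ⊆
        {R : ℝ × ℝ | 0 ≤ R.1 ∧ 0 ≤ R.2} := by
      refine closure_minimal (fun R hR => ⟨hR.1, hR.2.1⟩) ?_
      exact (isClosed_le continuous_const continuous_fst).inter
        (isClosed_le continuous_const continuous_snd)
    exact hcl hR
  refine ⟨h0.1, h0.2, ?_⟩
  obtain ⟨k, hk, hb⟩ := ch.exists_hullBounds_zero (R₀ := R.1) (R₁ := R.2) fun δ hδ => by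
    have hR' : R ∈ closure {R : ℝ × ℝ | 0 ≤ R.1 ∧ 0 ≤ R.2 ∧ ch.Achievable R.1 R.2} := hR
    -- An error of `δ / 4` in each rate costs at most `δ / 2` in the sum; the slack of the code
    -- takes the other half.
    obtain ⟨R', ⟨hR'0, hR'1, c, hc⟩, hdist⟩ := Metric.mem_closure_iff.1 hR' (δ / 4) (by positivity)
    have hlim : Filter.Tendsto (fun n : ℕ => 2 / (n : ℝ) +
        (c n).errorProb ch * (R'.1 + R'.2 + 2)) Filter.atTop (nhds 0) := by
      have := (tendsto_const_div_atTop_nhds_zero_nat (2 : ℝ)).add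
        (hc.mul_const (R'.1 + R'.2 + 2))
      simpa using this
    obtain ⟨n, hn, hn0⟩ := ((hlim.eventually_lt_const (show 0 < δ / 2 by positivity)).and
      (Filter.eventually_gt_atTop 0)).exists
    obtain ⟨k, hk, hb⟩ := (c n).exists_hullBounds (ch := ch) hn0 hR'0 hR'1
    refine ⟨k, hk, ?_⟩
    rw [Prod.dist_eq, max_lt_iff, Real.dist_eq, Real.dist_eq] at hdist
    have d1 := (abs_lt.1 hdist.1).2
    have d2 := (abs_lt.1 hdist.2).2
    obtain ⟨b1, b2, b3, b4⟩ := hb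
    refine ⟨?_, ?_, ?_, ?_⟩ <;> linarith
  exact hb.exists_rateBounds hdeg hk

end Converse

end MultilevelBC

namespace MultilevelBC

open Finset Real

/-! ### Expectations under product pmfs, and indicators. -/

section Expectation

variable {A B ι κ : Type*} [Fintype A] [Fintype B] [Fintype ι]

/-- The expectation of `F` under the pmf `w`. -/
noncomputable def ex (w F : A → ℝ) : ℝ := ∑ a, w a * F a

theorem ex_mono {w F G : A → ℝ} (hw : ∀ a, 0 ≤ w a) (h : ∀ a, w a ≠ 0 → F a ≤ G a) :
    ex w F ≤ ex w G := by
  refine sum_le_sum fun a _ => ?_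
  by_cases h0 : w a = 0
  · simp [h0]
  · exact mul_le_mul_of_nonneg_left (h a h0) (hw a)

theorem ex_nonneg {w F : A → ℝ} (hw : ∀ a, 0 ≤ w a) (h : ∀ a, 0 ≤ F a) : 0 ≤ ex w F :=
  sum_nonneg fun a _ => mul_nonneg (hw a) (h a)

theorem ex_add (w F G : A → ℝ) : (ex w fun a => F a + G a) = ex w F + ex w G := by
  simp only [ex, mul_add, sum_add_distrib]

theorem ex_sum (w : A → ℝ) (s : Finset κ) (F : κ → A → ℝ) :
    (ex w fun a => ∑ i ∈ s, F i a) = ∑ i ∈ s, ex w (F i) := by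
  simp only [ex, mul_sum]
  exact sum_comm

theorem ex_mul_left (w : A → ℝ) (c : ℝ) (F : A → ℝ) : (ex w fun a => c * F a) = c * ex w F := by
  simp only [ex, mul_sum]
  exact sum_congr rfl fun a _ => by ring

theorem ex_const {w : A → ℝ} (hw : ∑ a, w a = 1) (c : ℝ) : (ex w fun _ => c) = c := by
  simp only [ex, ← sum_mul, hw, one_mul]

theorem ex_comm (w : A → ℝ) (w' : B → ℝ) (F : A → B → ℝ) :
    (ex w fun a => ex w' fun b => F a b) = ex w' fun b => ex w fun a => F a b := by
  simp only [ex, mul_sum]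
  rw [sum_comm]
  exact sum_congr rfl fun b _ => sum_congr rfl fun a _ => by ring

/-- The pmf of a pair with first component of pmf `w` and conditional pmf `k`. -/
def pairPmf (w : A → ℝ) (k : A → B → ℝ) (x : A × B) : ℝ := w x.1 * k x.1 x.2

theorem ex_pairPmf (w : A → ℝ) (k : A → B → ℝ) (F : A × B → ℝ) :
    ex (pairPmf w k) F = ex w fun a => ex (k a) fun b => F (a, b) := by
  simp only [ex, pairPmf, Fintype.sum_prod_type, mul_sum, mul_assoc]

theorem pairPmf_mem_stdSimplex {w : A → ℝ} {k : A → B → ℝ} (hw : w ∈ stdSimplex ℝ A)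
    (hk : ∀ a, k a ∈ stdSimplex ℝ B) : pairPmf w k ∈ stdSimplex ℝ (A × B) := by
  refine ⟨fun x => mul_nonneg (hw.1 _) ((hk _).1 _), ?_⟩
  simp only [pairPmf, Fintype.sum_prod_type, ← mul_sum, (hk _).2, mul_one, hw.2]

/-- The pmf of independent components with pmfs `w i`. -/
def piPmf (w : ι → A → ℝ) (f : ι → A) : ℝ := ∏ i, w i (f i)

theorem ex_piPmf_prod [DecidableEq ι] (w : ι → A → ℝ) (g : ι → A → ℝ) :
    (ex (piPmf w) fun f => ∏ i, g i (f i)) = ∏ i, ex (w i) (g i) := by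
  unfold ex piPmf
  rw [prod_univ_sum, Fintype.piFinset_univ]
  simp only [prod_mul_distrib]

theorem piPmf_mem_stdSimplex [DecidableEq ι] {w : ι → A → ℝ} (hw : ∀ i, w i ∈ stdSimplex ℝ A) :
    piPmf w ∈ stdSimplex ℝ (ι → A) :=
  ⟨fun _ => prod_nonneg fun i _ => (hw i).1 _, sum_prod_eq_one fun i => (hw i).2⟩

theorem ex_piPmf_one [DecidableEq ι] {w : ι → A → ℝ} (hw : ∀ i, w i ∈ stdSimplex ℝ A) (i : ι)
    (F : A → ℝ) : (ex (piPmf w) fun f => F (f i)) = ex (w i) F := by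
  have h := ex_piPmf_prod w fun k a => if k = i then F a else 1
  rw [prod_eq_single i] at h
  · simp only [if_true] at h
    rw [← h]
    congr 1
    ext f
    rw [prod_eq_single i]
    · simp
    · intro k _ hk
      simp [hk]
    · simp
  · intro k _ hk
    simp only [hk, if_false]
    exact ex_const (hw k).2 1
  · simp

/-- Summing over the value `a'` of the coordinate `i` reduces `F` to products of functions of single
coordinates. -/
theorem ex_piPmf_two [DecidableEq ι] {w : ι → A → ℝ} (hw : ∀ i, w i ∈ stdSimplex ℝ A) {i j : ι}
    (hij : i ≠ j) (F : A → A → ℝ) :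
    (ex (piPmf w) fun f => F (f i) (f j)) = ex (w i) fun a => ex (w j) fun b => F a b := by
  classical
  have h : ∀ a', (ex (piPmf w) fun f => (if f i = a' then 1 else 0) * F a' (f j)) =
      w i a' * ex (w j) (F a') := by
    intro a'
    have h := ex_piPmf_prod w fun k a => if k = i then (if a = a' then 1 else 0) else
      if k = j then F a' a else 1
    rw [prod_eq_mul i j hij] at h
    · simp only [if_true, hij.symm, if_false] at h
      have h1 : (ex (w i) fun a => if a = a' then 1 else 0) = w i a' := by
        simp [ex]
      rw [h1] at h
      rw [← h]
      congr 1
      ext f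
      rw [prod_eq_mul i j hij]
      · simp [hij.symm]
      · rintro k _ ⟨h1, h2⟩
        simp [h1, h2]
      · simp
      · simp
    · rintro k _ ⟨h1, h2⟩
      simp only [h1, h2, if_false]
      exact ex_const (hw k).2 1
    · simp
    · simp
  have h2 : (fun f : ι → A => F (f i) (f j)) =
      fun f => ∑ a', (if f i = a' then 1 else 0) * F a' (f j) := by
    ext f
    simp
  rw [h2, ex_sum]
  simp only [h]
  rfl

/-- Some value of a random variable is at most its expectation. -/
theorem exists_le_ex {w : A → ℝ} (hw : w ∈ stdSimplex ℝ A) (F : A → ℝ) : ∃ a, F a ≤ ex w F := by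
  by_contra! h
  have h1 : ∑ a, w a * ex w F < ∑ a, w a * F a := by
    obtain ⟨a, ha⟩ : ∃ a, w a ≠ 0 := by
      by_contra! h0
      have := hw.2
      simp [h0] at this
    refine sum_lt_sum (fun b _ => mul_le_mul_of_nonneg_left (h b).le (hw.1 b)) ⟨a, mem_univ _, ?_⟩
    exact mul_lt_mul_of_pos_left (h a) (lt_of_le_of_ne (hw.1 a) ha.symm)
  rw [← sum_mul, hw.2, one_mul] at h1
  exact lt_irrefl _ h1

open Classical in
/-- The indicator of a proposition. -/
noncomputable def ind (p : Prop) : ℝ := if p then 1 else 0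

theorem ind_nonneg (p : Prop) : 0 ≤ ind p := by
  unfold ind
  split_ifs <;> norm_num

theorem ind_mono {p q : Prop} (h : p → q) : ind p ≤ ind q := by
  unfold ind
  split_ifs with h1 h2
  · exact le_rfl
  · exact absurd (h h1) h2
  · norm_num
  · exact le_rfl

theorem ind_or_le (p q : Prop) : ind (p ∨ q) ≤ ind p + ind q := by
  unfold ind
  by_cases hp : p <;> by_cases hq : q <;> simp [hp, hq]

theorem ind_exists_le (s : Finset κ) (p : κ → Prop) :
    ind (∃ i ∈ s, p i) ≤ ∑ i ∈ s, ind (p i) := by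
  by_cases h : ∃ i ∈ s, p i
  · obtain ⟨i, hi, hp⟩ := h
    refine le_trans ?_ (single_le_sum (f := fun i => ind (p i)) (fun i _ => ind_nonneg _) hi)
    exact ind_mono fun _ => hp
  · rw [ind, if_neg h]
    exact sum_nonneg fun i _ => ind_nonneg _

end Expectation

/-! ### Random superposition codebooks and the union bound. -/

section RandomCoding

variable {𝒰 𝒱 𝒳 𝒵 ℳ I J : Type*} [Fintype 𝒰] [Fintype 𝒱] [Fintype 𝒳] [Fintype 𝒵]
  [Fintype ℳ] [Fintype I] [Fintype J] [DecidableEq ℳ] [DecidableEq I] [DecidableEq J]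
  {pU : 𝒰 → ℝ} {pV : 𝒰 → 𝒱 → ℝ} {pX : 𝒱 → 𝒳 → ℝ} {W : 𝒳 → 𝒵 → ℝ}

/-- The expectation of `F(U,V,X,Z)`, for `U → V → X → Z` with the given transition pmfs. -/
noncomputable def exJoint (pU : 𝒰 → ℝ) (pV : 𝒰 → 𝒱 → ℝ) (pX : 𝒱 → 𝒳 → ℝ) (W : 𝒳 → 𝒵 → ℝ)
    (F : 𝒰 → 𝒱 → 𝒳 → 𝒵 → ℝ) : ℝ :=
  ex pU fun u => ex (pV u) fun v => ex (pX v) fun x => ex (W x) fun z => F u v x z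

/-- The pmf of a superposition codebook: a codeword `u` for each `m : ℳ`, a codeword `v` for each
`(m, i)` and a codeword `x` for each `(m, i, j)`. -/
noncomputable def codebookPmf (ℳ I J : Type*) [Fintype ℳ] [Fintype I] [Fintype J] (pU : 𝒰 → ℝ)
    (pV : 𝒰 → 𝒱 → ℝ) (pX : 𝒱 → 𝒳 → ℝ) : (ℳ → 𝒰 × (I → 𝒱 × (J → 𝒳))) → ℝ :=
  piPmf fun _ => pairPmf pU fun u => piPmf fun _ => pairPmf (pV u) fun v => piPmf fun _ => pX v

theorem branchPmf_mem (hX : ∀ v, pX v ∈ stdSimplex ℝ 𝒳)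
    (pV' : 𝒱 → ℝ) (hV' : pV' ∈ stdSimplex ℝ 𝒱) :
    (pairPmf pV' fun v => piPmf fun _ : J => pX v) ∈ stdSimplex ℝ (𝒱 × (J → 𝒳)) :=
  pairPmf_mem_stdSimplex hV' fun v => piPmf_mem_stdSimplex fun _ => hX v

theorem treePmf_mem (hU : pU ∈ stdSimplex ℝ 𝒰) (hV : ∀ u, pV u ∈ stdSimplex ℝ 𝒱)
    (hX : ∀ v, pX v ∈ stdSimplex ℝ 𝒳) :
    (pairPmf pU fun u => piPmf fun _ : I => pairPmf (pV u) fun v => piPmf fun _ : J => pX v) ∈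
      stdSimplex ℝ (𝒰 × (I → 𝒱 × (J → 𝒳))) :=
  pairPmf_mem_stdSimplex hU fun u => piPmf_mem_stdSimplex fun _ => branchPmf_mem hX _ (hV u)

theorem codebookPmf_mem (hU : pU ∈ stdSimplex ℝ 𝒰) (hV : ∀ u, pV u ∈ stdSimplex ℝ 𝒱)
    (hX : ∀ v, pX v ∈ stdSimplex ℝ 𝒳) :
    codebookPmf ℳ I J pU pV pX ∈ stdSimplex ℝ (ℳ → 𝒰 × (I → 𝒱 × (J → 𝒳))) :=
  piPmf_mem_stdSimplex fun _ => treePmf_mem hU hV hX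

theorem ex_codebook_sent (hU : pU ∈ stdSimplex ℝ 𝒰) (hV : ∀ u, pV u ∈ stdSimplex ℝ 𝒱)
    (hX : ∀ v, pX v ∈ stdSimplex ℝ 𝒳)
    (m : ℳ) (i : I) (j : J) (F : 𝒰 → 𝒱 → 𝒳 → 𝒵 → ℝ) :
    (ex (codebookPmf ℳ I J pU pV pX) fun C => ex (W (((C m).2 i).2 j)) fun z =>
      F (C m).1 ((C m).2 i).1 (((C m).2 i).2 j) z) = exJoint pU pV pX W F := by
  unfold codebookPmf exJoint
  rw [ex_piPmf_one (fun _ => treePmf_mem hU hV hX) m fun a => ex (W ((a.2 i).2 j)) fun z =>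
    F a.1 (a.2 i).1 ((a.2 i).2 j) z, ex_pairPmf]
  congr 1
  ext u
  rw [ex_piPmf_one (fun _ => branchPmf_mem hX _ (hV u)) i fun b => ex (W (b.2 j)) fun z =>
    F u b.1 (b.2 j) z, ex_pairPmf]
  congr 1
  ext v
  exact ex_piPmf_one (fun _ => hX v) j fun x => ex (W x) fun z => F u v x z

/-- The subtrees of `m` and `m'` are independent, so the wrong codeword may be averaged at fixed
output `z`. The next three lemmas do the same for wrong codewords at the lower levels of the tree.
-/
theorem ex_codebook_other_u (hU : pU ∈ stdSimplex ℝ 𝒰) (hV : ∀ u, pV u ∈ stdSimplex ℝ 𝒱)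
    (hX : ∀ v, pX v ∈ stdSimplex ℝ 𝒳)
    {m m' : ℳ} (hm : m ≠ m') (i : I) (j : J) (G : 𝒰 → 𝒵 → ℝ) :
    (ex (codebookPmf ℳ I J pU pV pX) fun C => ex (W (((C m).2 i).2 j)) fun z =>
      G (C m').1 z) = exJoint pU pV pX W fun _ _ _ z => ex pU fun u => G u z := by
  rw [← ex_codebook_sent hU hV hX m i j]
  unfold codebookPmf
  rw [ex_piPmf_two (fun _ => treePmf_mem hU hV hX) hm fun a b => ex (W ((a.2 i).2 j)) fun z =>
    G b.1 z, ex_piPmf_one (fun _ => treePmf_mem hU hV hX) m fun a => ex (W ((a.2 i).2 j)) fun z =>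
    ex pU fun u => G u z]
  congr 1
  ext a
  rw [ex_comm]
  congr 1
  ext z
  rw [ex_pairPmf]
  congr 1
  ext u
  exact ex_const (piPmf_mem_stdSimplex fun _ : I => branchPmf_mem (J := J) hX _ (hV u)).2 (G u z)

theorem ex_codebook_other_v (hU : pU ∈ stdSimplex ℝ 𝒰) (hV : ∀ u, pV u ∈ stdSimplex ℝ 𝒱)
    (hX : ∀ v, pX v ∈ stdSimplex ℝ 𝒳)
    {m m' : ℳ} (hm : m ≠ m') (i i' : I) (j : J) (G : 𝒱 → 𝒵 → ℝ) :
    (ex (codebookPmf ℳ I J pU pV pX) fun C => ex (W (((C m).2 i).2 j)) fun z =>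
      G ((C m').2 i').1 z) = exJoint pU pV pX W fun _ _ _ z => ex pU fun u => ex (pV u) fun v =>
        G v z := by
  rw [← ex_codebook_sent hU hV hX m i j]
  unfold codebookPmf
  rw [ex_piPmf_two (fun _ => treePmf_mem hU hV hX) hm fun a b => ex (W ((a.2 i).2 j)) fun z =>
    G (b.2 i').1 z, ex_piPmf_one (fun _ => treePmf_mem hU hV hX) m fun a =>
    ex (W ((a.2 i).2 j)) fun z => ex pU fun u => ex (pV u) fun v => G v z]
  congr 1
  ext a
  rw [ex_comm]
  congr 1
  ext z
  rw [ex_pairPmf]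
  congr 1
  ext u
  rw [ex_piPmf_one (fun _ => branchPmf_mem hX _ (hV u)) i' fun b => G b.1 z, ex_pairPmf]
  congr 1
  ext v
  exact ex_const (piPmf_mem_stdSimplex fun _ : J => hX v).2 (G v z)

/-- Here independence holds only given `u`: a wrong `x` of another branch comes through its own `v`,
drawn from `pV u`. -/
theorem ex_codebook_other_branch (hU : pU ∈ stdSimplex ℝ 𝒰) (hV : ∀ u, pV u ∈ stdSimplex ℝ 𝒱)
    (hX : ∀ v, pX v ∈ stdSimplex ℝ 𝒳)
    (m : ℳ) {i i' : I} (hi : i ≠ i') (j j' : J)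
    (G : 𝒰 → 𝒳 → 𝒵 → ℝ) :
    (ex (codebookPmf ℳ I J pU pV pX) fun C => ex (W (((C m).2 i).2 j)) fun z =>
      G (C m).1 (((C m).2 i').2 j') z) = exJoint pU pV pX W fun u _ _ z =>
        ex (pV u) fun v => ex (pX v) fun x => G u x z := by
  rw [← ex_codebook_sent hU hV hX m i j]
  unfold codebookPmf
  rw [ex_piPmf_one (fun _ => treePmf_mem hU hV hX) m fun a => ex (W ((a.2 i).2 j)) fun z =>
    G a.1 ((a.2 i').2 j') z, ex_piPmf_one (fun _ => treePmf_mem hU hV hX) m fun a =>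
    ex (W ((a.2 i).2 j)) fun z => ex (pV a.1) fun v => ex (pX v) fun x => G a.1 x z,
    ex_pairPmf, ex_pairPmf]
  congr 1
  ext u
  rw [ex_piPmf_two (fun _ => branchPmf_mem hX _ (hV u)) hi fun a b => ex (W (a.2 j)) fun z =>
    G u (b.2 j') z, ex_piPmf_one (fun _ => branchPmf_mem hX _ (hV u)) i fun a =>
    ex (W (a.2 j)) fun z => ex (pV u) fun v => ex (pX v) fun x => G u x z]
  congr 1
  ext a
  rw [ex_comm]
  congr 1
  ext z
  rw [ex_pairPmf]
  congr 1
  ext v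
  exact ex_piPmf_one (fun _ => hX v) j' fun x => G u x z

theorem ex_codebook_other_leaf (hU : pU ∈ stdSimplex ℝ 𝒰) (hV : ∀ u, pV u ∈ stdSimplex ℝ 𝒱)
    (hX : ∀ v, pX v ∈ stdSimplex ℝ 𝒳)
    (m : ℳ) (i : I) {j j' : J} (hj : j ≠ j')
    (G : 𝒱 → 𝒳 → 𝒵 → ℝ) :
    (ex (codebookPmf ℳ I J pU pV pX) fun C => ex (W (((C m).2 i).2 j)) fun z =>
      G ((C m).2 i).1 (((C m).2 i).2 j') z) = exJoint pU pV pX W fun _ v _ z =>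
        ex (pX v) fun x => G v x z := by
  unfold codebookPmf exJoint
  rw [ex_piPmf_one (fun _ => treePmf_mem hU hV hX) m fun a => ex (W ((a.2 i).2 j)) fun z =>
    G (a.2 i).1 ((a.2 i).2 j') z, ex_pairPmf]
  congr 1
  ext u
  rw [ex_piPmf_one (fun _ => branchPmf_mem hX _ (hV u)) i fun b => ex (W (b.2 j)) fun z =>
    G b.1 (b.2 j') z, ex_pairPmf]
  congr 1
  ext v
  rw [ex_piPmf_two (fun _ => hX v) hj fun x x' => ex (W x) fun z => G v x' z]
  congr 1
  ext x
  rw [ex_comm]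

/-- The events that may cause a decoding error, when the message `(m, i, j)` is sent: a test of
some receiver rejects the codewords sent, or accepts others. -/
def Confusion {ρ ρ' : Type*} (T : ρ → 𝒰 → 𝒵 → Prop) (T' : ρ' → 𝒱 → 𝒵 → Prop)
    (S : 𝒰 → 𝒳 → 𝒵 → Prop) (S' : 𝒱 → 𝒳 → 𝒵 → Prop) (C : ℳ → 𝒰 × (I → 𝒱 × (J → 𝒳)))
    (m : ℳ) (i : I) (j : J) (z : 𝒵) : Prop :=
  (∃ r, ¬T r (C m).1 z) ∨ (∃ r, ∃ m', m' ≠ m ∧ T r (C m').1 z) ∨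
  (∃ r, ¬T' r ((C m).2 i).1 z) ∨ (∃ r, ∃ m', m' ≠ m ∧ ∃ i', T' r ((C m').2 i').1 z) ∨
  ¬S (C m).1 (((C m).2 i).2 j) z ∨ ¬S' ((C m).2 i).1 (((C m).2 i).2 j) z ∨
  (∃ i', i' ≠ i ∧ ∃ j', S (C m).1 (((C m).2 i').2 j') z) ∨
  ∃ j', j' ≠ j ∧ S' ((C m).2 i).1 (((C m).2 i).2 j') z

theorem ind_confusion_le {ρ ρ' : Type*} [Fintype ρ] [Fintype ρ'] (T : ρ → 𝒰 → 𝒵 → Prop)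
    (T' : ρ' → 𝒱 → 𝒵 → Prop) (S : 𝒰 → 𝒳 → 𝒵 → Prop) (S' : 𝒱 → 𝒳 → 𝒵 → Prop)
    (C : ℳ → 𝒰 × (I → 𝒱 × (J → 𝒳))) (m : ℳ) (i : I) (j : J) (z : 𝒵) :
    ind (Confusion T T' S S' C m i j z) ≤
      (((∑ r, ind (¬T r (C m).1 z) + ∑ r, ind (¬T' r ((C m).2 i).1 z)) +
      (ind (¬S (C m).1 (((C m).2 i).2 j) z) + ind (¬S' ((C m).2 i).1 (((C m).2 i).2 j) z))) +
      (∑ r, ∑ m' ∈ univ.erase m, ind (T r (C m').1 z) +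
      ∑ r, ∑ m' ∈ univ.erase m, ∑ i', ind (T' r ((C m').2 i').1 z))) +
      (∑ i' ∈ univ.erase i, ∑ j', ind (S (C m).1 (((C m).2 i').2 j') z) +
      ∑ j' ∈ univ.erase j, ind (S' ((C m).2 i).1 (((C m).2 i).2 j') z)) := by
  unfold Confusion
  have u1 : ind (∃ r, ¬T r (C m).1 z) ≤ ∑ r, ind (¬T r (C m).1 z) := by
    simpa using ind_exists_le univ fun r => ¬T r (C m).1 z
  have u2 : ind (∃ r, ¬T' r ((C m).2 i).1 z) ≤ ∑ r, ind (¬T' r ((C m).2 i).1 z) := by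
    simpa using ind_exists_le univ fun r => ¬T' r ((C m).2 i).1 z
  have u3 : ind (∃ r, ∃ m', m' ≠ m ∧ T r (C m').1 z) ≤
      ∑ r, ∑ m' ∈ univ.erase m, ind (T r (C m').1 z) := by
    refine le_trans ?_ (sum_le_sum fun r _ => ind_exists_le (univ.erase m) fun m' => T r (C m').1 z)
    simpa using ind_exists_le univ fun r => ∃ m' ∈ univ.erase m, T r (C m').1 z
  have u4 : ind (∃ r, ∃ m', m' ≠ m ∧ ∃ i', T' r ((C m').2 i').1 z) ≤
      ∑ r, ∑ m' ∈ univ.erase m, ∑ i', ind (T' r ((C m').2 i').1 z) := by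
    refine le_trans ?_ (sum_le_sum fun r _ => sum_le_sum fun m' _ =>
      ind_exists_le univ fun i' => T' r ((C m').2 i').1 z)
    refine le_trans ?_ (sum_le_sum fun r _ => ind_exists_le (univ.erase m) fun m' =>
      ∃ i' ∈ univ, T' r ((C m').2 i').1 z)
    simpa using ind_exists_le univ fun r => ∃ m' ∈ univ.erase m, ∃ i', T' r ((C m').2 i').1 z
  have u5 : ind (∃ i', i' ≠ i ∧ ∃ j', S (C m).1 (((C m).2 i').2 j') z) ≤
      ∑ i' ∈ univ.erase i, ∑ j', ind (S (C m).1 (((C m).2 i').2 j') z) := by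
    refine le_trans ?_ (sum_le_sum fun i' _ =>
      ind_exists_le univ fun j' => S (C m).1 (((C m).2 i').2 j') z)
    simpa using ind_exists_le (univ.erase i) fun i' => ∃ j', S (C m).1 (((C m).2 i').2 j') z
  have u6 : ind (∃ j', j' ≠ j ∧ S' ((C m).2 i).1 (((C m).2 i).2 j') z) ≤
      ∑ j' ∈ univ.erase j, ind (S' ((C m).2 i).1 (((C m).2 i).2 j') z) := by
    simpa using ind_exists_le (univ.erase j) fun j' => S' ((C m).2 i).1 (((C m).2 i).2 j') z
  refine (ind_or_le _ _).trans ?_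
  have o1 := ind_or_le (∃ r, ∃ m', m' ≠ m ∧ T r (C m').1 z) ((∃ r, ¬T' r ((C m).2 i).1 z) ∨
    (∃ r, ∃ m', m' ≠ m ∧ ∃ i', T' r ((C m').2 i').1 z) ∨
    ¬S (C m).1 (((C m).2 i).2 j) z ∨ ¬S' ((C m).2 i).1 (((C m).2 i).2 j) z ∨
    (∃ i', i' ≠ i ∧ ∃ j', S (C m).1 (((C m).2 i').2 j') z) ∨
    ∃ j', j' ≠ j ∧ S' ((C m).2 i).1 (((C m).2 i).2 j') z)
  have o2 := ind_or_le (∃ r, ¬T' r ((C m).2 i).1 z)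
    ((∃ r, ∃ m', m' ≠ m ∧ ∃ i', T' r ((C m').2 i').1 z) ∨
    ¬S (C m).1 (((C m).2 i).2 j) z ∨ ¬S' ((C m).2 i).1 (((C m).2 i).2 j) z ∨
    (∃ i', i' ≠ i ∧ ∃ j', S (C m).1 (((C m).2 i').2 j') z) ∨
    ∃ j', j' ≠ j ∧ S' ((C m).2 i).1 (((C m).2 i).2 j') z)
  have o3 := ind_or_le (∃ r, ∃ m', m' ≠ m ∧ ∃ i', T' r ((C m').2 i').1 z)
    (¬S (C m).1 (((C m).2 i).2 j) z ∨ ¬S' ((C m).2 i).1 (((C m).2 i).2 j) z ∨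
    (∃ i', i' ≠ i ∧ ∃ j', S (C m).1 (((C m).2 i').2 j') z) ∨
    ∃ j', j' ≠ j ∧ S' ((C m).2 i).1 (((C m).2 i).2 j') z)
  have o4 := ind_or_le (¬S (C m).1 (((C m).2 i).2 j) z)
    (¬S' ((C m).2 i).1 (((C m).2 i).2 j) z ∨
    (∃ i', i' ≠ i ∧ ∃ j', S (C m).1 (((C m).2 i').2 j') z) ∨
    ∃ j', j' ≠ j ∧ S' ((C m).2 i).1 (((C m).2 i).2 j') z)
  have o5 := ind_or_le (¬S' ((C m).2 i).1 (((C m).2 i).2 j) z)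
    ((∃ i', i' ≠ i ∧ ∃ j', S (C m).1 (((C m).2 i').2 j') z) ∨
    ∃ j', j' ≠ j ∧ S' ((C m).2 i).1 (((C m).2 i).2 j') z)
  have o6 := ind_or_le (∃ i', i' ≠ i ∧ ∃ j', S (C m).1 (((C m).2 i').2 j') z)
    (∃ j', j' ≠ j ∧ S' ((C m).2 i).1 (((C m).2 i).2 j') z)
  linarith

/-- The random coding bound for superposition codes. -/
theorem exists_codebook {𝒩 ρ ρ' : Type*} [Fintype 𝒩] [Fintype ρ] [Fintype ρ'] [Nonempty ℳ]
    [Nonempty 𝒩] (hU : pU ∈ stdSimplex ℝ 𝒰) (hV : ∀ u, pV u ∈ stdSimplex ℝ 𝒱)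
    (hX : ∀ v, pX v ∈ stdSimplex ℝ 𝒳) (hW : ∀ x z, 0 ≤ W x z) (s : 𝒩 → I × J)
    (T : ρ → 𝒰 → 𝒵 → Prop) (T' : ρ' → 𝒱 → 𝒵 → Prop) (S : 𝒰 → 𝒳 → 𝒵 → Prop)
    (S' : 𝒱 → 𝒳 → 𝒵 → Prop) :
    ∃ C : ℳ → 𝒰 × (I → 𝒱 × (J → 𝒳)),
      (∑ m, ∑ l, ex (W (((C m).2 (s l).1).2 (s l).2)) fun z =>
        ind (Confusion T T' S S' C m (s l).1 (s l).2 z)) /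
        ((Fintype.card ℳ : ℝ) * Fintype.card 𝒩) ≤
      (((∑ r, exJoint pU pV pX W (fun u _ _ z => ind (¬T r u z)) +
        ∑ r, exJoint pU pV pX W (fun _ v _ z => ind (¬T' r v z))) +
      (exJoint pU pV pX W (fun u _ x z => ind (¬S u x z)) +
        exJoint pU pV pX W (fun _ v x z => ind (¬S' v x z)))) +
      (∑ r, ((Fintype.card ℳ - 1 : ℕ) : ℝ) *
        exJoint pU pV pX W (fun _ _ _ z => ex pU fun u => ind (T r u z)) +
      ∑ r, ((Fintype.card ℳ - 1 : ℕ) : ℝ) * (Fintype.card I * exJoint pU pV pX W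
        (fun _ _ _ z => ex pU fun u => ex (pV u) fun v => ind (T' r v z))))) +
      (((Fintype.card I - 1 : ℕ) : ℝ) * (Fintype.card J * exJoint pU pV pX W
        (fun u _ _ z => ex (pV u) fun v => ex (pX v) fun x => ind (S u x z))) +
      ((Fintype.card J - 1 : ℕ) : ℝ) *
        exJoint pU pV pX W (fun _ v _ z => ex (pX v) fun x => ind (S' v x z))) := by
  set w := codebookPmf ℳ I J pU pV pX with hw
  have hwmem : w ∈ stdSimplex ℝ _ := codebookPmf_mem hU hV hX
  obtain ⟨C, hC⟩ := exists_le_ex hwmem fun C => (∑ m, ∑ l, ex (W (((C m).2 (s l).1).2 (s l).2))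
    fun z => ind (Confusion T T' S S' C m (s l).1 (s l).2 z)) /
      ((Fintype.card ℳ : ℝ) * Fintype.card 𝒩)
  refine ⟨C, hC.trans ?_⟩
  have hcard : (0 : ℝ) < (Fintype.card ℳ : ℝ) * Fintype.card 𝒩 := by
    have h1 : 0 < Fintype.card ℳ := Fintype.card_pos
    have h2 : 0 < Fintype.card 𝒩 := Fintype.card_pos
    positivity
  simp only [div_eq_inv_mul]
  rw [ex_mul_left, ex_sum]
  simp only [ex_sum]
  rw [inv_mul_le_iff₀ hcard, mul_assoc, ← nsmul_eq_mul, ← card_univ, ← sum_const]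
  refine sum_le_sum fun m _ => ?_
  rw [← nsmul_eq_mul, ← card_univ, ← sum_const]
  refine sum_le_sum fun l _ => ?_
  refine (ex_mono hwmem.1 fun C _ => ex_mono (hW _) fun z _ => ind_confusion_le T T' S S' C m
    (s l).1 (s l).2 z).trans (le_of_eq ?_)
  simp only [ex_add, ex_sum]
  congr 1
  · congr 1
    · congr 1
      · congr 1
        · exact sum_congr rfl fun r _ => ex_codebook_sent hU hV hX m _ _
            fun u _ _ z => ind (¬T r u z)
        · exact sum_congr rfl fun r _ => ex_codebook_sent hU hV hX m _ _
            fun _ v _ z => ind (¬T' r v z)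
      · congr 1
        · exact ex_codebook_sent hU hV hX m _ _ fun u _ x z => ind (¬S u x z)
        · exact ex_codebook_sent hU hV hX m _ _ fun _ v x z => ind (¬S' v x z)
    · congr 1
      · refine sum_congr rfl fun r _ => ?_
        rw [sum_congr rfl fun m' hm' => ex_codebook_other_u hU hV hX (ne_of_mem_erase hm').symm
          (s l).1 (s l).2 fun u z => ind (T r u z), sum_const, card_erase_of_mem (mem_univ _),
          card_univ, nsmul_eq_mul]
      · refine sum_congr rfl fun r _ => ?_
        rw [sum_congr rfl fun m' hm' => sum_congr rfl fun i' _ => ex_codebook_other_v hU hV hX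
          (ne_of_mem_erase hm').symm (s l).1 i' (s l).2 fun v z => ind (T' r v z), sum_const,
          sum_const, card_erase_of_mem (mem_univ _), card_univ, card_univ, nsmul_eq_mul,
          nsmul_eq_mul]
  · congr 1
    · rw [sum_congr rfl fun i' hi' => sum_congr rfl fun j' _ => ex_codebook_other_branch hU hV hX
        m (ne_of_mem_erase hi').symm (s l).2 j' fun u x z => ind (S u x z), sum_const,
        sum_const, card_erase_of_mem (mem_univ _), card_univ, card_univ, nsmul_eq_mul,
        nsmul_eq_mul]
    · rw [sum_congr rfl fun j' hj' => ex_codebook_other_leaf hU hV hX m (s l).1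
        (ne_of_mem_erase hj').symm fun v x z => ind (S' v x z), sum_const,
        card_erase_of_mem (mem_univ _), card_univ, nsmul_eq_mul]

end RandomCoding

end MultilevelBC

namespace MultilevelBC

open Finset Real

/-! ### Markov and Chernoff bounds. -/

section Concentration

variable {A : Type*} [Fintype A]

theorem ex_pos {w F : A → ℝ} (hw : ∀ a, 0 ≤ w a) (hF : ∀ a, 0 ≤ F a) {a : A} (ha : w a ≠ 0)
    (hFa : 0 < F a) : 0 < ex w F := by
  have h1 : 0 < w a := lt_of_le_of_ne (hw a) ha.symm
  exact lt_of_lt_of_le (mul_pos h1 hFa)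
    (single_le_sum (f := fun a => w a * F a) (fun a _ => mul_nonneg (hw a) (hF a)) (mem_univ a))

/-- Markov's inequality. -/
theorem ex_ind_le {w N : A → ℝ} (hw : ∀ a, 0 ≤ w a) (hN : ∀ a, 0 ≤ N a) {τ : ℝ} (hτ : 0 < τ) :
    (ex w fun a => ind (τ * ex w N < N a)) ≤ τ⁻¹ := by
  -- If the mean is zero, `N` vanishes on the support, where the strict inequality in the event
  -- fails; hence the tests are strict.
  rcases (ex_nonneg hw hN).eq_or_lt with h0 | hpos
  · have h1 : ∀ a, w a * N a = 0 := fun a =>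
      (sum_eq_zero_iff_of_nonneg fun a _ => mul_nonneg (hw a) (hN a)).1 h0.symm a (mem_univ a)
    have h2 : (ex w fun a => ind (τ * ex w N < N a)) = 0 := by
      refine sum_eq_zero fun a _ => ?_
      rcases mul_eq_zero.1 (h1 a) with h | h
      · rw [h, zero_mul]
      · have h3 : ¬τ * ex w N < N a := by rw [h, ← h0]; simp
        have h4 : ind (τ * ex w N < N a) = 0 := if_neg h3
        exact mul_eq_zero_of_right _ h4
    rw [h2]
    positivity
  · calc (ex w fun a => ind (τ * ex w N < N a))
        ≤ ex w fun a => (τ * ex w N)⁻¹ * N a := by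
          refine ex_mono hw fun a _ => ?_
          unfold ind
          split_ifs with h
          · rw [inv_mul_eq_div, one_le_div (by positivity)]
            exact h.le
          · exact mul_nonneg (by positivity) (hN a)
      _ = τ⁻¹ := by
          rw [ex_mul_left]
          field_simp

/-- A random variable with positive mean has an exponential moment less than one. -/
theorem exists_ex_exp_lt_one {w : A → ℝ} (hw : w ∈ stdSimplex ℝ A) {a : A → ℝ}
    (ha : 0 < ex w a) : ∃ s > 0, (ex w fun x => exp (-(s * a x))) < 1 := by
  set M := 1 + ∑ x, |a x| with hM
  have hM1 : 1 ≤ M := le_add_of_nonneg_right (sum_nonneg fun x _ => abs_nonneg _)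
  have haM : ∀ x, |a x| ≤ M := fun x =>
    (single_le_sum (f := fun x => |a x|) (fun x _ => abs_nonneg _) (mem_univ x)).trans
      (by linarith)
  have hM0 : 0 < M := by linarith
  -- The first bound gives `|s * a x| ≤ 1`, whence exp y ≤ 1 + y + y² applies; the second keeps the
  -- quadratic term `s ^ 2 * M ^ 2` below half of the linear gain `s * ex w a`.
  set s := min (1 / M) (ex w a / (2 * M ^ 2)) with hs
  have hs0 : 0 < s := lt_min (by positivity) (by positivity)
  have hs1 : s * M ≤ 1 := by
    have := min_le_left (1 / M) (ex w a / (2 * M ^ 2))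
    rwa [le_div_iff₀ hM0] at this
  have hs2 : s * (2 * M ^ 2) ≤ ex w a := by
    have := min_le_right (1 / M) (ex w a / (2 * M ^ 2))
    rwa [le_div_iff₀ (by positivity)] at this
  refine ⟨s, hs0, ?_⟩
  have hx : ∀ x, exp (-(s * a x)) ≤ (1 + s ^ 2 * M ^ 2) + (-s) * a x := by
    intro x
    have habs : |-(s * a x)| ≤ s * M := by
      rw [abs_neg, abs_mul, abs_of_pos hs0]
      exact mul_le_mul_of_nonneg_left (haM x) hs0.le
    have h1 := (abs_le.1 (abs_exp_sub_one_sub_id_le (habs.trans hs1))).2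
    have h2 : (-(s * a x)) ^ 2 ≤ (s * M) ^ 2 := sq_le_sq' (by linarith [(abs_le.1 habs).1])
      (abs_le.1 habs).2
    nlinarith
  calc (ex w fun x => exp (-(s * a x)))
      ≤ ex w fun x => (1 + s ^ 2 * M ^ 2) + (-s) * a x := ex_mono hw.1 fun x _ => hx x
    _ = 1 + s ^ 2 * M ^ 2 - s * ex w a := by
        rw [ex_add, ex_const hw.2, ex_mul_left]
        ring
    _ < 1 := by nlinarith [mul_pos hs0 hM0, mul_le_mul_of_nonneg_left hs2 hs0.le]

end Concentration

/-! ### Independent copies of (U, V, X, Z). -/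

section Block

variable {𝒰 𝒱 𝒳 𝒵 : Type*} [Fintype 𝒰] [Fintype 𝒱] [Fintype 𝒳] [Fintype 𝒵]
  {pU : 𝒰 → ℝ} {pV : 𝒰 → 𝒱 → ℝ} {pX : 𝒱 → 𝒳 → ℝ} {W : 𝒳 → 𝒵 → ℝ}

theorem exJoint_eq_ex (F : 𝒰 → 𝒱 → 𝒳 → 𝒵 → ℝ) :
    exJoint pU pV pX W F = ex (pairPmf pU fun u => pairPmf (pV u) fun v => pairPmf (pX v) W)
      fun ω => F ω.1 ω.2.1 ω.2.2.1 ω.2.2.2 := by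
  simp only [ex_pairPmf, exJoint]

theorem exJoint_mono (hU : ∀ u, 0 ≤ pU u) (hV : ∀ u v, 0 ≤ pV u v) (hX : ∀ v x, 0 ≤ pX v x)
    (hW : ∀ x z, 0 ≤ W x z) {F G : 𝒰 → 𝒱 → 𝒳 → 𝒵 → ℝ}
    (h : ∀ u v x z, pU u ≠ 0 → pV u v ≠ 0 → pX v x ≠ 0 → W x z ≠ 0 → F u v x z ≤ G u v x z) :
    exJoint pU pV pX W F ≤ exJoint pU pV pX W G :=
  ex_mono hU fun u hu => ex_mono (hV u) fun v hv => ex_mono (hX v) fun x hx =>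
    ex_mono (hW x) fun z hz => h u v x z hu hv hx hz

theorem exJoint_const (hU : pU ∈ stdSimplex ℝ 𝒰) (hV : ∀ u, pV u ∈ stdSimplex ℝ 𝒱)
    (hX : ∀ v, pX v ∈ stdSimplex ℝ 𝒳) (hW : ∀ x, W x ∈ stdSimplex ℝ 𝒵) (c : ℝ) :
    exJoint pU pV pX W (fun _ _ _ _ => c) = c := by
  unfold exJoint
  simp only [ex_const (hW _).2, ex_const (hX _).2, ex_const (hV _).2, ex_const hU.2]

/-- The expectation of a function of independent copies of `(U,V,X,Z)`. -/
noncomputable def exBlock (pU : 𝒰 → ℝ) (pV : 𝒰 → 𝒱 → ℝ) (pX : 𝒱 → 𝒳 → ℝ) (W : 𝒳 → 𝒵 → ℝ)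
    (n : ℕ) (F : (Fin n → 𝒰) → (Fin n → 𝒱) → (Fin n → 𝒳) → (Fin n → 𝒵) → ℝ) : ℝ :=
  exJoint (piPmf fun _ => pU) (fun u => piPmf fun k => pV (u k)) (fun v => piPmf fun k => pX (v k))
    (fun x => piPmf fun k => W (x k)) F

theorem exBlock_prod (n : ℕ) (c : 𝒰 → 𝒱 → 𝒳 → 𝒵 → ℝ) :
    exBlock pU pV pX W n (fun u v x z => ∏ k, c (u k) (v k) (x k) (z k)) =
      exJoint pU pV pX W c ^ n := by
  unfold exBlock exJoint
  have h1 : ∀ (u : Fin n → 𝒰) (v : Fin n → 𝒱) (x : Fin n → 𝒳),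
      (ex (piPmf fun k => W (x k)) fun z => ∏ k, c (u k) (v k) (x k) (z k)) =
      ∏ k, ex (W (x k)) fun z => c (u k) (v k) (x k) z := fun u v x =>
    ex_piPmf_prod _ fun k z => c (u k) (v k) (x k) z
  have h2 : ∀ (u : Fin n → 𝒰) (v : Fin n → 𝒱),
      (ex (piPmf fun k => pX (v k)) fun x => ∏ k, ex (W (x k)) fun z => c (u k) (v k) (x k) z) =
      ∏ k, ex (pX (v k)) fun x => ex (W x) fun z => c (u k) (v k) x z := fun u v =>
    ex_piPmf_prod _ fun k x => ex (W x) fun z => c (u k) (v k) x z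
  have h3 : ∀ u : Fin n → 𝒰, (ex (piPmf fun k => pV (u k)) fun v => ∏ k, ex (pX (v k)) fun x =>
      ex (W x) fun z => c (u k) (v k) x z) =
      ∏ k, ex (pV (u k)) fun v => ex (pX v) fun x => ex (W x) fun z => c (u k) v x z := fun u =>
    ex_piPmf_prod _ fun k v => ex (pX v) fun x => ex (W x) fun z => c (u k) v x z
  simp only [h1, h2, h3]
  rw [ex_piPmf_prod _ fun _ u => ex (pV u) fun v => ex (pX v) fun x => ex (W x) fun z => c u v x z]
  simp

/-- The Chernoff bound for the probability that a likelihood ratio test rejects. -/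
theorem exists_exBlock_reject_le (hU : pU ∈ stdSimplex ℝ 𝒰) (hV : ∀ u, pV u ∈ stdSimplex ℝ 𝒱)
    (hX : ∀ v, pX v ∈ stdSimplex ℝ 𝒳) (hW : ∀ x, W x ∈ stdSimplex ℝ 𝒵)
    {N D : 𝒰 → 𝒱 → 𝒳 → 𝒵 → ℝ}
    (hpos : ∀ u v x z, pU u ≠ 0 → pV u v ≠ 0 → pX v x ≠ 0 → W x z ≠ 0 →
      0 < N u v x z ∧ 0 < D u v x z) {γ : ℝ}
    (hγ : γ < exJoint pU pV pX W fun u v x z => logb 2 (N u v x z / D u v x z)) :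
    ∃ θ : ℝ, 0 ≤ θ ∧ θ < 1 ∧ ∀ n : ℕ, exBlock pU pV pX W n (fun u v x z =>
      ind (¬(2 : ℝ) ^ ((n : ℝ) * γ) * ∏ k, D (u k) (v k) (x k) (z k) <
        ∏ k, N (u k) (v k) (x k) (z k))) ≤ θ ^ n := by
  set Q := pairPmf pU fun u => pairPmf (pV u) fun v => pairPmf (pX v) W with hQ
  have hQmem : Q ∈ stdSimplex ℝ (𝒰 × 𝒱 × 𝒳 × 𝒵) := pairPmf_mem_stdSimplex hU fun u =>
    pairPmf_mem_stdSimplex (hV u) fun v => pairPmf_mem_stdSimplex (hX v) hW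
  -- The excess of the log-likelihood ratio over the threshold, per letter. Its mean is positive by
  -- `hγ`; rejection means that its sum over the letters is at most 0, where `exp` of minus `s`
  -- times the sum is at least 1.
  set i : 𝒰 → 𝒱 → 𝒳 → 𝒵 → ℝ := fun u v x z => log (N u v x z / D u v x z) - γ * log 2 with hi
  have hl2 : 0 < log 2 := log_pos (by norm_num)
  have hmean : 0 < ex Q fun ω => i ω.1 ω.2.1 ω.2.2.1 ω.2.2.2 := by
    have h1 : (fun ω : 𝒰 × 𝒱 × 𝒳 × 𝒵 => i ω.1 ω.2.1 ω.2.2.1 ω.2.2.2) = fun ω =>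
        log 2 * logb 2 (N ω.1 ω.2.1 ω.2.2.1 ω.2.2.2 / D ω.1 ω.2.1 ω.2.2.1 ω.2.2.2) +
          -(γ * log 2) := by
      ext ω
      simp only [hi, logb]
      field_simp
      ring
    rw [exJoint_eq_ex] at hγ
    rw [h1, ex_add, ex_const hQmem.2, ex_mul_left]
    nlinarith
  obtain ⟨s, hs, hlt⟩ := exists_ex_exp_lt_one hQmem hmean
  refine ⟨_, ex_nonneg hQmem.1 fun ω => (exp_pos _).le, hlt, fun n => ?_⟩
  have h2 := exJoint_eq_ex (pU := pU) (pV := pV) (pX := pX) (W := W)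
    fun u v x z => exp (-(s * i u v x z))
  rw [← hQ] at h2
  rw [← h2, ← exBlock_prod]
  refine exJoint_mono (fun u => prod_nonneg fun k _ => hU.1 _)
    (fun u v => prod_nonneg fun k _ => (hV _).1 _) (fun v x => prod_nonneg fun k _ => (hX _).1 _)
    (fun x z => prod_nonneg fun k _ => (hW _).1 _) fun u v x z hu hv hx hz => ?_
  have hp : ∀ k, 0 < N (u k) (v k) (x k) (z k) ∧ 0 < D (u k) (v k) (x k) (z k) := fun k =>
    hpos _ _ _ _ (prod_ne_zero_iff.1 hu k (mem_univ k)) (prod_ne_zero_iff.1 hv k (mem_univ k))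
      (prod_ne_zero_iff.1 hx k (mem_univ k)) (prod_ne_zero_iff.1 hz k (mem_univ k))
  by_cases h : (2 : ℝ) ^ ((n : ℝ) * γ) * ∏ k, D (u k) (v k) (x k) (z k) <
      ∏ k, N (u k) (v k) (x k) (z k)
  · unfold ind
    rw [if_neg (not_not.2 h)]
    exact prod_nonneg fun k _ => (exp_pos _).le
  · unfold ind
    rw [if_pos h, ← exp_sum, one_le_exp_iff, sum_neg_distrib, neg_nonneg, ← mul_sum]
    refine mul_nonpos_of_nonneg_of_nonpos hs.le ?_
    simp only [hi, sum_sub_distrib, sum_const, card_univ, Fintype.card_fin, nsmul_eq_mul]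
    rw [not_lt] at h
    have hND : 0 < ∏ k, N (u k) (v k) (x k) (z k) := prod_pos fun k _ => (hp k).1
    have hDD : 0 < ∏ k, D (u k) (v k) (x k) (z k) := prod_pos fun k _ => (hp k).2
    have h3 := log_le_log hND h
    rw [log_mul (by positivity) hDD.ne', log_rpow (by norm_num), log_prod fun k _ => (hp k).1.ne',
      log_prod fun k _ => (hp k).2.ne'] at h3
    have h4 : ∑ k, log (N (u k) (v k) (x k) (z k) / D (u k) (v k) (x k) (z k)) =
        ∑ k, log (N (u k) (v k) (x k) (z k)) - ∑ k, log (D (u k) (v k) (x k) (z k)) := by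
      rw [← sum_sub_distrib]
      exact sum_congr rfl fun k _ => log_div (hp k).1.ne' (hp k).2.ne'
    rw [h4]
    linarith

end Block

section CondMutualInfo

variable {Ω α β γ : Type*} [Fintype Ω] [Fintype α] [Fintype β] [Fintype γ]

theorem condMutualInfo_eq_sum (P : Ω → ℝ) (A : Ω → α) (B : Ω → β) (C : Ω → γ) :
    condMutualInfo P A B C = ∑ ω, P ω * logb 2 (law P (fun ω => (A ω, B ω, C ω)) (A ω, B ω, C ω) *
      law P C (C ω) / (law P (fun ω => (A ω, C ω)) (A ω, C ω) *
      law P (fun ω => (B ω, C ω)) (B ω, C ω))) := by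
  have h := sum_law_mul P (fun ω => (A ω, B ω, C ω)) fun x =>
    logb 2 (law P (fun ω => (A ω, B ω, C ω)) x * law P C x.2.2 /
      (law P (fun ω => (A ω, C ω)) (x.1, x.2.2) * law P (fun ω => (B ω, C ω)) x.2))
  simp only [Fintype.sum_prod_type] at h
  exact h

end CondMutualInfo

/-! ### Mutual informations as means of log-likelihood ratios. -/

section Kernels

variable {m m' : ℕ} {𝒰 𝒱 𝒳 β : Type*} {𝒴 : Fin (m + 1) → Type*} {𝒴' : Fin (m' + 1) → Type*}
  [Fintype 𝒰] [Fintype 𝒱] [Fintype 𝒳] [∀ i, Fintype (𝒴 i)] [∀ j, Fintype (𝒴' j)] [Fintype β]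
  {ch : Channel 𝒳 𝒴 𝒴'} {pU : 𝒰 → ℝ} {pV : 𝒰 → 𝒱 → ℝ} {pX : 𝒱 → 𝒳 → ℝ}

/-- The transition probabilities from `V` to the output of `w`. -/
noncomputable def kerV (pX : 𝒱 → 𝒳 → ℝ) (w : 𝒳 → β → ℝ) (v : 𝒱) (y : β) : ℝ :=
  ex (pX v) fun x => w x y

/-- The transition probabilities from `U` to the output of `w`. -/
noncomputable def kerU (pV : 𝒰 → 𝒱 → ℝ) (pX : 𝒱 → 𝒳 → ℝ) (w : 𝒳 → β → ℝ) (u : 𝒰) (y : β) : ℝ :=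
  ex (pV u) fun v => kerV pX w v y

/-- The pmf of the output of `w`. -/
noncomputable def outPmf (pU : 𝒰 → ℝ) (pV : 𝒰 → 𝒱 → ℝ) (pX : 𝒱 → 𝒳 → ℝ) (w : 𝒳 → β → ℝ)
    (y : β) : ℝ :=
  ex pU fun u => kerU pV pX w u y

theorem kerV_nonneg (hX : ∀ v, pX v ∈ stdSimplex ℝ 𝒳) {w : 𝒳 → β → ℝ} (hw : ∀ x y, 0 ≤ w x y)
    (v : 𝒱) (y : β) : 0 ≤ kerV pX w v y :=
  ex_nonneg (hX v).1 fun x => hw x y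

theorem kerU_nonneg (hV : ∀ u, pV u ∈ stdSimplex ℝ 𝒱) (hX : ∀ v, pX v ∈ stdSimplex ℝ 𝒳)
    {w : 𝒳 → β → ℝ} (hw : ∀ x y, 0 ≤ w x y) (u : 𝒰) (y : β) : 0 ≤ kerU pV pX w u y :=
  ex_nonneg (hV u).1 fun v => kerV_nonneg hX hw v y

theorem kerV_pos (hX : ∀ v, pX v ∈ stdSimplex ℝ 𝒳) {w : 𝒳 → β → ℝ} (hw : ∀ x y, 0 ≤ w x y)
    {v : 𝒱} {x : 𝒳} {y : β} (hx : pX v x ≠ 0) (hy : 0 < w x y) : 0 < kerV pX w v y :=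
  ex_pos (hX v).1 (fun x => hw x y) hx hy

theorem kerU_pos (hV : ∀ u, pV u ∈ stdSimplex ℝ 𝒱) (hX : ∀ v, pX v ∈ stdSimplex ℝ 𝒳)
    {w : 𝒳 → β → ℝ} (hw : ∀ x y, 0 ≤ w x y) {u : 𝒰} {v : 𝒱} {y : β} (hv : pV u v ≠ 0)
    (hy : 0 < kerV pX w v y) : 0 < kerU pV pX w u y :=
  ex_pos (hV u).1 (fun v => kerV_nonneg hX hw v y) hv hy

theorem outPmf_pos (hU : pU ∈ stdSimplex ℝ 𝒰) (hV : ∀ u, pV u ∈ stdSimplex ℝ 𝒱)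
    (hX : ∀ v, pX v ∈ stdSimplex ℝ 𝒳) {w : 𝒳 → β → ℝ} (hw : ∀ x y, 0 ≤ w x y) {u : 𝒰} {y : β}
    (hu : pU u ≠ 0) (hy : 0 < kerU pV pX w u y) : 0 < outPmf pU pV pX w y :=
  ex_pos hU.1 (fun u => kerU_nonneg hV hX hw u y) hu hy

section Laws

variable (φ : (∀ i, 𝒴 i) × (∀ j, 𝒴' j) → β)

theorem exJoint_eq_sum (F : 𝒰 → 𝒱 → 𝒳 → (∀ i, 𝒴 i) × (∀ j, 𝒴' j) → ℝ) :
    exJoint pU pV pX ch.W F =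
      ∑ ω, ch.joint (pairPmf pU pV) pX ω * F ω.1 ω.2.1 ω.2.2.1 ω.2.2.2 := by
  rw [exJoint_eq_ex]
  unfold ex Channel.joint pairPmf
  exact sum_congr rfl fun ω _ => by ring

theorem law_joint_U_eq (hV : ∀ u, pV u ∈ stdSimplex ℝ 𝒱) (hX : ∀ v, pX v ∈ stdSimplex ℝ 𝒳)
    (u : 𝒰) : law (ch.joint (pairPmf pU pV) pX) (fun ω => ω.1) u = pU u := by
  rw [law_joint_U hX]
  simp only [pairPmf, ← mul_sum, (hV u).2, mul_one]

theorem law_joint_UY (u : 𝒰) (y : β) :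
    law (ch.joint (pairPmf pU pV) pX) (fun ω => (ω.1, φ ω.2.2.2)) (u, y) =
      pU u * kerU pV pX (outLaw ch.W φ) u y := by
  rw [(((isOutput_joint ch (pairPmf pU pV) pX).comp fun x => x.1).map φ).law_pair]
  simp only [law_joint_UX, pairPmf, kerU, kerV, ex, mul_sum, sum_mul]
  rw [sum_comm]
  exact sum_congr rfl fun _ _ => sum_congr rfl fun _ _ => by ring

theorem law_joint_VY (hX : ∀ v, pX v ∈ stdSimplex ℝ 𝒳) (v : 𝒱) (y : β) :
    law (ch.joint (pairPmf pU pV) pX) (fun ω => (ω.2.1, φ ω.2.2.2)) (v, y) =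
      law (ch.joint (pairPmf pU pV) pX) (fun ω => ω.2.1) v * kerV pX (outLaw ch.W φ) v y := by
  rw [(((isOutput_joint ch (pairPmf pU pV) pX).comp fun x => x.2).map φ).law_pair]
  simp only [law_joint_VX, law_joint_V hX, kerV, ex, mul_sum, mul_assoc]

theorem law_joint_Y (y : β) :
    law (ch.joint (pairPmf pU pV) pX) (fun ω => φ ω.2.2.2) y =
      outPmf pU pV pX (outLaw ch.W φ) y := by
  rw [← sum_law_pair_left _ fun ω => ω.1]
  simp only [law_joint_UY, outPmf, ex]

/-- The marginal of U cancels on the support, leaving the mean of the ratio on which `TestU` is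
built. The next three lemmas do this for the other tests. -/
theorem mutualInfo_joint_U (hU : pU ∈ stdSimplex ℝ 𝒰) (hV : ∀ u, pV u ∈ stdSimplex ℝ 𝒱)
    (hX : ∀ v, pX v ∈ stdSimplex ℝ 𝒳) :
    mutualInfo (ch.joint (pairPmf pU pV) pX) (fun ω => ω.1) (fun ω => φ ω.2.2.2) =
      exJoint pU pV pX ch.W fun u _ _ z => logb 2 (kerU pV pX (outLaw ch.W φ) u (φ z) /
        outPmf pU pV pX (outLaw ch.W φ) (φ z)) := by
  set P := ch.joint (pairPmf pU pV) pX with hP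
  have hPmem : P ∈ stdSimplex ℝ _ := joint_mem_stdSimplex (pairPmf_mem_stdSimplex hU hV) hX
  have h := sum_law_mul P (fun ω => (ω.1, φ ω.2.2.2)) fun x =>
    logb 2 (law P (fun ω => (ω.1, φ ω.2.2.2)) x /
      (law P (fun ω => ω.1) x.1 * law P (fun ω => φ ω.2.2.2) x.2))
  rw [Fintype.sum_prod_type] at h
  unfold mutualInfo
  rw [h, exJoint_eq_sum]
  refine sum_congr rfl fun ω _ => ?_
  by_cases h0 : P ω = 0
  · rw [← hP, h0, zero_mul, zero_mul]
  have h1 := (law_apply_pos hPmem.1 (fun ω => ω.1) h0).ne'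
  rw [law_joint_U_eq hV hX] at h1
  rw [law_joint_UY, law_joint_U_eq hV hX, law_joint_Y, mul_div_mul_left _ _ h1]

theorem mutualInfo_joint_V (hU : pU ∈ stdSimplex ℝ 𝒰) (hV : ∀ u, pV u ∈ stdSimplex ℝ 𝒱)
    (hX : ∀ v, pX v ∈ stdSimplex ℝ 𝒳) :
    mutualInfo (ch.joint (pairPmf pU pV) pX) (fun ω => ω.2.1) (fun ω => φ ω.2.2.2) =
      exJoint pU pV pX ch.W fun _ v _ z => logb 2 (kerV pX (outLaw ch.W φ) v (φ z) /
        outPmf pU pV pX (outLaw ch.W φ) (φ z)) := by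
  set P := ch.joint (pairPmf pU pV) pX with hP
  have hPmem : P ∈ stdSimplex ℝ _ := joint_mem_stdSimplex (pairPmf_mem_stdSimplex hU hV) hX
  have h := sum_law_mul P (fun ω => (ω.2.1, φ ω.2.2.2)) fun x =>
    logb 2 (law P (fun ω => (ω.2.1, φ ω.2.2.2)) x /
      (law P (fun ω => ω.2.1) x.1 * law P (fun ω => φ ω.2.2.2) x.2))
  rw [Fintype.sum_prod_type] at h
  unfold mutualInfo
  rw [h, exJoint_eq_sum]
  refine sum_congr rfl fun ω _ => ?_
  by_cases h0 : P ω = 0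
  · rw [← hP, h0, zero_mul, zero_mul]
  have h1 := (law_apply_pos hPmem.1 (fun ω => ω.2.1) h0).ne'
  rw [law_joint_VY φ hX, law_joint_Y, mul_div_mul_left _ _ h1]

theorem condMutualInfo_joint_U (hU : pU ∈ stdSimplex ℝ 𝒰) (hV : ∀ u, pV u ∈ stdSimplex ℝ 𝒱)
    (hX : ∀ v, pX v ∈ stdSimplex ℝ 𝒳) :
    condMutualInfo (ch.joint (pairPmf pU pV) pX) (fun ω => ω.2.2.1) (fun ω => φ ω.2.2.2)
      (fun ω => ω.1) =
      exJoint pU pV pX ch.W fun u _ x z => logb 2 (outLaw ch.W φ x (φ z) /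
        kerU pV pX (outLaw ch.W φ) u (φ z)) := by
  set P := ch.joint (pairPmf pU pV) pX with hP
  have hPmem : P ∈ stdSimplex ℝ _ := joint_mem_stdSimplex (pairPmf_mem_stdSimplex hU hV) hX
  rw [condMutualInfo_eq_sum, exJoint_eq_sum]
  refine sum_congr rfl fun ω _ => ?_
  by_cases h0 : P ω = 0
  · rw [← hP, h0, zero_mul, zero_mul]
  have h1 := (law_apply_pos hPmem.1 (fun ω => ω.1) h0).ne'
  have h2 := (law_apply_pos hPmem.1 (fun ω => (ω.2.2.1, ω.1)) h0).ne'
  have e1 : law P (fun ω => (ω.2.2.1, φ ω.2.2.2, ω.1)) (ω.2.2.1, φ ω.2.2.2, ω.1) =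
      law P (fun ω => (ω.2.2.1, ω.1)) (ω.2.2.1, ω.1) * outLaw ch.W φ ω.2.2.1 (φ ω.2.2.2) := by
    have := (((isOutput_joint ch (pairPmf pU pV) pX).comp fun x => x.1).map φ) ω.1 ω.2.2.1
      (φ ω.2.2.2)
    rw [law_congr_apply (B := fun ω => (ω.2.2.1, φ ω.2.2.2, ω.1))
      (b := (ω.2.2.1, φ ω.2.2.2, ω.1)) (by simp only [Prod.mk.injEq]; tauto)]
      at this
    have e3 : law P (fun ω => (ω.2.2.1, ω.1)) (ω.2.2.1, ω.1) =
        law P (fun ω => (ω.1, ω.2.2.1)) (ω.1, ω.2.2.1) :=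
      law_congr_apply (by simp only [Prod.mk.injEq]; tauto)
    rw [e3]
    exact this
  have e2 : law P (fun ω => (φ ω.2.2.2, ω.1)) (φ ω.2.2.2, ω.1) =
      pU ω.1 * kerU pV pX (outLaw ch.W φ) ω.1 (φ ω.2.2.2) := by
    rw [← law_joint_UY]
    exact law_congr_apply (by simp only [Prod.mk.injEq]; tauto)
  rw [law_joint_U_eq hV hX] at h1
  rw [e1, e2, law_joint_U_eq hV hX, mul_assoc, mul_div_mul_left _ _ h2, mul_comm (pU ω.1),
    mul_div_mul_right _ _ h1]

theorem condMutualInfo_joint_V (hU : pU ∈ stdSimplex ℝ 𝒰) (hV : ∀ u, pV u ∈ stdSimplex ℝ 𝒱)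
    (hX : ∀ v, pX v ∈ stdSimplex ℝ 𝒳) :
    condMutualInfo (ch.joint (pairPmf pU pV) pX) (fun ω => ω.2.2.1) (fun ω => φ ω.2.2.2)
      (fun ω => ω.2.1) =
      exJoint pU pV pX ch.W fun _ v x z => logb 2 (outLaw ch.W φ x (φ z) /
        kerV pX (outLaw ch.W φ) v (φ z)) := by
  set P := ch.joint (pairPmf pU pV) pX with hP
  have hPmem : P ∈ stdSimplex ℝ _ := joint_mem_stdSimplex (pairPmf_mem_stdSimplex hU hV) hX
  rw [condMutualInfo_eq_sum, exJoint_eq_sum]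
  refine sum_congr rfl fun ω _ => ?_
  by_cases h0 : P ω = 0
  · rw [← hP, h0, zero_mul, zero_mul]
  have h1 := (law_apply_pos hPmem.1 (fun ω => ω.2.1) h0).ne'
  have h2 := (law_apply_pos hPmem.1 (fun ω => (ω.2.2.1, ω.2.1)) h0).ne'
  have e1 : law P (fun ω => (ω.2.2.1, φ ω.2.2.2, ω.2.1)) (ω.2.2.1, φ ω.2.2.2, ω.2.1) =
      law P (fun ω => (ω.2.2.1, ω.2.1)) (ω.2.2.1, ω.2.1) *
        outLaw ch.W φ ω.2.2.1 (φ ω.2.2.2) := by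
    have := (((isOutput_joint ch (pairPmf pU pV) pX).comp fun x => x.2).map φ) ω.2.1 ω.2.2.1
      (φ ω.2.2.2)
    rw [law_congr_apply (B := fun ω => (ω.2.2.1, φ ω.2.2.2, ω.2.1))
      (b := (ω.2.2.1, φ ω.2.2.2, ω.2.1)) (by simp only [Prod.mk.injEq]; tauto)]
      at this
    have e3 : law P (fun ω => (ω.2.2.1, ω.2.1)) (ω.2.2.1, ω.2.1) =
        law P (fun ω => (ω.2.1, ω.2.2.1)) (ω.2.1, ω.2.2.1) :=
      law_congr_apply (by simp only [Prod.mk.injEq]; tauto)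
    rw [e3]
    exact this
  have e2 : law P (fun ω => (φ ω.2.2.2, ω.2.1)) (φ ω.2.2.2, ω.2.1) =
      law P (fun ω => ω.2.1) ω.2.1 * kerV pX (outLaw ch.W φ) ω.2.1 (φ ω.2.2.2) := by
    rw [← law_joint_VY φ hX]
    exact law_congr_apply (by simp only [Prod.mk.injEq]; tauto)
  rw [e1, e2, mul_assoc, mul_div_mul_left _ _ h2, mul_comm (law P (fun ω => ω.2.1) ω.2.1),
    mul_div_mul_right _ _ h1]

end Laws

end Kernels

end MultilevelBC

namespace MultilevelBC

open Finset Real Filter Topology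

/-! ### False acceptance by likelihood ratio tests. -/

section UnionBound

variable {A B ι : Type*} [Fintype A] [Fintype B] [Fintype ι] [DecidableEq ι]

/-- A likelihood ratio test accepts independent symbols with small probability. -/
theorem ex_piPmf_ind_le {w g : ι → A → ℝ} (hw : ∀ i a, 0 ≤ w i a) (hg : ∀ i a, 0 ≤ g i a) {τ : ℝ}
    (hτ : 0 < τ) :
    (ex (piPmf w) fun f => ind (τ * ∏ i, ex (w i) (g i) < ∏ i, g i (f i))) ≤ τ⁻¹ := by
  have h := ex_ind_le (w := piPmf w) (N := fun f => ∏ i, g i (f i))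
    (fun f => prod_nonneg fun i _ => hw _ _)
    (fun f => prod_nonneg fun i _ => hg _ _) hτ
  rwa [ex_piPmf_prod] at h

/-- Two layers are drawn but only the second is tested: Markov's inequality is applied under the pmf
of the pair. -/
theorem ex_piPmf_piPmf_ind_le {w : ι → A → ℝ} {k : A → B → ℝ} {g : ι → B → ℝ}
    (hw : ∀ i a, 0 ≤ w i a) (hk : ∀ a b, 0 ≤ k a b) (hg : ∀ i b, 0 ≤ g i b) {τ : ℝ} (hτ : 0 < τ) :
    (ex (piPmf w) fun f => ex (piPmf fun i => k (f i)) fun h =>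
      ind (τ * ∏ i, ex (w i) (fun a => ex (k a) (g i)) < ∏ i, g i (h i))) ≤ τ⁻¹ := by
  have h1 : ∏ i, ex (w i) (fun a => ex (k a) (g i)) =
      ex (pairPmf (piPmf w) fun f => piPmf fun i => k (f i)) fun x => ∏ i, g i (x.2 i) := by
    rw [ex_pairPmf, ← ex_piPmf_prod]
    congr 1
    ext f
    exact (ex_piPmf_prod (fun i => k (f i)) g).symm
  rw [h1, ← ex_pairPmf _ _ fun x : (ι → A) × (ι → B) => ind (τ * ex (pairPmf (piPmf w) fun f =>
    piPmf fun i => k (f i)) (fun x => ∏ i, g i (x.2 i)) < ∏ i, g i (x.2 i))]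
  exact ex_ind_le (N := fun x : (ι → A) × (ι → B) => ∏ i, g i (x.2 i))
    (fun x => mul_nonneg (prod_nonneg fun i _ => hw _ _) (prod_nonneg fun i _ => hk _ _))
    (fun f => prod_nonneg fun i _ => hg _ _) hτ

theorem exJoint_le {𝒰 𝒱 𝒳 𝒵 : Type*} [Fintype 𝒰] [Fintype 𝒱] [Fintype 𝒳] [Fintype 𝒵]
    {pU : 𝒰 → ℝ} {pV : 𝒰 → 𝒱 → ℝ} {pX : 𝒱 → 𝒳 → ℝ} {W : 𝒳 → 𝒵 → ℝ}
    (hU : pU ∈ stdSimplex ℝ 𝒰) (hV : ∀ u, pV u ∈ stdSimplex ℝ 𝒱)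
    (hX : ∀ v, pX v ∈ stdSimplex ℝ 𝒳) (hW : ∀ x, W x ∈ stdSimplex ℝ 𝒵) {c : ℝ}
    {F : 𝒰 → 𝒱 → 𝒳 → 𝒵 → ℝ} (h : ∀ u v x z, F u v x z ≤ c) : exJoint pU pV pX W F ≤ c :=
  (exJoint_mono hU.1 (fun u => (hV u).1) (fun v => (hX v).1) (fun x => (hW x).1)
    fun u v x z _ _ _ _ => h u v x z).trans (exJoint_const hU hV hX hW c).le

end UnionBound

/-! ### Sizes of the message sets. -/

section Counting

theorem card_msg_sub_one_le (n : ℕ) (R : ℝ) :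
    ((Fintype.card (Msg n R) - 1 : ℕ) : ℝ) ≤ 2 ^ ((n : ℝ) * R) := by
  have h0 : 0 < Fintype.card (Msg n R) := Fintype.card_pos
  have h := Nat.ceil_lt_add_one (a := (2 : ℝ) ^ ((n : ℝ) * R)) (by positivity)
  rw [Nat.cast_sub h0, Fintype.card_fin, Nat.cast_one]
  linarith

theorem card_msg_le (n : ℕ) {R : ℝ} (hR : 0 ≤ R) :
    (Fintype.card (Msg n R) : ℝ) ≤ 2 * 2 ^ ((n : ℝ) * R) := by
  have h1 : (1 : ℝ) ≤ 2 ^ ((n : ℝ) * R) := one_le_rpow (by norm_num) (by positivity)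
  have h := Nat.ceil_lt_add_one (a := (2 : ℝ) ^ ((n : ℝ) * R)) (by positivity)
  rw [Fintype.card_fin]
  linarith

/-- The first factor counts the wrong messages. At `R = 0` there are none, so `γ` is then
unrestricted; otherwise the product is at most 2 · 2^{n(R+S-γ)}, the 2 coming from the ceiling in
the second factor. -/
theorem tendsto_card_msg_sub_one_mul {R S γ : ℝ} (hS : 0 ≤ S) (h : R = 0 ∨ R + S < γ) :
    Tendsto (fun n : ℕ => ((Fintype.card (Msg n R) - 1 : ℕ) : ℝ) *
      (Fintype.card (Msg n S) * ((2 : ℝ) ^ ((n : ℝ) * γ))⁻¹)) atTop (𝓝 0) := by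
  rcases h with rfl | h
  · simp
  have hθ : (2 : ℝ) ^ (R + S - γ) < 1 := rpow_lt_one_of_one_lt_of_neg (by norm_num) (by linarith)
  have hlim : Tendsto (fun n : ℕ => 2 * ((2 : ℝ) ^ (R + S - γ)) ^ n) atTop (𝓝 0) := by
    simpa using (tendsto_pow_atTop_nhds_zero_of_lt_one (by positivity) hθ).const_mul 2
  refine squeeze_zero (fun n => by positivity) (fun n => ?_) hlim
  calc ((Fintype.card (Msg n R) - 1 : ℕ) : ℝ) *
        (Fintype.card (Msg n S) * ((2 : ℝ) ^ ((n : ℝ) * γ))⁻¹)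
      ≤ 2 ^ ((n : ℝ) * R) * (2 * 2 ^ ((n : ℝ) * S) * ((2 : ℝ) ^ ((n : ℝ) * γ))⁻¹) := by
        gcongr
        · exact card_msg_sub_one_le n R
        · exact card_msg_le n hS
    _ = 2 * ((2 : ℝ) ^ (R + S - γ)) ^ n := by
        rw [← rpow_natCast, ← rpow_mul (by norm_num), ← rpow_neg (by norm_num),
          show (R + S - γ) * (n : ℝ) = n * R + n * S + -(n * γ) by ring, rpow_add (by norm_num),
          rpow_add (by norm_num)]
        ring

theorem tendsto_card_msg_sub_one_mul_inv {R γ : ℝ} (h : R = 0 ∨ R < γ) :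
    Tendsto (fun n : ℕ => ((Fintype.card (Msg n R) - 1 : ℕ) : ℝ) * ((2 : ℝ) ^ ((n : ℝ) * γ))⁻¹)
      atTop (𝓝 0) := by
  simpa using tendsto_card_msg_sub_one_mul (S := 0) le_rfl (by simpa using h)

/-- A message of rate `S₁ + S₂` is split into messages of rates `S₁` and `S₂`. -/
theorem exists_injective_msg (n : ℕ) (S₁ S₂ : ℝ) :
    ∃ s : Msg n (S₁ + S₂) → Msg n S₁ × Msg n S₂, Function.Injective s := by
  have h : Fintype.card (Msg n (S₁ + S₂)) ≤ Fintype.card (Msg n S₁ × Msg n S₂) := by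
    rw [Fintype.card_prod]
    simp only [Fintype.card_fin]
    rw [mul_add, rpow_add (by norm_num)]
    refine Nat.ceil_le.2 ?_
    push_cast
    gcongr <;> exact Nat.le_ceil _
  obtain ⟨e⟩ := Function.Embedding.nonempty_of_card_le h
  exact ⟨e, e.injective⟩

end Counting

/-! ### Decoders that look for a codeword passing the tests. -/

section Decoding

variable {m m' : ℕ} {𝒰 𝒱 𝒳 I J : Type*} {𝒴 : Fin (m + 1) → Type*} {𝒴' : Fin (m' + 1) → Type*}
  [Fintype 𝒳] [∀ i, Fintype (𝒴 i)] [∀ j, Fintype (𝒴' j)] {ch : Channel 𝒳 𝒴 𝒴'}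

/-- Every receiver looks for the message that passes its test. -/
theorem exists_code_isError_confusion (n : ℕ) {R₀ R₁ : ℝ}
    (C : Msg n R₀ → 𝒰 × (I → 𝒱 × (J → Fin n → 𝒳))) {s : Msg n R₁ → I × J}
    (hs : Function.Injective s) (T : ∀ i, 𝒰 → (Fin n → 𝒴 i) → Prop)
    (T' : ∀ j, 𝒱 → (Fin n → 𝒴' j) → Prop) (S : 𝒰 → (Fin n → 𝒳) → (Fin n → 𝒴 0) → Prop)
    (S' : 𝒱 → (Fin n → 𝒳) → (Fin n → 𝒴 0) → Prop) :
    ∃ c : Code 𝒳 𝒴 𝒴' n R₀ R₁, (∀ k l, c.enc k l = ((C k).2 (s l).1).2 (s l).2) ∧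
      ∀ k l z, c.IsError k l z → Confusion (fun i u (z : Fin n → _) => T i u fun t => (z t).1 i)
        (fun j v z => T' j v fun t => (z t).2 j) (fun u x z => S u x fun t => (z t).1 0)
        (fun v x z => S' v x fun t => (z t).1 0) C k (s l).1 (s l).2 z := by
  obtain ⟨d, hd⟩ : ∃ d : ∀ i, (Fin n → 𝒴 i) → Msg n R₀, ∀ i y, (∃ k, T i (C k).1 y) →
      T i (C (d i y)).1 y :=
    ⟨fun i y => Classical.epsilon fun k => T i (C k).1 y, fun i y h => Classical.epsilon_spec h⟩
  obtain ⟨d', hd'⟩ : ∃ d' : ∀ j, (Fin n → 𝒴' j) → Msg n R₀, ∀ j y,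
      (∃ k, ∃ i, T' j ((C k).2 i).1 y) → ∃ i, T' j ((C (d' j y)).2 i).1 y :=
    ⟨fun j y => Classical.epsilon fun k => ∃ i, T' j ((C k).2 i).1 y,
      fun j y h => Classical.epsilon_spec h⟩
  -- The private message is sought below the common estimate `d 0 y`. The variable `k` lets that
  -- estimate be replaced by the message sent, once it is known to be right.
  obtain ⟨dP, hdP⟩ : ∃ dP : (Fin n → 𝒴 0) → Msg n R₁, ∀ y, ∀ k, d 0 y = k →
      (∃ l, S (C k).1 (((C k).2 (s l).1).2 (s l).2) y ∧
        S' ((C k).2 (s l).1).1 (((C k).2 (s l).1).2 (s l).2) y) →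
      S (C k).1 (((C k).2 (s (dP y)).1).2 (s (dP y)).2) y ∧
        S' ((C k).2 (s (dP y)).1).1 (((C k).2 (s (dP y)).1).2 (s (dP y)).2) y := by
    refine ⟨fun y => Classical.epsilon fun l =>
      S (C (d 0 y)).1 (((C (d 0 y)).2 (s l).1).2 (s l).2) y ∧
        S' ((C (d 0 y)).2 (s l).1).1 (((C (d 0 y)).2 (s l).1).2 (s l).2) y, ?_⟩
    rintro y _ rfl h
    exact Classical.epsilon_spec h
  refine ⟨⟨fun k l => ((C k).2 (s l).1).2 (s l).2, d, d', dP⟩, fun k l => rfl, fun k l z hE => ?_⟩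
  by_contra hC
  unfold Confusion at hC
  push Not at hC
  obtain ⟨c1, c2, c3, c4, c5, c6, c7, c8⟩ := hC
  have hdec : ∀ i, d i (fun t => (z t).1 i) = k := by
    intro i
    by_contra hne
    exact c2 i _ hne (hd i _ ⟨k, c1 i⟩)
  rcases hE with ⟨i, hi⟩ | ⟨j, hj⟩ | hl
  · exact hi (hdec i)
  · obtain ⟨i, h⟩ := hd' j (fun t => (z t).2 j) ⟨k, (s l).1, c3 j⟩
    exact c4 j _ hj i h
  · have h := hdP _ k (hdec 0) ⟨l, c5, c6⟩
    refine hl (hs ?_)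
    -- The test `S` excludes a wrong branch; on the right branch `S'` excludes a wrong leaf.
    have h1 : (s (dP fun t => (z t).1 0)).1 = (s l).1 := by
      by_contra hne
      exact c7 _ hne _ h.1
    refine Prod.ext h1 ?_
    by_contra hne
    rw [h1] at h
    exact c8 _ hne h.2

theorem Code.errorProb_le {n : ℕ} {R₀ R₁ : ℝ} (c : Code 𝒳 𝒴 𝒴' n R₀ R₁)
    {E : Msg n R₀ → Msg n R₁ → (Fin n → (∀ i, 𝒴 i) × (∀ j, 𝒴' j)) → Prop}
    (hE : ∀ k l z, c.IsError k l z → E k l z) :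
    c.errorProb ch ≤ (∑ k, ∑ l, ex (piPmf fun t => ch.W (c.enc k l t)) fun z => ind (E k l z)) /
      ((Fintype.card (Msg n R₀) : ℝ) * Fintype.card (Msg n R₁)) := by
  classical
  unfold Code.errorProb
  gcongr with k _ l _
  refine sum_le_sum fun z _ => ?_
  split_ifs with h
  · have h1 : ind (E k l z) = 1 := if_pos (hE k l z h)
    change _ ≤ (∏ t, ch.W (c.enc k l t) (z t)) * ind (E k l z)
    rw [h1, mul_one]
  · exact mul_nonneg (prod_nonneg fun t _ => (ch.isPmf _).1 _) (ind_nonneg _)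

end Decoding

end MultilevelBC

namespace MultilevelBC

open Finset Real Filter Topology

/-! ### The four likelihood ratio tests and their error probabilities. -/

section Tests

variable {m m' : ℕ} {𝒰 𝒱 𝒳 β : Type*} {𝒴 : Fin (m + 1) → Type*} {𝒴' : Fin (m' + 1) → Type*}
  [Fintype 𝒰] [Fintype 𝒱] [Fintype 𝒳] [∀ i, Fintype (𝒴 i)] [∀ j, Fintype (𝒴' j)] [Fintype β]
  {ch : Channel 𝒳 𝒴 𝒴'} {pU : 𝒰 → ℝ} {pV : 𝒰 → 𝒱 → ℝ} {pX : 𝒱 → 𝒳 → ℝ}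

/-- The likelihood ratio test of the output `y` against the codeword `u`. -/
def TestU (pU : 𝒰 → ℝ) (pV : 𝒰 → 𝒱 → ℝ) (pX : 𝒱 → 𝒳 → ℝ) (w : 𝒳 → β → ℝ) (n : ℕ) (γ : ℝ)
    (u : Fin n → 𝒰) (y : Fin n → β) : Prop :=
  (2 : ℝ) ^ ((n : ℝ) * γ) * ∏ k, outPmf pU pV pX w (y k) < ∏ k, kerU pV pX w (u k) (y k)

/-- The likelihood ratio test of the output `y` against the codeword `v`. -/
def TestV (pU : 𝒰 → ℝ) (pV : 𝒰 → 𝒱 → ℝ) (pX : 𝒱 → 𝒳 → ℝ) (w : 𝒳 → β → ℝ) (n : ℕ) (γ : ℝ)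
    (v : Fin n → 𝒱) (y : Fin n → β) : Prop :=
  (2 : ℝ) ^ ((n : ℝ) * γ) * ∏ k, outPmf pU pV pX w (y k) < ∏ k, kerV pX w (v k) (y k)

/-- The likelihood ratio test of the output `y` against the codeword `x`, given `u`. -/
def TestXU (pV : 𝒰 → 𝒱 → ℝ) (pX : 𝒱 → 𝒳 → ℝ) (w : 𝒳 → β → ℝ) (n : ℕ) (γ : ℝ)
    (u : Fin n → 𝒰) (x : Fin n → 𝒳) (y : Fin n → β) : Prop :=
  (2 : ℝ) ^ ((n : ℝ) * γ) * ∏ k, kerU pV pX w (u k) (y k) < ∏ k, w (x k) (y k)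

/-- The likelihood ratio test of the output `y` against the codeword `x`, given `v`. -/
def TestXV (pX : 𝒱 → 𝒳 → ℝ) (w : 𝒳 → β → ℝ) (n : ℕ) (γ : ℝ)
    (v : Fin n → 𝒱) (x : Fin n → 𝒳) (y : Fin n → β) : Prop :=
  (2 : ℝ) ^ ((n : ℝ) * γ) * ∏ k, kerV pX w (v k) (y k) < ∏ k, w (x k) (y k)

section Accept

variable {w : 𝒳 → β → ℝ}

/-- At fixed `y` the likelihood in the numerator has the denominator as its mean, so Markov's
inequality yields the inverse of the threshold. The other three tests behave alike. -/
theorem ex_testU_le (hU : pU ∈ stdSimplex ℝ 𝒰) (hV : ∀ u, pV u ∈ stdSimplex ℝ 𝒱)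
    (hX : ∀ v, pX v ∈ stdSimplex ℝ 𝒳) (hw : ∀ x y, 0 ≤ w x y) (n : ℕ) (γ : ℝ) (y : Fin n → β) :
    (ex (piPmf fun _ => pU) fun u => ind (TestU pU pV pX w n γ u y)) ≤
      ((2 : ℝ) ^ ((n : ℝ) * γ))⁻¹ :=
  ex_piPmf_ind_le (w := fun _ => pU) (g := fun k u => kerU pV pX w u (y k)) (fun _ => hU.1)
    (fun _ _ => kerU_nonneg hV hX hw _ _) (by positivity)

theorem ex_testV_le (hU : pU ∈ stdSimplex ℝ 𝒰) (hV : ∀ u, pV u ∈ stdSimplex ℝ 𝒱)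
    (hX : ∀ v, pX v ∈ stdSimplex ℝ 𝒳) (hw : ∀ x y, 0 ≤ w x y) (n : ℕ) (γ : ℝ) (y : Fin n → β) :
    (ex (piPmf fun _ => pU) fun u => ex (piPmf fun k => pV (u k)) fun v =>
      ind (TestV pU pV pX w n γ v y)) ≤ ((2 : ℝ) ^ ((n : ℝ) * γ))⁻¹ :=
  ex_piPmf_piPmf_ind_le (w := fun _ => pU) (k := pV) (g := fun k v => kerV pX w v (y k))
    (fun _ => hU.1) (fun u => (hV u).1) (fun _ _ => kerV_nonneg hX hw _ _) (by positivity)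

theorem ex_testXU_le (hV : ∀ u, pV u ∈ stdSimplex ℝ 𝒱)
    (hX : ∀ v, pX v ∈ stdSimplex ℝ 𝒳) (hw : ∀ x y, 0 ≤ w x y) (n : ℕ) (γ : ℝ) (u : Fin n → 𝒰)
    (y : Fin n → β) :
    (ex (piPmf fun k => pV (u k)) fun v => ex (piPmf fun k => pX (v k)) fun x =>
      ind (TestXU pV pX w n γ u x y)) ≤ ((2 : ℝ) ^ ((n : ℝ) * γ))⁻¹ :=
  ex_piPmf_piPmf_ind_le (w := fun k => pV (u k)) (k := pX) (g := fun k x => w x (y k))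
    (fun _ => (hV _).1) (fun v => (hX v).1) (fun _ _ => hw _ _) (by positivity)

theorem ex_testXV_le (hX : ∀ v, pX v ∈ stdSimplex ℝ 𝒳) (hw : ∀ x y, 0 ≤ w x y) (n : ℕ) (γ : ℝ)
    (v : Fin n → 𝒱) (y : Fin n → β) :
    (ex (piPmf fun k => pX (v k)) fun x => ind (TestXV pX w n γ v x y)) ≤
      ((2 : ℝ) ^ ((n : ℝ) * γ))⁻¹ :=
  ex_piPmf_ind_le (w := fun k => pX (v k)) (g := fun k x => w x (y k)) (fun _ => (hX _).1)
    (fun _ _ => hw _ _) (by positivity)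

end Accept

section Reject

variable (φ : (∀ i, 𝒴 i) × (∀ j, 𝒴' j) → β)

theorem exists_testU_reject_le (hU : pU ∈ stdSimplex ℝ 𝒰) (hV : ∀ u, pV u ∈ stdSimplex ℝ 𝒱)
    (hX : ∀ v, pX v ∈ stdSimplex ℝ 𝒳) {γ : ℝ}
    (hγ : γ < mutualInfo (ch.joint (pairPmf pU pV) pX) (fun ω => ω.1) (fun ω => φ ω.2.2.2)) :
    ∃ θ : ℝ, 0 ≤ θ ∧ θ < 1 ∧ ∀ n, exBlock pU pV pX ch.W n (fun u _ _ z =>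
      ind (¬TestU pU pV pX (outLaw ch.W φ) n γ u fun k => φ (z k))) ≤ θ ^ n := by
  rw [mutualInfo_joint_U φ hU hV hX] at hγ
  unfold TestU
  refine exists_exBlock_reject_le (N := fun u _ _ z => kerU pV pX (outLaw ch.W φ) u (φ z))
    (D := fun _ _ _ z => outPmf pU pV pX (outLaw ch.W φ) (φ z)) hU hV hX ch.isPmf
    (fun u v x z hu hv hx hz => ?_) hγ
  have hw := outLaw_nonneg ch.isPmf φ
  have hU0 := kerU_pos hV hX hw hv (kerV_pos hX hw hx (law_apply_pos (ch.isPmf x).1 φ hz))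
  exact ⟨hU0, outPmf_pos hU hV hX hw hu hU0⟩

theorem exists_testV_reject_le (hU : pU ∈ stdSimplex ℝ 𝒰) (hV : ∀ u, pV u ∈ stdSimplex ℝ 𝒱)
    (hX : ∀ v, pX v ∈ stdSimplex ℝ 𝒳) {γ : ℝ}
    (hγ : γ < mutualInfo (ch.joint (pairPmf pU pV) pX) (fun ω => ω.2.1) (fun ω => φ ω.2.2.2)) :
    ∃ θ : ℝ, 0 ≤ θ ∧ θ < 1 ∧ ∀ n, exBlock pU pV pX ch.W n (fun _ v _ z =>
      ind (¬TestV pU pV pX (outLaw ch.W φ) n γ v fun k => φ (z k))) ≤ θ ^ n := by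
  rw [mutualInfo_joint_V φ hU hV hX] at hγ
  unfold TestV
  refine exists_exBlock_reject_le (N := fun _ v _ z => kerV pX (outLaw ch.W φ) v (φ z))
    (D := fun _ _ _ z => outPmf pU pV pX (outLaw ch.W φ) (φ z)) hU hV hX ch.isPmf
    (fun u v x z hu hv hx hz => ?_) hγ
  have hw := outLaw_nonneg ch.isPmf φ
  have hV0 := kerV_pos hX hw hx (law_apply_pos (ch.isPmf x).1 φ hz)
  exact ⟨hV0, outPmf_pos hU hV hX hw hu (kerU_pos hV hX hw hv hV0)⟩

theorem exists_testXU_reject_le (hU : pU ∈ stdSimplex ℝ 𝒰) (hV : ∀ u, pV u ∈ stdSimplex ℝ 𝒱)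
    (hX : ∀ v, pX v ∈ stdSimplex ℝ 𝒳) {γ : ℝ}
    (hγ : γ < condMutualInfo (ch.joint (pairPmf pU pV) pX) (fun ω => ω.2.2.1)
      (fun ω => φ ω.2.2.2) (fun ω => ω.1)) :
    ∃ θ : ℝ, 0 ≤ θ ∧ θ < 1 ∧ ∀ n, exBlock pU pV pX ch.W n (fun u _ x z =>
      ind (¬TestXU pV pX (outLaw ch.W φ) n γ u x fun k => φ (z k))) ≤ θ ^ n := by
  rw [condMutualInfo_joint_U φ hU hV hX] at hγ
  unfold TestXU
  refine exists_exBlock_reject_le (N := fun _ _ x z => outLaw ch.W φ x (φ z))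
    (D := fun u _ _ z => kerU pV pX (outLaw ch.W φ) u (φ z)) hU hV hX ch.isPmf
    (fun u v x z hu hv hx hz => ?_) hγ
  have hw := outLaw_nonneg ch.isPmf φ
  have h0 : 0 < outLaw ch.W φ x (φ z) := law_apply_pos (ch.isPmf x).1 φ hz
  exact ⟨h0, kerU_pos hV hX hw hv (kerV_pos hX hw hx h0)⟩

theorem exists_testXV_reject_le (hU : pU ∈ stdSimplex ℝ 𝒰) (hV : ∀ u, pV u ∈ stdSimplex ℝ 𝒱)
    (hX : ∀ v, pX v ∈ stdSimplex ℝ 𝒳) {γ : ℝ}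
    (hγ : γ < condMutualInfo (ch.joint (pairPmf pU pV) pX) (fun ω => ω.2.2.1)
      (fun ω => φ ω.2.2.2) (fun ω => ω.2.1)) :
    ∃ θ : ℝ, 0 ≤ θ ∧ θ < 1 ∧ ∀ n, exBlock pU pV pX ch.W n (fun _ v x z =>
      ind (¬TestXV pX (outLaw ch.W φ) n γ v x fun k => φ (z k))) ≤ θ ^ n := by
  rw [condMutualInfo_joint_V φ hU hV hX] at hγ
  unfold TestXV
  refine exists_exBlock_reject_le (N := fun _ _ x z => outLaw ch.W φ x (φ z))
    (D := fun _ v _ z => kerV pX (outLaw ch.W φ) v (φ z)) hU hV hX ch.isPmf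
    (fun u v x z hu hv hx hz => ?_) hγ
  have hw := outLaw_nonneg ch.isPmf φ
  have h0 : 0 < outLaw ch.W φ x (φ z) := law_apply_pos (ch.isPmf x).1 φ hz
  exact ⟨h0, kerV_pos hX hw hx h0⟩

end Reject

end Tests

/-! ### The direct part: superposition coding with indirect decoding. -/

section Achievability

variable {m m' : ℕ} {𝒰 𝒱 𝒳 : Type*} {𝒴 : Fin (m + 1) → Type*} {𝒴' : Fin (m' + 1) → Type*}
  [Fintype 𝒰] [Fintype 𝒱] [Fintype 𝒳] [∀ i, Fintype (𝒴 i)] [∀ j, Fintype (𝒴' j)]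
  {ch : Channel 𝒳 𝒴 𝒴'} {pU : 𝒰 → ℝ} {pV : 𝒰 → 𝒱 → ℝ} {pX : 𝒱 → 𝒳 → ℝ}

/-- Superposition coding: the common message is encoded in `U`, a part of rate `S₁` of the private
message in `V`, and the rest of it in `X`. The receivers `Y' j` decode the common message from `V`,
without decoding the private part uniquely. -/
theorem Channel.achievable_of_lt (hU : pU ∈ stdSimplex ℝ 𝒰) (hV : ∀ u, pV u ∈ stdSimplex ℝ 𝒱)
    (hX : ∀ v, pX v ∈ stdSimplex ℝ 𝒳) {R₀ S₁ S₂ : ℝ} (hS₁ : 0 ≤ S₁) (hS₂ : 0 ≤ S₂)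
    (hY : ∀ i, ∃ γ < mutualInfo (ch.joint (pairPmf pU pV) pX) (fun ω => ω.1)
      (fun ω => ω.2.2.2.1 i), R₀ = 0 ∨ R₀ < γ)
    (hY' : ∀ j, ∃ γ < mutualInfo (ch.joint (pairPmf pU pV) pX) (fun ω => ω.2.1)
      (fun ω => ω.2.2.2.2 j), R₀ = 0 ∨ R₀ + S₁ < γ)
    (hXU : ∃ γ < condMutualInfo (ch.joint (pairPmf pU pV) pX) (fun ω => ω.2.2.1)
      (fun ω => ω.2.2.2.1 0) (fun ω => ω.1), S₁ = 0 ∨ S₁ + S₂ < γ)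
    (hXV : ∃ γ < condMutualInfo (ch.joint (pairPmf pU pV) pX) (fun ω => ω.2.2.1)
      (fun ω => ω.2.2.2.1 0) (fun ω => ω.2.1), S₂ = 0 ∨ S₂ < γ) :
    ch.Achievable R₀ (S₁ + S₂) := by
  choose γ hγ hRγ using hY
  choose γ' hγ' hRγ' using hY'
  obtain ⟨γ₁, hγ₁, hRγ₁⟩ := hXU
  obtain ⟨γ₂, hγ₂, hRγ₂⟩ := hXV
  choose θ hθ0 hθ1 hθ using fun i => exists_testU_reject_le (fun z => z.1 i) hU hV hX (hγ i)
  choose θ' hθ'0 hθ'1 hθ' using fun j => exists_testV_reject_le (fun z => z.2 j) hU hV hX (hγ' j)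
  obtain ⟨η, hη0, hη1, hη⟩ := exists_testXU_reject_le (fun z => z.1 0) hU hV hX hγ₁
  obtain ⟨η', hη'0, hη'1, hη'⟩ := exists_testXV_reject_le (fun z => z.1 0) hU hV hX hγ₂
  -- The eight terms match the events of `Confusion`: four kinds of rejection, then false acceptance
  -- of another u, another v, another branch and another leaf.
  obtain ⟨B, hB⟩ : ∃ B : ℕ → ℝ, B = fun n => (((∑ i, θ i ^ n + ∑ j, θ' j ^ n) + (η ^ n + η' ^ n)) +
    (∑ i, ((Fintype.card (Msg n R₀) - 1 : ℕ) : ℝ) * ((2 : ℝ) ^ ((n : ℝ) * γ i))⁻¹ +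
    ∑ j, ((Fintype.card (Msg n R₀) - 1 : ℕ) : ℝ) * (Fintype.card (Msg n S₁) *
      ((2 : ℝ) ^ ((n : ℝ) * γ' j))⁻¹))) +
    (((Fintype.card (Msg n S₁) - 1 : ℕ) : ℝ) * (Fintype.card (Msg n S₂) *
      ((2 : ℝ) ^ ((n : ℝ) * γ₁))⁻¹) +
    ((Fintype.card (Msg n S₂) - 1 : ℕ) : ℝ) * ((2 : ℝ) ^ ((n : ℝ) * γ₂))⁻¹) := ⟨_, rfl⟩
  have hB0 : Tendsto B atTop (𝓝 0) := by
    have t1 : Tendsto (fun n => ∑ i, θ i ^ n) atTop (𝓝 0) := by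
      simpa using tendsto_finsetSum univ fun i _ =>
        tendsto_pow_atTop_nhds_zero_of_lt_one (hθ0 i) (hθ1 i)
    have t2 : Tendsto (fun n => ∑ j, θ' j ^ n) atTop (𝓝 0) := by
      simpa using tendsto_finsetSum univ fun j _ =>
        tendsto_pow_atTop_nhds_zero_of_lt_one (hθ'0 j) (hθ'1 j)
    have t3 := tendsto_pow_atTop_nhds_zero_of_lt_one hη0 hη1
    have t4 := tendsto_pow_atTop_nhds_zero_of_lt_one hη'0 hη'1
    have t5 := tendsto_finsetSum univ fun i (_ : i ∈ univ) =>
      tendsto_card_msg_sub_one_mul_inv (hRγ i)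
    have t6 := tendsto_finsetSum univ fun j (_ : j ∈ univ) =>
      tendsto_card_msg_sub_one_mul hS₁ (hRγ' j)
    have t7 := tendsto_card_msg_sub_one_mul hS₂ hRγ₁
    have t8 := tendsto_card_msg_sub_one_mul_inv hRγ₂
    rw [hB]
    simpa using (((t1.add t2).add (t3.add t4)).add (t5.add t6)).add (t7.add t8)
  have key : ∀ n, ∃ c : Code 𝒳 𝒴 𝒴' n R₀ (S₁ + S₂), c.errorProb ch ≤ B n := by
    intro n
    have hUn : (piPmf fun _ : Fin n => pU) ∈ stdSimplex ℝ (Fin n → 𝒰) :=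
      piPmf_mem_stdSimplex fun _ => hU
    have hVn : ∀ u : Fin n → 𝒰, (piPmf fun k => pV (u k)) ∈ stdSimplex ℝ (Fin n → 𝒱) := fun u =>
      piPmf_mem_stdSimplex fun k => hV (u k)
    have hXn : ∀ v : Fin n → 𝒱, (piPmf fun k => pX (v k)) ∈ stdSimplex ℝ (Fin n → 𝒳) := fun v =>
      piPmf_mem_stdSimplex fun k => hX (v k)
    have hWn : ∀ x : Fin n → 𝒳, (piPmf fun k => ch.W (x k)) ∈ stdSimplex ℝ (Fin n → _) := fun x =>
      piPmf_mem_stdSimplex fun k => ch.isPmf (x k)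
    obtain ⟨s, hs⟩ := exists_injective_msg n S₁ S₂
    set w : ∀ i, 𝒳 → 𝒴 i → ℝ := fun i => outLaw ch.W fun z => z.1 i with hw
    set w' : ∀ j, 𝒳 → 𝒴' j → ℝ := fun j => outLaw ch.W fun z => z.2 j with hw'
    have hw0 : ∀ i x y, 0 ≤ w i x y := fun i => outLaw_nonneg ch.isPmf _
    have hw'0 : ∀ j x y, 0 ≤ w' j x y := fun j => outLaw_nonneg ch.isPmf _
    obtain ⟨C, hC⟩ := exists_codebook (ℳ := Msg n R₀) hUn hVn hXn (fun x => (hWn x).1) s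
      (fun i u z => TestU pU pV pX (w i) n (γ i) u fun t => (z t).1 i)
      (fun j v z => TestV pU pV pX (w' j) n (γ' j) v fun t => (z t).2 j)
      (fun u x z => TestXU pV pX (w 0) n γ₁ u x fun t => (z t).1 0)
      (fun v x z => TestXV pX (w 0) n γ₂ v x fun t => (z t).1 0)
    obtain ⟨c, hc, hE⟩ := exists_code_isError_confusion n C hs
      (fun i u y => TestU pU pV pX (w i) n (γ i) u y)
      (fun j v y => TestV pU pV pX (w' j) n (γ' j) v y)
      (fun u x y => TestXU pV pX (w 0) n γ₁ u x y) (fun v x y => TestXV pX (w 0) n γ₂ v x y)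
    refine ⟨c, (c.errorProb_le (ch := ch) hE).trans ?_⟩
    simp only [hc]
    refine hC.trans ?_
    simp only [hB]
    gcongr with i _ j _ i _ j _
    · exact hθ i n
    · exact hθ' j n
    · exact hη n
    · exact hη' n
    · exact exJoint_le hUn hVn hXn hWn fun _ _ _ z => ex_testU_le hU hV hX (hw0 i) n _ _
    · exact exJoint_le hUn hVn hXn hWn fun _ _ _ z => ex_testV_le hU hV hX (hw'0 j) n _ _
    · exact exJoint_le hUn hVn hXn hWn fun u _ _ z => ex_testXU_le hV hX (hw0 0) n _ u _
    · exact exJoint_le hUn hVn hXn hWn fun _ v _ z => ex_testXV_le hX (hw0 0) n _ v _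
  choose c hc using key
  refine ⟨c, squeeze_zero (fun n => ?_) hc hB0⟩
  unfold Code.errorProb
  refine div_nonneg (sum_nonneg fun _ _ => sum_nonneg fun _ _ => sum_nonneg fun z _ => ?_)
    (by positivity)
  split_ifs
  · exact prod_nonneg fun t _ => (ch.isPmf _).1 _
  · exact le_rfl

/-- Scaling by `t < 1` makes room for a strict inequality unless `a = 0`; a zero rate leaves no
wrong message, and any `γ < I` serves. -/
theorem exists_lt_of_mul_lt {a I t : ℝ} (ha : 0 ≤ a) (hI : a ≤ I) (ht : t < 1) :
    ∃ γ < I, t * a = 0 ∨ t * a < γ := by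
  rcases ha.eq_or_lt with rfl | ha
  · exact ⟨I - 1, by linarith, Or.inl (mul_zero t)⟩
  · obtain ⟨γ, h1, h2⟩ := exists_between (show t * a < I by nlinarith)
    exact ⟨γ, h2, Or.inr h1⟩

/-- The direct part, for auxiliary variables `U → V → X` given by transition pmfs. -/
theorem Channel.RateBounds.mem_capacityRegion (hU : pU ∈ stdSimplex ℝ 𝒰)
    (hV : ∀ u, pV u ∈ stdSimplex ℝ 𝒱) (hX : ∀ v, pX v ∈ stdSimplex ℝ 𝒳)
    (hdeg : ∀ i, IsDegraded ch.W (fun z => z.1 i) fun z => z.1 (Fin.last m))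
    (hdeg' : ∀ j, IsDegraded ch.W (fun z => z.2 j) fun z => z.2 (Fin.last m'))
    {R : ℝ × ℝ} (h₀ : 0 ≤ R.1) (h₁ : 0 ≤ R.2) (h : ch.RateBounds R.1 R.2 (pairPmf pU pV) pX) :
    R ∈ ch.capacityRegion := by
  obtain ⟨b1, b2, b3, b4⟩ := h
  have hP : ch.joint (pairPmf pU pV) pX ∈ stdSimplex ℝ _ :=
    joint_mem_stdSimplex (pairPmf_mem_stdSimplex hU hV) hX
  have hO := isOutput_joint ch (pairPmf pU pV) pX
  have hI := fun i => (hO.comp fun x => x.1).mutualInfo_degraded_le hP (hdeg i)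
  have hI' := fun j => (hO.comp fun x => x.2).mutualInfo_degraded_le hP (hdeg' j)
  set K := condMutualInfo (ch.joint (pairPmf pU pV) pX) (fun ω => ω.2.2.1)
    (fun ω => ω.2.2.2.1 0) (fun ω => ω.2.1) with hK
  have hK0 : 0 ≤ K := condMutualInfo_nonneg hP _ _ _
  -- The top layer takes as much private rate as it can carry. The remainder `R.2 - S₂` is 0 or `R.2
  -- - K`, so the bound on `R.1 + (R.2 - S₂)` is the one on `R.1` or the one on the sum rate.
  set S₂ := min R.2 K with hS₂
  have hS₂0 : 0 ≤ S₂ := le_min h₁ hK0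
  have hS₂R : S₂ ≤ R.2 := min_le_left _ _
  have key : ∀ t : ℝ, 0 ≤ t → t < 1 →
      0 ≤ t * R.1 ∧ 0 ≤ t * R.2 ∧ ch.Achievable (t * R.1) (t * R.2) := by
    intro t ht0 ht1
    refine ⟨mul_nonneg ht0 h₀, mul_nonneg ht0 h₁, ?_⟩
    have hsum : t * R.2 = t * (R.2 - S₂) + t * S₂ := by ring
    rw [hsum]
    refine Channel.achievable_of_lt hU hV hX (mul_nonneg ht0 (by linarith)) (mul_nonneg ht0 hS₂0)
      (fun i => exists_lt_of_mul_lt h₀ (b1.trans (hI i)) ht1) (fun j => ?_) ?_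
      (exists_lt_of_mul_lt hS₂0 (min_le_right _ _) ht1)
    · have hle : R.1 + (R.2 - S₂) ≤ mutualInfo (ch.joint (pairPmf pU pV) pX) (fun ω => ω.2.1)
          (fun ω => ω.2.2.2.2 (Fin.last m')) := by
        rcases min_choice R.2 K with h | h <;> rw [← hS₂] at h <;> rw [h]
        · linarith
        · linarith
      obtain ⟨γ, hγ, h⟩ := exists_lt_of_mul_lt (t := t) (by linarith) (hle.trans (hI' j)) ht1
      refine ⟨γ, hγ, ?_⟩
      rw [mul_add] at h
      rcases h with h | h
      · left
        have := mul_nonneg ht0 h₀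
        have := mul_nonneg ht0 (sub_nonneg.2 hS₂R)
        linarith
      · exact Or.inr h
    · obtain ⟨γ, hγ, h⟩ := exists_lt_of_mul_lt (t := t) h₁ b3 ht1
      refine ⟨γ, hγ, ?_⟩
      rw [hsum] at h
      rcases h with h | h
      · left
        have := mul_nonneg ht0 hS₂0
        have := mul_nonneg ht0 (sub_nonneg.2 hS₂R)
        linarith
      · exact Or.inr h
  have hlim : Tendsto (fun t : ℝ => (t * R.1, t * R.2)) (𝓝[<] 1) (𝓝 R) := by
    have hc : Continuous fun t : ℝ => (t * R.1, t * R.2) := by fun_prop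
    have := hc.tendsto 1
    simp only [one_mul] at this
    exact this.mono_left nhdsWithin_le_nhds
  refine mem_closure_of_tendsto hlim ?_
  filter_upwards [Ioo_mem_nhdsLT (show (0 : ℝ) < 1 by norm_num)] with t ht
  exact key t ht.1.le ht.2

end Achievability

end MultilevelBC

theorem theorem16 {m m' : ℕ} {𝒳 : Type*} {𝒴 : Fin (m + 1) → Type*} {𝒴' : Fin (m' + 1) → Type*}
    [Fintype 𝒳] [Nonempty 𝒳] [∀ i, Fintype (𝒴 i)] [∀ j, Fintype (𝒴' j)]
    (ch : MultilevelBC.Channel 𝒳 𝒴 𝒴') (hch : ch.IsMultilevel) :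
    ch.capacityRegion =
      {R : ℝ × ℝ | 0 ≤ R.1 ∧ 0 ≤ R.2 ∧
        ∃ (a b : ℕ) (p : Fin a × Fin b → ℝ) (q : Fin b → 𝒳 → ℝ),
          p ∈ stdSimplex ℝ (Fin a × Fin b) ∧ (∀ v, q v ∈ stdSimplex ℝ 𝒳) ∧
          let P := ch.joint p q
          let U := fun ω : Fin a × Fin b × 𝒳 × (∀ i, 𝒴 i) × (∀ j, 𝒴' j) => ω.1
          let V := fun ω : Fin a × Fin b × 𝒳 × (∀ i, 𝒴 i) × (∀ j, 𝒴' j) => ω.2.1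
          let X := fun ω : Fin a × Fin b × 𝒳 × (∀ i, 𝒴 i) × (∀ j, 𝒴' j) => ω.2.2.1
          let Y := fun i (ω : Fin a × Fin b × 𝒳 × (∀ i, 𝒴 i) × (∀ j, 𝒴' j)) => ω.2.2.2.1 i
          let Y' := fun j (ω : Fin a × Fin b × 𝒳 × (∀ i, 𝒴 i) × (∀ j, 𝒴' j)) => ω.2.2.2.2 j
          R.1 ≤ min (MultilevelBC.mutualInfo P U (Y (Fin.last m)))
              (MultilevelBC.mutualInfo P V (Y' (Fin.last m'))) ∧
          R.2 ≤ MultilevelBC.condMutualInfo P X (Y 0) U ∧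
          R.1 + R.2 ≤ MultilevelBC.mutualInfo P V (Y' (Fin.last m')) +
              MultilevelBC.condMutualInfo P X (Y 0) V} := by
  have hcard : (0 : ℝ) < Fintype.card 𝒳 := by exact_mod_cast Fintype.card_pos
  -- The uniform input has full support, so its Markov chains alone fix the degrading kernels.
  have hp : (fun _ : 𝒳 => (Fintype.card 𝒳 : ℝ)⁻¹) ∈ stdSimplex ℝ 𝒳 := ⟨fun _ => by positivity, by
    rw [Finset.sum_const, Finset.card_univ, nsmul_eq_mul, mul_inv_cancel₀ hcard.ne']⟩
  obtain ⟨hY, hY'⟩ := hch _ hp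
  have hdeg : ∀ i, MultilevelBC.IsDegraded ch.W (fun z => z.1 i) fun z => z.1 (Fin.last m) :=
    fun i => MultilevelBC.isDegraded_of_isMarkovChain ch.isPmf hp (fun _ => by positivity)
      (fun i z => z.1 i) hY (Fin.le_last i)
  have hdeg' : ∀ j, MultilevelBC.IsDegraded ch.W (fun z => z.2 j) fun z => z.2 (Fin.last m') :=
    fun j => MultilevelBC.isDegraded_of_isMarkovChain ch.isPmf hp (fun _ => by positivity)
      (fun j z => z.2 j) hY' (Fin.le_last j)
  ext R
  constructor
  · intro hR
    obtain ⟨h0, h1, a, b, p, q, hp, hq, b1, b2, b3, b4⟩ :=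
      ch.exists_rateBounds_of_mem_capacityRegion (hdeg 0) hR
    exact ⟨h0, h1, a, b, p, q, hp, hq, le_min b1 b2, b3, b4⟩
  · rintro ⟨h0, h1, a, b, p, q, hp, hq, b12, b3, b4⟩
    obtain ⟨b1, b2⟩ := le_min_iff.1 b12
    have hne : Nonempty (Fin b) := by
      by_contra hb
      have hempty : IsEmpty (Fin b) := not_nonempty_iff.1 hb
      have := hp.2
      simp at this
    -- Random coding draws V from a kernel given U, which must be a pmf also at values of U of
    -- probability zero.
    obtain ⟨k, hk, hpk⟩ := MultilevelBC.exists_kernel p hp.1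
    have hpair : p = MultilevelBC.pairPmf (fun u => ∑ v, p (u, v)) k := by
      ext x
      exact hpk x.1 x.2
    have hU : (fun u => ∑ v, p (u, v)) ∈ stdSimplex ℝ (Fin a) :=
      ⟨fun u => Finset.sum_nonneg fun v _ => hp.1 _, by rw [← Fintype.sum_prod_type]; exact hp.2⟩
    have hb : ch.RateBounds R.1 R.2 p q := ⟨b1, b2, b3, b4⟩
    rw [hpair] at hb
    exact hb.mem_capacityRegion hU hk hq hdeg hdeg' h0 h1
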